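/- Let $s>\frac52$ and let $u\in C([0,\infty);H^s_{df}(\mathbb R^3))$ be an axisymmetric, swirl-free solution of the incompressible Euler equation $\partial_t u+(u\cdot\nabla)u+\nabla p=0$, $\nabla\cdot u=0$ on $\mathbb R^3$, not identically zero. Here $H^s_{df}(\mathbb R^3)$ is the space of divergence-free vector fields in $H^s(\mathbb R^3;\mathbb R^3)$, and axisymmetric, swirl-free means $u(x,t)=u_r(r,z,t)e_r+u_z(r,z,t)e_z$ in cylindrical coordinates, so that the vorticity is $\nabla\times u=\omega_\theta(r,z,t)e_\theta$. Suppose that the initial vorticity $\omega^0_\theta=\omega_\theta(\cdot,\cdot,0)$ is odd in $z$, that its support is compact in $\{(r,z):r\ge 0\}$ and disjoint from $\{r=0\}$ and $\{z=0\}$, and that $\omega^0_\theta(r,z)\le 0$ for all $r,z\ge 0$. For $t\ge 0$ let $\Omega_+(t)=\operatorname{supp}\omega_\theta(\cdot,\cdot,t)\cap\{z\ge 0\}$ and $$\kappa(t)=\frac1{2\pi}\inf_{(r,z),(\bar r,\bar z)\in\Omega_+(t)}\int_0^1\frac{(z+\bar z)\,\sigma(1-\sigma^2)^{-1/2}}{r\bar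 r}\left(\frac1{\left((z+\bar z)^2+r^2+\bar r^2-2r\bar r\sigma\right)^{3/2}}-\frac1{\left((z+\bar z)^2+r^2+\bar r^2+2r\bar r\sigma\right)^{3/2}}\right)d\sigma,$$ and let $$Q^0=-\int_0^\infty\int_0^\infty r^2\omega^0_\theta(r,z)\,dr\,dz .$$ Then $Q^0>0$, $\kappa(t)>0$ for all $t\ge 0$, $\kappa$ is integrable on $(0,\infty)$, and $$\int_0^\infty\kappa(t)\,dt\le\frac1{2Q^0}.$$ -/

import Mathlib

open MeasureTheory Set Filter Topology FourierTransform

noncomputable section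

namespace AxisymEuler

/-- Physical space `ℝ³`; the coordinates are `x 0 = x₁`, `x 1 = x₂`, `x 2 = x₃ = z`. -/
abbrev R3 : Type := EuclideanSpace ℝ (Fin 3)

/-- Complexified vectors, in which Fourier transforms take their values. -/
abbrev C3 : Type := EuclideanSpace ℂ (Fin 3)

/-! ### Sobolev spaces of vector fields -/

/-- A real vector field regarded as a complex one. -/
def complexify (v : R3 → R3) (x : R3) : C3 :=
  WithLp.toLp 2 (fun i => ((v x i : ℝ) : ℂ))

open Classical in
/-- The `L²` (Plancherel) Fourier transform of a square integrable vector field,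
with the convention `v̂ ξ = ∫ v x * exp (-2 π i x·ξ) dx`. Only used for `v ∈ L²`. -/
def fourierL2 (v : R3 → R3) : R3 → C3 :=
  if h : MemLp (complexify v) 2 (volume : Measure R3) then
    ((𝓕 (h.toLp (complexify v)) : Lp C3 2 (volume : Measure R3)) : R3 → C3)
  else 0

/-- The `H^s` norm `(∫ (1 + 4π²|ξ|²)^s |v̂ ξ|² dξ)^(1/2)`, with values in `[0, ∞]`. -/
def hsNorm (s : ℝ) (v : R3 → R3) : ENNReal :=
  (∫⁻ ξ : R3, ENNReal.ofReal ((1 + 4 * Real.pi ^ 2 * ‖ξ‖ ^ 2) ^ s) * ‖fourierL2 v ξ‖ₑ ^ 2)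
    ^ (1 / 2 : ℝ)

/-- Membership in `H^s(ℝ³; ℝ³)`, for `s ≥ 0`. -/
def MemHs (s : ℝ) (v : R3 → R3) : Prop :=
  MemLp (complexify v) 2 (volume : Measure R3) ∧ hsNorm s v < ⊤

/-- Membership in `H^s_df`, the divergence free fields of `H^s`: `ξ · v̂ ξ = 0`. -/
def MemHsdf (s : ℝ) (v : R3 → R3) : Prop :=
  MemHs s v ∧ ∀ᵐ ξ : R3, ∑ i : Fin 3, ((ξ i : ℝ) : ℂ) * fourierL2 v ξ i = 0

/-- `u ∈ C([0,∞); H^s_df(ℝ³))`. For `s > 3/2` each time slice is identified with its continuous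
representative. -/
structure MemCHsdf (s : ℝ) (u : ℝ → R3 → R3) : Prop where
  continuous_slice : ∀ t, 0 ≤ t → Continuous (u t)
  mem : ∀ t, 0 ≤ t → MemHsdf s (u t)
  continuous_time : ∀ t, 0 ≤ t →
    Tendsto (fun τ => hsNorm s (fun x => u τ x - u t x)) (𝓝[Ici 0] t) (𝓝 0)

/-! ### Vector calculus and the Euler equation -/

/-- The partial derivative `∂ᵢ vⱼ` at `x`. -/
def pderiv (v : R3 → R3) (i j : Fin 3) (x : R3) : ℝ :=
  fderiv ℝ v x (EuclideanSpace.single i 1) j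

/-- The divergence `∇ · v`. -/
def divergence (v : R3 → R3) (x : R3) : ℝ := ∑ i : Fin 3, pderiv v i i x

/-- The curl `∇ × v`. -/
def curl (v : R3 → R3) (x : R3) : R3 :=
  !₂[pderiv v 1 2 x - pderiv v 2 1 x,
     pderiv v 2 0 x - pderiv v 0 2 x,
     pderiv v 0 1 x - pderiv v 1 0 x]

/-- `(u · ∇) v`. -/
def advect (u v : R3 → R3) (x : R3) : R3 := fderiv ℝ v x (u x)

/-- `∂ₜ u = w` at time `t`, as a limit of difference quotients in `L²(ℝ³; ℝ³)`. -/
def HasL2DerivAt (u : ℝ → R3 → R3) (w : R3 → R3) (t : ℝ) : Prop :=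
  Tendsto (fun h : ℝ => eLpNorm (fun x => h⁻¹ • (u (t + h) x - u t x) - w x) 2
    (volume : Measure R3)) (𝓝[≠] 0) (𝓝 0)

/-- `u` is a global solution in `C([0,∞); H^s_df)` of the Euler equation
`∂ₜ u + (u·∇)u + ∇p = 0`, `∇·u = 0`, for some pressure `p`. -/
structure IsGlobalEulerSolution (s : ℝ) (u : ℝ → R3 → R3) : Prop where
  regular : MemCHsdf s u
  incompressible : ∀ t, 0 ≤ t → ∀ x, divergence (u t) x = 0
  momentum : ∃ p : ℝ → R3 → ℝ, ∀ t, 0 < t →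
    ContDiff ℝ 1 (p t) ∧
    HasL2DerivAt u (fun x => -(advect (u t) (u t) x) - gradient (p t) x) t

/-! ### Axisymmetric, swirl-free fields -/

/-- The distance `r` to the axis. -/
def radius (x : R3) : ℝ := Real.sqrt (x 0 ^ 2 + x 1 ^ 2)

/-- The radial unit vector `e_r` (set to `0` on the axis, where it is undefined). -/
def eR (x : R3) : R3 := !₂[x 0 / radius x, x 1 / radius x, 0]

/-- The vertical unit vector `e_z`. -/
def eZ : R3 := !₂[0, 0, 1]

/-- `v x = v_r(r,z) e_r + v_z(r,z) e_z`. -/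
def IsAxisymmetricSwirlFree (v : R3 → R3) : Prop :=
  ∃ vr vz : ℝ → ℝ → ℝ, ∀ x : R3,
    v x = vr (radius x) (x 2) • eR x + vz (radius x) (x 2) • eZ

/-- The angular vorticity `ω_θ(r,z)` of an axisymmetric, swirl-free velocity `v`, for `r ≥ 0`.
The vorticity is `ω = ω_θ(r,z) e_θ`; this reads off `ω · e_θ` in the half plane `θ = 0`, where
`e_θ = (0,1,0)`. -/
def omegaTheta (v : R3 → R3) (r z : ℝ) : ℝ := curl v !₂[r, 0, z] 1

/-- The support `Ω` of `ω_θ` in the half plane `Π = {(r,z) : r ≥ 0}`. -/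
def vortSupport (v : R3 → R3) : Set (ℝ × ℝ) :=
  closure {q : ℝ × ℝ | 0 ≤ q.1 ∧ omegaTheta v q.1 q.2 ≠ 0}

/-- `Ω₊ = Ω ∩ {z ≥ 0}`. -/
def vortSupportUpper (v : R3 → R3) : Set (ℝ × ℝ) :=
  vortSupport v ∩ {q : ℝ × ℝ | 0 ≤ q.2}

/-- The interaction kernel of two points `p = (r,z)` and `q = (r̄,z̄)`. -/
def kernel (p q : ℝ × ℝ) : ℝ :=
  ∫ s in (0 : ℝ)..1,
    (p.2 + q.2) * s * (1 - s ^ 2) ^ (-(1 / 2) : ℝ) / (p.1 * q.1) *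
      (1 / ((p.2 + q.2) ^ 2 + p.1 ^ 2 + q.1 ^ 2 - 2 * p.1 * q.1 * s) ^ (3 / 2 : ℝ)
        - 1 / ((p.2 + q.2) ^ 2 + p.1 ^ 2 + q.1 ^ 2 + 2 * p.1 * q.1 * s) ^ (3 / 2 : ℝ))

/-- `κ = (1/2π) inf` of the kernel over pairs of points of `Ω₊`. -/
def kappa (v : R3 → R3) : ℝ :=
  1 / (2 * Real.pi) *
    sInf ((fun pq : (ℝ × ℝ) × (ℝ × ℝ) => kernel pq.1 pq.2) ''
      (vortSupportUpper v ×ˢ vortSupportUpper v))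

/-- `Q = -∫₀^∞ ∫₀^∞ r² ω_θ(r,z) dr dz`. -/
def Q (v : R3 → R3) : ℝ :=
  -∫ z in Ioi (0 : ℝ), ∫ r in Ioi (0 : ℝ), r ^ 2 * omegaTheta v r z

end AxisymEuler

end

/-!
The solution is regular enough (Sobolev embedding, `s > 5/2`) to be treated classically in space:
`u` and `∇u` are bounded and continuous in time, uniformly in space. Uniqueness in the energy class
(`RegularSolution.eq_of_eq_zero`), applied to `u` and its mirror image, shows that the vorticity
stays odd in `z`. The vorticity is only continuous, so the transport of `ω_θ / r` is first obtained
weakly, for the impulse density `Γ = r ω_θ` against test functions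
(`RegularSolution.hasDerivAt_integral_impulse`), and then along trajectories by mollification
around a moving point, the commutator with the flow being controlled by the modulus of continuity
of `Γ` (`RegularSolution.impulse_trajectory`). As trajectories change `r` and `z` by at most
exponential factors, the vorticity keeps its sign and stays in a compact set away from the axis
and the plane `z = 0` (`OddVortex`, `RegularSolution.oddVortex`). In particular `Q > 0` and, the
kernel being continuous and positive, `κ > 0` at all times.

The weak equation also gives `Q' = -(1/π) ∫_{z > 0} u_r ω_θ` (`RegularSolution.hasDerivAt_Q`). By
the Biot–Savart law (`biotSavart_horizontal`, regularized at scale `ε` by the field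
`y (ε² + |y|²)^(-3/2)`), this is a double integral over pairs of points. Pairs in the same half
space cancel by antisymmetry of the kernel, and oddness turns the remaining pairs into an
interaction of the upper vorticity with itself through the reflected kernel
(`integral_mul_of_biotSavart`, `OddVortex.integral_upperLamb`). Integrating over the angles turns
the reflected kernel into the function `kernel` in the definition of `κ` (`integral_circle`,
`kernel_eq`), and since all values of `ω_θ` in question are nonpositive, bounding the kernel below
by its infimum gives `Q' ≥ 2 κ Q²` (`OddVortex.kappa_mul_Q_sq_le`). Hence `(-1/(2Q))' ≥ κ`, which
integrates to the bound. Measurability of `κ` in time follows from upper semicontinuity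
(`RegularSolution.isOpen_kappa_lt`): points where the vorticity does not vanish persist for short
times.
-/

open MeasureTheory Set Filter Topology FourierTransform

noncomputable section

namespace AxisymEuler

open scoped ContDiff SchwartzMap LineDeriv



/-! ### The Sobolev embedding -/

/-- The Fourier inversion formula for square integrable functions whose transform is integrable. -/
theorem ae_eq_fourierInv_of_integrable {F : Type*} [NormedAddCommGroup F] [InnerProductSpace ℂ F]
    [CompleteSpace F] (V : Lp F 2 (volume : Measure R3))
    (hf : Integrable ((𝓕 V : Lp F 2 (volume : Measure R3)) : R3 → F)) :
    ∀ᵐ x, V x = 𝓕⁻ ((𝓕 V : Lp F 2 (volume : Measure R3)) : R3 → F) x := by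
  set f : Lp F 2 (volume : Measure R3) := 𝓕 V with hfdef
  have hcont : Continuous (𝓕⁻ (f : R3 → F)) := by
    rw [Real.fourierInv_eq_fourier_comp_neg]
    exact VectorFourier.fourierIntegral_continuous Real.continuous_fourierChar
      (by exact continuous_inner) hf.comp_neg
  refine ae_eq_of_integral_contDiff_smul_eq
    ((Lp.memLp V).locallyIntegrable (by norm_num)) hcont.locallyIntegrable ?_
  intro ψ hψ hψc
  let φ : 𝓢(R3, ℂ) := (hψc.comp_left (g := fun a : ℝ => (a : ℂ)) (by simp)).toSchwartzMap
    (Complex.ofRealCLM.contDiff.comp hψ)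
  have hφ : ∀ x, φ x = (ψ x : ℂ) := fun x => rfl
  have h1 : V = 𝓕⁻ f := by simp [hfdef]
  have h2 : (V : 𝓢'(R3, F)) φ = (f : 𝓢'(R3, F)) (𝓕⁻ φ) := by
    conv_lhs => rw [h1, ← Lp.fourierInv_toTemperedDistribution_eq]
    rfl
  rw [Lp.toTemperedDistribution_apply, Lp.toTemperedDistribution_apply] at h2
  have h3 := VectorFourier.integral_fourierIntegral_smul_eq_flip (μ := (volume : Measure R3))
    (ν := (volume : Measure R3)) (L := -innerₗ R3) (e := Real.fourierChar)
    (f := φ) (g := (f : R3 → F)) Real.continuous_fourierChar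
    (by exact (continuous_inner (𝕜 := ℝ) (E := R3)).neg) φ.integrable hf
  calc ∫ x, ψ x • V x = ∫ x, φ x • V x := by
        refine integral_congr_ae (Eventually.of_forall fun x => ?_)
        simp only [hφ]
        exact (Complex.coe_smul _ _).symm
    _ = _ := h2
    _ = ∫ x, φ x • 𝓕⁻ (f : R3 → F) x := by
        refine Eq.trans ?_ (h3.trans ?_)
        · refine integral_congr_ae (Eventually.of_forall fun x => ?_)
          simp only [SchwartzMap.fourierInv_coe]
          rfl
        · refine integral_congr_ae (Eventually.of_forall fun x => ?_)
          simp only [Real.fourierInv_eq, VectorFourier.fourierIntegral]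
          congr 2
          ext v
          simp [real_inner_comm]
    _ = _ := by
        refine integral_congr_ae (Eventually.of_forall fun x => ?_)
        simp only [hφ]
        exact (Complex.coe_smul _ _)

/-- The Cauchy-Schwarz estimate behind the Sobolev embedding `H^s ⊂ C¹`, `s > 5/2`. -/
theorem exists_lintegral_weight_le (s : ℝ) (hs : 5 / 2 < s) :
    ∃ C : ENNReal, C < ⊤ ∧ ∀ f : R3 → C3, AEStronglyMeasurable f volume →
      ∫⁻ ξ, ENNReal.ofReal (1 + ‖ξ‖) * ‖f ξ‖ₑ ≤
        C * (∫⁻ ξ : R3, ENNReal.ofReal ((1 + 4 * Real.pi ^ 2 * ‖ξ‖ ^ 2) ^ s) * ‖f ξ‖ₑ ^ 2)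
          ^ (1 / 2 : ℝ) := by
  refine ⟨(∫⁻ ξ : R3, ENNReal.ofReal ((1 + ‖ξ‖) * (1 + 4 * Real.pi ^ 2 * ‖ξ‖ ^ 2) ^ (-(s / 2)))
    ^ (2 : ℝ)) ^ (1 / 2 : ℝ), ?_, ?_⟩
  -- `(1 + ‖ξ‖)² (1 + ‖ξ‖²)^(-s)` is integrable because `2 s - 2 > 3`
  · refine ENNReal.rpow_lt_top_of_nonneg (by norm_num) (ne_of_lt ?_)
    have hint : Integrable (fun ξ : R3 => 2 * ((1 : ℝ) + ‖ξ‖ ^ 2) ^ (-(2 * s - 2) / 2)) :=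
      (integrable_rpow_neg_one_add_norm_sq (by simp; linarith)).const_mul 2
    refine lt_of_le_of_lt (lintegral_mono fun ξ => ?_) hint.lintegral_lt_top
    rw [ENNReal.ofReal_rpow_of_nonneg (by positivity) (by norm_num)]
    refine ENNReal.ofReal_le_ofReal ?_
    rw [Real.mul_rpow (by positivity) (by positivity), ← Real.rpow_mul (by positivity)]
    have hW : (1 : ℝ) + ‖ξ‖ ^ 2 ≤ 1 + 4 * Real.pi ^ 2 * ‖ξ‖ ^ 2 := by
      have : (1 : ℝ) ≤ 4 * Real.pi ^ 2 := by nlinarith [Real.pi_gt_three]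
      nlinarith [sq_nonneg ‖ξ‖]
    have h1 : (1 + 4 * Real.pi ^ 2 * ‖ξ‖ ^ 2) ^ (-(s / 2) * 2) ≤ (1 + ‖ξ‖ ^ 2) ^ (-(s / 2) * 2) :=
      Real.rpow_le_rpow_of_nonpos (by positivity) hW (by linarith)
    have h2 : (1 + ‖ξ‖) ^ (2 : ℝ) ≤ 2 * (1 + ‖ξ‖ ^ 2) := by
      rw [Real.rpow_two]; nlinarith [sq_nonneg (1 - ‖ξ‖)]
    calc (1 + ‖ξ‖) ^ (2 : ℝ) * (1 + 4 * Real.pi ^ 2 * ‖ξ‖ ^ 2) ^ (-(s / 2) * 2)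
        ≤ (2 * (1 + ‖ξ‖ ^ 2)) * (1 + ‖ξ‖ ^ 2) ^ (-(s / 2) * 2) := by gcongr
      _ = 2 * ((1 : ℝ) + ‖ξ‖ ^ 2) ^ (-(2 * s - 2) / 2) := by
          rw [mul_assoc, ← Real.rpow_one_add' (by positivity) (by linarith)]
          congr 2; ring
  · intro f hf
    have hmeas : AEMeasurable (fun ξ : R3 =>
        ENNReal.ofReal ((1 + ‖ξ‖) * (1 + 4 * Real.pi ^ 2 * ‖ξ‖ ^ 2) ^ (-(s / 2)))) volume := by
      fun_prop
    have hmeas2 : AEMeasurable (fun ξ : R3 =>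
        ENNReal.ofReal ((1 + 4 * Real.pi ^ 2 * ‖ξ‖ ^ 2) ^ (s / 2)) * ‖f ξ‖ₑ) volume :=
      (by fun_prop : AEMeasurable (fun ξ : R3 =>
        ENNReal.ofReal ((1 + 4 * Real.pi ^ 2 * ‖ξ‖ ^ 2) ^ (s / 2))) volume).mul hf.enorm
    have key := ENNReal.lintegral_mul_le_Lp_mul_Lq volume
      Real.HolderConjugate.two_two hmeas hmeas2
    refine le_trans (le_of_eq ?_) (key.trans (le_of_eq ?_))
    · refine lintegral_congr fun ξ => ?_
      simp only [Pi.mul_apply]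
      rw [← mul_assoc, ← ENNReal.ofReal_mul (by positivity), mul_assoc,
        ← Real.rpow_add (by positivity)]
      simp
    · congr 2
      refine lintegral_congr fun ξ => ?_
      rw [ENNReal.mul_rpow_of_nonneg _ _ (by norm_num),
        ENNReal.ofReal_rpow_of_nonneg (by positivity) (by norm_num),
        ← Real.rpow_mul (by positivity)]
      simp

/-- The real part of a complex vector, componentwise. -/
def reL : C3 →L[ℝ] R3 :=
  LinearMap.mkContinuous
    { toFun := fun w => WithLp.toLp 2 (fun i => (w i).re)
      map_add' := fun a b => by ext i; simp
      map_smul' := fun c a => by ext i; simp }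
    1 (fun w => by
      rw [one_mul]
      refine (sq_le_sq₀ (norm_nonneg _) (norm_nonneg _)).1 ?_
      rw [EuclideanSpace.norm_sq_eq, EuclideanSpace.norm_sq_eq]
      refine Finset.sum_le_sum fun i _ => ?_
      have := Complex.abs_re_le_norm (w i)
      simp only [LinearMap.coe_mk, AddHom.coe_mk, Real.norm_eq_abs]
      gcongr)

theorem norm_reL_le : ‖reL‖ ≤ 1 := LinearMap.mkContinuous_norm_le _ (by norm_num) _

theorem reL_complexify (v : R3 → R3) (x : R3) : reL (complexify v x) = v x := by
  ext i; simp [reL, complexify]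

theorem norm_complexify (v : R3 → R3) (x : R3) : ‖complexify v x‖ = ‖v x‖ := by
  rw [EuclideanSpace.norm_eq, EuclideanSpace.norm_eq]; simp [complexify]

theorem complexify_continuous {v : R3 → R3} (hv : Continuous v) : Continuous (complexify v) := by
  unfold complexify
  fun_prop

theorem memLp_of_complexify {v : R3 → R3} (hv : Continuous v)
    (h : MemLp (complexify v) 2 volume) : MemLp v 2 volume := by
  refine ⟨hv.aestronglyMeasurable, ?_⟩
  rw [eLpNorm_congr_norm_ae (g := complexify v)
    (Eventually.of_forall fun x => (norm_complexify v x).symm)]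
  exact h.2

theorem eLpNorm_le_hsNorm {s : ℝ} (hs : 0 ≤ s) {v : R3 → R3}
    (h : MemLp (complexify v) 2 volume) : eLpNorm v 2 volume ≤ hsNorm s v := by
  rw [eLpNorm_congr_norm_ae (g := complexify v)
    (Eventually.of_forall fun x => (norm_complexify v x).symm)]
  have h1 : eLpNorm (complexify v) 2 volume = eLpNorm (fourierL2 v) 2 volume := by
    rw [fourierL2, dif_pos h]
    have := congrArg ENNReal.ofReal (Lp.norm_fourier_eq (h.toLp (complexify v)))
    rw [Lp.norm_def, Lp.norm_def, ENNReal.ofReal_toReal (Lp.eLpNorm_ne_top _),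
      ENNReal.ofReal_toReal (Lp.eLpNorm_ne_top _), eLpNorm_congr_ae h.coeFn_toLp] at this
    exact this.symm
  rw [h1, eLpNorm_eq_lintegral_rpow_enorm_toReal (by norm_num) (by norm_num), hsNorm]
  simp only [ENNReal.toReal_ofNat, ENNReal.rpow_ofNat]
  gcongr with ξ
  refine le_mul_of_one_le_left (by simp) ?_
  rw [← ENNReal.ofReal_one]
  refine ENNReal.ofReal_le_ofReal (Real.one_le_rpow ?_ hs)
  have : 0 ≤ 4 * Real.pi ^ 2 * ‖ξ‖ ^ 2 := by positivity
  linarith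

/-- The Sobolev embedding `H^s(ℝ³) ⊂ C¹` for `s > 5/2`, with bounds on the field and its
derivative. -/
theorem exists_sobolev_bound (s : ℝ) (hs : 5 / 2 < s) :
    ∃ C : ℝ, 0 ≤ C ∧ ∀ v : R3 → R3, Continuous v → MemHs s v →
      ContDiff ℝ 1 v ∧ (∀ x, ‖v x‖ ≤ C * (hsNorm s v).toReal) ∧
        ∀ x, ‖fderiv ℝ v x‖ ≤ C * (hsNorm s v).toReal := by
  obtain ⟨C, hC, hCf⟩ := exists_lintegral_weight_le s hs
  refine ⟨2 * Real.pi * C.toReal, by positivity, fun v hv hmem => ?_⟩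
  obtain ⟨hL2, hN⟩ := hmem
  -- the Fourier transform `f` of `v` is integrable with its first moment, so `v` is the inverse
  -- transform of an `L¹` function that may be differentiated under the integral
  set f : R3 → C3 := fourierL2 v with hfdef
  have hf' : f = ((𝓕 (hL2.toLp (complexify v)) : Lp C3 2 (volume : Measure R3)) : R3 → C3) := by
    rw [hfdef, fourierL2, dif_pos hL2]
  have hfm : AEStronglyMeasurable f volume := by rw [hf']; exact Lp.aestronglyMeasurable _
  have hw : ∫⁻ ξ, ENNReal.ofReal (1 + ‖ξ‖) * ‖f ξ‖ₑ ≤ C * hsNorm s v := hCf f hfm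
  have hwtop : C * hsNorm s v < ⊤ := ENNReal.mul_lt_top hC hN
  have hweq : ∀ ξ, ENNReal.ofReal (1 + ‖ξ‖) * ‖f ξ‖ₑ = ‖(1 + ‖ξ‖) * ‖f ξ‖‖ₑ := fun ξ => by
    rw [enorm_mul, enorm_norm, Real.enorm_of_nonneg (by positivity)]
  have hint : Integrable (fun ξ => (1 + ‖ξ‖) * ‖f ξ‖) := by
    refine ⟨(by fun_prop : Continuous fun ξ : R3 => 1 + ‖ξ‖).aestronglyMeasurable.mul hfm.norm, ?_⟩
    rw [hasFiniteIntegral_iff_enorm]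
    simp_rw [← hweq]
    exact hw.trans_lt hwtop
  have hI : ∫ ξ, (1 + ‖ξ‖) * ‖f ξ‖ ≤ C.toReal * (hsNorm s v).toReal := by
    rw [integral_eq_lintegral_of_nonneg_ae (Eventually.of_forall fun ξ => by positivity)
      hint.aestronglyMeasurable, ← ENNReal.toReal_mul]
    refine ENNReal.toReal_mono hwtop.ne ?_
    refine le_trans (le_of_eq (lintegral_congr fun ξ => ?_)) hw
    rw [hweq, Real.enorm_of_nonneg (by positivity)]
  have hint0 : Integrable f := by
    refine hint.mono' hfm (Eventually.of_forall fun ξ => ?_)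
    exact le_mul_of_one_le_left (norm_nonneg _) (by linarith [norm_nonneg ξ])
  have hint1 : Integrable (fun ξ => ‖ξ‖ * ‖f ξ‖) := by
    refine hint.mono' (continuous_norm.aestronglyMeasurable.mul hfm.norm)
      (Eventually.of_forall fun ξ => ?_)
    rw [Real.norm_of_nonneg (by positivity)]
    gcongr; linarith
  set g : R3 → C3 := fun ξ => f (-ξ) with hg
  have hg0 : Integrable g := hint0.comp_neg
  have hg1 : Integrable (fun ξ => ‖ξ‖ * ‖g ξ‖) := by simpa [hg] using hint1.comp_neg
  have hcd : ContDiff ℝ 1 (𝓕 g) := by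
    refine Real.contDiff_fourier (N := 1) fun n hn => ?_
    have hn : n ≤ 1 := by exact_mod_cast hn
    interval_cases n
    · simpa using hg0.norm
    · simpa using hg1
  have hvg : complexify v = 𝓕 g := by
    refine ((complexify_continuous hv).ae_eq_iff_eq volume hcd.continuous).1 ?_
    filter_upwards [hL2.coeFn_toLp, ae_eq_fourierInv_of_integrable (hL2.toLp (complexify v))
      (by rw [← hf']; exact hint0)] with x h1 h2
    rw [← h1, h2, ← hf', Real.fourierInv_eq_fourier_comp_neg]
  have hvre : v = reL ∘ 𝓕 g := by
    ext1 x; rw [← hvg, Function.comp_apply, reL_complexify]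
  have hgI : ∫ ξ, ‖g ξ‖ ≤ C.toReal * (hsNorm s v).toReal := by
    refine le_trans ?_ hI
    rw [hg, integral_neg_eq_self (fun ξ => ‖f ξ‖) volume]
    refine integral_mono hint0.norm hint fun ξ => ?_
    exact le_mul_of_one_le_left (norm_nonneg _) (by linarith [norm_nonneg ξ])
  have hgI1 : ∫ ξ, ‖ξ‖ * ‖g ξ‖ ≤ C.toReal * (hsNorm s v).toReal := by
    refine le_trans ?_ hI
    have : ∫ ξ, ‖ξ‖ * ‖g ξ‖ = ∫ ξ, ‖ξ‖ * ‖f ξ‖ := by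
      rw [← integral_neg_eq_self (fun ξ => ‖ξ‖ * ‖f ξ‖) volume]; simp [hg]
    rw [this]
    refine integral_mono hint1 hint fun ξ => ?_
    simp only
    gcongr; linarith
  have hN0 : 0 ≤ C.toReal * (hsNorm s v).toReal := by positivity
  have hpi : 1 ≤ 2 * Real.pi := by linarith [Real.pi_gt_three]
  refine ⟨by rw [hvre]; exact reL.contDiff.comp hcd, fun x => ?_, fun x => ?_⟩
  · rw [← norm_complexify, hvg]
    calc ‖𝓕 g x‖ ≤ ∫ ξ, ‖g ξ‖ := VectorFourier.norm_fourierIntegral_le_integral_norm _ _ _ _ _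
      _ ≤ C.toReal * (hsNorm s v).toReal := hgI
      _ ≤ 2 * Real.pi * C.toReal * (hsNorm s v).toReal := by
        rw [mul_assoc]; exact le_mul_of_one_le_left hN0 hpi
  · have hd := Real.hasFDerivAt_fourier hg0 hg1 x
    have hd' := HasFDerivAt.comp x (ContinuousLinearMap.hasFDerivAt (𝕜 := ℝ) reL (x := 𝓕 g x)) hd
    rw [← hvre] at hd'
    rw [hd'.fderiv]
    refine (ContinuousLinearMap.opNorm_comp_le _ _).trans ?_
    calc ‖reL‖ * ‖𝓕 (VectorFourier.fourierSMulRight (innerSL ℝ) g) x‖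
        ≤ 1 * ∫ ξ, ‖VectorFourier.fourierSMulRight (innerSL ℝ) g ξ‖ := by
          gcongr
          · exact norm_reL_le
          · exact VectorFourier.norm_fourierIntegral_le_integral_norm _ _ _ _ _
      _ ≤ ∫ ξ, 2 * Real.pi * (‖ξ‖ * ‖g ξ‖) := by
          rw [one_mul]
          refine integral_mono_of_nonneg (Eventually.of_forall fun _ => norm_nonneg _)
            (hg1.const_mul _) (Eventually.of_forall fun ξ => ?_)
          refine (VectorFourier.norm_fourierSMulRight_le _ _ _).trans ?_
          have : ‖(innerSL ℝ : R3 →L[ℝ] R3 →L[ℝ] ℝ)‖ ≤ 1 := norm_innerSL_le (𝕜 := ℝ) (E := R3)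
          calc 2 * Real.pi * ‖(innerSL ℝ : R3 →L[ℝ] R3 →L[ℝ] ℝ)‖ * ‖ξ‖ * ‖g ξ‖
              ≤ 2 * Real.pi * 1 * ‖ξ‖ * ‖g ξ‖ := by gcongr
            _ = _ := by ring
      _ ≤ 2 * Real.pi * C.toReal * (hsNorm s v).toReal := by
          rw [integral_const_mul, mul_assoc (2 * Real.pi)]; gcongr



/-! ### The divergence theorem and the Helmholtz decomposition -/

/-- The standard basis vectors of `ℝ³`. -/
abbrev e (i : Fin 3) : R3 := EuclideanSpace.single i 1

/-- Smooth cutoffs that exhaust the space and whose gradients tend to zero uniformly. -/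
theorem exists_cutoff : ∃ (χ : ℕ → R3 → ℝ) (C : ℝ), 0 ≤ C ∧ ∀ n,
    ContDiff ℝ ∞ (χ n) ∧ HasCompactSupport (χ n) ∧ (∀ x, |χ n x| ≤ 1) ∧
    (∀ x, ‖fderiv ℝ (χ n) x‖ ≤ C / (n + 1)) ∧ (∀ x, ‖x‖ ≤ n + 1 → χ n x = 1) := by
  let b : ContDiffBump (0 : R3) := ⟨1, 2, by norm_num, by norm_num⟩
  have hb : ContDiff ℝ ∞ b := b.contDiff
  obtain ⟨C, hC⟩ : ∃ C, ∀ x, ‖fderiv ℝ b x‖ ≤ C :=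
    (hb.continuous_fderiv (by simp)).bounded_above_of_compact_support
      (b.hasCompactSupport.fderiv ℝ)
  have hn0 : ∀ n : ℕ, ((n : ℝ) + 1)⁻¹ ≠ 0 := fun n => by positivity
  refine ⟨fun n x => b (((n : ℝ) + 1)⁻¹ • x), C, (norm_nonneg _).trans (hC 0),
    fun n => ⟨?_, ?_, ?_, ?_, ?_⟩⟩
  · exact hb.comp (contDiff_const_smul _)
  · exact b.hasCompactSupport.comp_homeomorph (Homeomorph.smulOfNeZero _ (hn0 n))
  · intro x
    rw [abs_of_nonneg b.nonneg]
    exact b.le_one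
  · intro x
    have h1 : HasFDerivAt (fun x : R3 => ((n : ℝ) + 1)⁻¹ • x)
        (((n : ℝ) + 1)⁻¹ • ContinuousLinearMap.id ℝ R3) x :=
      (((n : ℝ) + 1)⁻¹ • ContinuousLinearMap.id ℝ R3).hasFDerivAt
    have h2 := ((hb.differentiable (by simp)) (((n : ℝ) + 1)⁻¹ • x)).hasFDerivAt.comp x h1
    have h3 : fderiv ℝ (fun x => b (((n : ℝ) + 1)⁻¹ • x)) x =
        ((n : ℝ) + 1)⁻¹ • fderiv ℝ b (((n : ℝ) + 1)⁻¹ • x) := by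
      rw [show (fun x => b (((n : ℝ) + 1)⁻¹ • x)) = b ∘ (fun x => ((n : ℝ) + 1)⁻¹ • x) from rfl,
        h2.fderiv]
      ext v; simp
    rw [h3, norm_smul, Real.norm_of_nonneg (by positivity), div_eq_inv_mul]
    gcongr
    exact hC _
  · intro x hx
    refine b.one_of_mem_closedBall ?_
    rw [mem_closedBall_zero_iff, norm_smul, Real.norm_of_nonneg (by positivity),
      inv_mul_le_iff₀ (by positivity)]
    simpa [b] using hx

theorem abs_fderiv_e_le (f : R3 → ℝ) (x : R3) (i : Fin 3) :
    |fderiv ℝ f x (e i)| ≤ ‖fderiv ℝ f x‖ := by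
  simpa using (fderiv ℝ f x).le_opNorm (e i)

theorem continuous_fderiv_e {f : R3 → ℝ} (hf : ContDiff ℝ 1 f) (v : R3) :
    Continuous fun x => fderiv ℝ f x v :=
  (hf.continuous_fderiv (by simp)).clm_apply continuous_const

/-- The divergence theorem on `ℝ³` for an integrable `C¹` field with integrable divergence: there
is no flux through infinity. -/
theorem integral_div_eq_zero {f : Fin 3 → R3 → ℝ} (hf : ∀ i, ContDiff ℝ 1 (f i))
    (hi : ∀ i, Integrable (f i))
    (hd : Integrable fun x => ∑ i, fderiv ℝ (f i) x (e i)) :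
    ∫ x, ∑ i, fderiv ℝ (f i) x (e i) = 0 := by
  obtain ⟨χ, C, hC0, hχ⟩ := exists_cutoff
  have hχ1 : ∀ n, ContDiff ℝ 1 (χ n) := fun n => (hχ n).1.of_le (by simp)
  have hcs : ∀ n i, HasCompactSupport fun x => χ n x * f i x := fun n i => (hχ n).2.1.mul_right
  have hcs1 : ∀ n i, HasCompactSupport fun x => χ n x * fderiv ℝ (f i) x (e i) :=
    fun n i => (hχ n).2.1.mul_right
  have hcs2 : ∀ n i, HasCompactSupport fun x => fderiv ℝ (χ n) x (e i) * f i x := fun n i =>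
    ((hχ n).2.1.fderiv_apply (𝕜 := ℝ) (e i)).mul_right
  have hc1 : ∀ n i, Integrable fun x => χ n x * fderiv ℝ (f i) x (e i) := fun n i =>
    ((hχ1 n).continuous.mul
      (continuous_fderiv_e (hf i) _)).integrable_of_hasCompactSupport (hcs1 n i)
  have hc2 : ∀ n i, Integrable fun x => fderiv ℝ (χ n) x (e i) * f i x := fun n i =>
    ((continuous_fderiv_e (hχ1 n) _).mul
      (hf i).continuous).integrable_of_hasCompactSupport (hcs2 n i)
  have hibp : ∀ n, ∫ x, χ n x * ∑ i, fderiv ℝ (f i) x (e i) =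
      - ∫ x, ∑ i, fderiv ℝ (χ n) x (e i) * f i x := by
    intro n
    simp_rw [Finset.mul_sum]
    rw [integral_finsetSum _ fun i _ => hc1 n i, integral_finsetSum _ fun i _ => hc2 n i,
      ← Finset.sum_neg_distrib]
    refine Finset.sum_congr rfl fun i _ => ?_
    exact integral_mul_fderiv_eq_neg_fderiv_mul_of_integrable (hc2 n i) (hc1 n i)
      (((hχ1 n).continuous.mul (hf i).continuous).integrable_of_hasCompactSupport (hcs n i))
      (fun x _ => (hχ1 n).differentiable (by simp) x)
      (fun x _ => (hf i).differentiable (by simp) x)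
  have hdc : Continuous fun x => ∑ i, fderiv ℝ (f i) x (e i) :=
    continuous_finsetSum _ fun i _ => continuous_fderiv_e (hf i) _
  have hlim1 : Tendsto (fun n => ∫ x, χ n x * ∑ i, fderiv ℝ (f i) x (e i)) atTop
      (𝓝 (∫ x, ∑ i, fderiv ℝ (f i) x (e i))) := by
    refine tendsto_integral_of_dominated_convergence
      (fun x => |∑ i, fderiv ℝ (f i) x (e i)|) (fun n => ?_) hd.abs (fun n => ?_) ?_
    · exact ((hχ1 n).continuous.mul hdc).aestronglyMeasurable
    · refine Eventually.of_forall fun x => ?_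
      rw [Real.norm_eq_abs, abs_mul]
      exact mul_le_of_le_one_left (abs_nonneg _) ((hχ n).2.2.1 x)
    · refine Eventually.of_forall fun x => ?_
      refine tendsto_const_nhds.congr' ?_
      obtain ⟨N, hN⟩ := exists_nat_ge ‖x‖
      filter_upwards [eventually_ge_atTop N] with n hn
      have : (N : ℝ) ≤ n := by exact_mod_cast hn
      rw [(hχ n).2.2.2.2 x (by linarith), one_mul]
  have hlim2 : Tendsto (fun n : ℕ => ∫ x, ∑ i, fderiv ℝ (χ n) x (e i) * f i x) atTop (𝓝 0) := by
    have hsum : Integrable fun x => ∑ i, |f i x| := integrable_finsetSum _ fun i _ => (hi i).abs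
    refine squeeze_zero_norm (a := fun n : ℕ => C / (n + 1) * ∫ x, ∑ i, |f i x|) (fun n => ?_) ?_
    · rw [← integral_const_mul]
      refine norm_integral_le_of_norm_le (hsum.const_mul _) (Eventually.of_forall fun x => ?_)
      rw [Finset.mul_sum]
      refine (norm_sum_le _ _).trans (Finset.sum_le_sum fun i _ => ?_)
      rw [Real.norm_eq_abs, abs_mul]
      gcongr
      exact (abs_fderiv_e_le _ _ _).trans ((hχ n).2.2.2.1 x)
    · have : Tendsto (fun n : ℕ => C * (1 / ((n : ℝ) + 1)) * ∫ x, ∑ i, |f i x|) atTop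
          (𝓝 (C * 0 * ∫ x, ∑ i, |f i x|)) :=
        (tendsto_one_div_add_atTop_nhds_zero_nat.const_mul C).mul_const _
      simpa [div_eq_mul_inv] using this
  refine tendsto_nhds_unique hlim1 ?_
  simp_rw [hibp]
  simpa using hlim2.neg

/-- A square integrable field that annihilates gradients of test functions annihilates gradients
of smooth functions in `H¹`. -/
theorem integral_weakDiv_eq_zero {h : Fin 3 → R3 → ℝ} (hh : ∀ i, MemLp (h i) 2 volume)
    (hw : ∀ ψ : R3 → ℝ, ContDiff ℝ ∞ ψ → HasCompactSupport ψ →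
      ∫ x, ∑ i, h i x * fderiv ℝ ψ x (e i) = 0)
    {a : R3 → ℝ} (ha : ContDiff ℝ ∞ a) (ha2 : MemLp a 2 volume)
    (hda : ∀ i, MemLp (fun x => fderiv ℝ a x (e i)) 2 volume) :
    ∫ x, ∑ i, h i x * fderiv ℝ a x (e i) = 0 := by
  obtain ⟨χ, C, hC0, hχ⟩ := exists_cutoff
  have ha1 : ContDiff ℝ 1 a := ha.of_le (by simp)
  have hχ1 : ∀ n, ContDiff ℝ 1 (χ n) := fun n => (hχ n).1.of_le (by simp)
  have hder : ∀ n x i, fderiv ℝ (fun x => χ n x * a x) x (e i) =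
      χ n x * fderiv ℝ a x (e i) + a x * fderiv ℝ (χ n) x (e i) := by
    intro n x i
    rw [fderiv_fun_mul ((hχ1 n).differentiable (by simp) x) (ha1.differentiable (by simp) x)]
    simp
  have hz : ∀ n, ∫ x, ∑ i, h i x * fderiv ℝ (fun x => χ n x * a x) x (e i) = 0 := fun n =>
    hw _ ((hχ n).1.mul ha) (hχ n).2.1.mul_right
  have hlim : Tendsto (fun n => ∫ x, ∑ i, h i x * fderiv ℝ (fun x => χ n x * a x) x (e i)) atTop
      (𝓝 (∫ x, ∑ i, h i x * fderiv ℝ a x (e i))) := by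
    refine tendsto_integral_of_dominated_convergence
      (fun x => ∑ i, (|h i x * fderiv ℝ a x (e i)| + C * |h i x * a x|)) (fun n => ?_) ?_
      (fun n => ?_) ?_
    · refine Finset.aestronglyMeasurable_fun_sum _ fun i _ => (hh i).1.mul ?_
      exact (continuous_fderiv_e ((hχ1 n).mul ha1) _).aestronglyMeasurable
    · refine integrable_finsetSum _ fun i _ => Integrable.add ?_ (Integrable.const_mul ?_ _)
      · exact ((hh i).integrable_mul (hda i)).abs
      · exact ((hh i).integrable_mul ha2).abs
    · refine Eventually.of_forall fun x => (norm_sum_le _ _).trans (Finset.sum_le_sum fun i _ => ?_)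
      rw [hder, Real.norm_eq_abs, mul_add]
      refine (abs_add_le _ _).trans (add_le_add ?_ ?_)
      · rw [mul_left_comm, abs_mul]
        exact mul_le_of_le_one_left (abs_nonneg _) ((hχ n).2.2.1 x)
      · rw [← mul_assoc, abs_mul, mul_comm]
        gcongr
        refine (abs_fderiv_e_le _ _ _).trans (((hχ n).2.2.2.1 x).trans ?_)
        exact div_le_self hC0 (by linarith [(Nat.cast_nonneg n : (0 : ℝ) ≤ n)])
    · refine Eventually.of_forall fun x => tendsto_finsetSum _ fun i _ => ?_
      refine Tendsto.const_mul _ ?_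
      have h2 : Tendsto (fun n : ℕ => fderiv ℝ (χ n) x (e i)) atTop (𝓝 0) := by
        refine squeeze_zero_norm (a := fun n : ℕ => C * (1 / ((n : ℝ) + 1))) (fun n => ?_) ?_
        · refine (abs_fderiv_e_le _ _ _).trans (((hχ n).2.2.2.1 x).trans (le_of_eq ?_))
          rw [mul_one_div]
        · simpa using tendsto_one_div_add_atTop_nhds_zero_nat.const_mul C
      have h1 : Tendsto (fun n : ℕ => χ n x) atTop (𝓝 1) := by
        refine tendsto_const_nhds.congr' ?_
        obtain ⟨N, hN⟩ := exists_nat_ge ‖x‖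
        filter_upwards [eventually_ge_atTop N] with n hn
        have : (N : ℝ) ≤ n := by exact_mod_cast hn
        rw [(hχ n).2.2.2.2 x (by linarith)]
      simp_rw [hder]
      simpa using (h1.mul_const (fderiv ℝ a x (e i))).add (h2.const_mul (a x))
  refine tendsto_nhds_unique hlim ?_
  simp_rw [hz]
  exact tendsto_const_nhds

/-- A real square integrable function as an element of complex `L²`. -/
def toC {h : R3 → ℝ} (hh : MemLp h 2 volume) : Lp ℂ 2 (volume : Measure R3) :=
  (hh.ofReal (K := ℂ)).toLp (fun x => (h x : ℂ))

theorem coeFn_toC {h : R3 → ℝ} (hh : MemLp h 2 volume) : ∀ᵐ x, toC hh x = (h x : ℂ) :=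
  (hh.ofReal (K := ℂ)).coeFn_toLp

/-- The Fourier transform of a weakly divergence free field of `L²` is orthogonal to the
frequency. -/
theorem sum_mul_fourier_eq_zero {h : Fin 3 → R3 → ℝ} (hh : ∀ i, MemLp (h i) 2 volume)
    (hw : ∀ ψ : R3 → ℝ, ContDiff ℝ ∞ ψ → HasCompactSupport ψ →
      ∫ x, ∑ i, h i x * fderiv ℝ ψ x (e i) = 0) :
    ∀ᵐ ξ : R3, ∑ i, ((ξ i : ℝ) : ℂ) * (𝓕 (toC (hh i)) : Lp ℂ 2 (volume : Measure R3)) ξ = 0 := by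
  -- Schwartz functions are admissible test functions, by truncation and splitting into real and
  -- imaginary parts
  have hS : ∀ φ : 𝓢(R3, ℂ), ∑ i, (toC (hh i) : 𝓢'(R3, ℂ)) (∂_{e i} φ) = 0 := by
    intro φ
    have hφ : ContDiff ℝ ∞ φ := φ.smooth ⊤
    have hre : ContDiff ℝ ∞ fun x => (φ x).re := Complex.reCLM.contDiff.comp hφ
    have him : ContDiff ℝ ∞ fun x => (φ x).im := Complex.imCLM.contDiff.comp hφ
    have hdre : ∀ x i, fderiv ℝ (fun x => (φ x).re) x (e i) = ((∂_{e i} φ) x).re := fun x i => by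
      have := Complex.reCLM.hasFDerivAt.comp x (φ.differentiableAt (x := x)).hasFDerivAt
      rw [show (fun x => (φ x).re) = Complex.reCLM ∘ φ from rfl, this.fderiv]
      rfl
    have hdim : ∀ x i, fderiv ℝ (fun x => (φ x).im) x (e i) = ((∂_{e i} φ) x).im := fun x i => by
      have := Complex.imCLM.hasFDerivAt.comp x (φ.differentiableAt (x := x)).hasFDerivAt
      rw [show (fun x => (φ x).im) = Complex.imCLM ∘ φ from rfl, this.fderiv]
      rfl
    have hm : ∀ η : 𝓢(R3, ℂ), MemLp η 2 volume := fun η => η.memLp 2 volume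
    have h1 := integral_weakDiv_eq_zero hh hw hre (hm φ).re
      (fun i => by simp_rw [hdre]; exact (hm _).re)
    have h2 := integral_weakDiv_eq_zero hh hw him (hm φ).im
      (fun i => by simp_rw [hdim]; exact (hm _).im)
    have hint : ∀ i, Integrable fun x => (h i x : ℂ) * (∂_{e i} φ) x := fun i =>
      ((hh i).ofReal (K := ℂ)).integrable_mul (hm _)
    have h3 : ∑ i, (toC (hh i) : 𝓢'(R3, ℂ)) (∂_{e i} φ) =
        ∫ x, ∑ i, (h i x : ℂ) * (∂_{e i} φ) x := by
      rw [integral_finsetSum _ fun i _ => hint i]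
      refine Finset.sum_congr rfl fun i _ => ?_
      rw [Lp.toTemperedDistribution_apply]
      refine integral_congr_ae ?_
      filter_upwards [coeFn_toC (hh i)] with x hx
      rw [hx, smul_eq_mul, mul_comm]
    have hint' : Integrable fun x => ∑ i, (h i x : ℂ) * (∂_{e i} φ) x :=
      integrable_finsetSum _ fun i _ => hint i
    rw [h3, ← integral_re_add_im hint']
    simp_rw [hdre] at h1
    simp_rw [hdim] at h2
    simp [h1, h2]
  -- testing against `𝓕 φ` and moving the transform to `h`
  have hF : ∀ φ : 𝓢(R3, ℂ), ∑ i, ∫ ξ : R3, φ ξ * (((ξ i : ℝ) : ℂ) *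
      (𝓕 (toC (hh i)) : Lp ℂ 2 (volume : Measure R3)) ξ) = 0 := by
    intro φ
    have h1 := hS (𝓕 φ)
    have h2 : ∀ i, (toC (hh i) : 𝓢'(R3, ℂ)) (∂_{e i} (𝓕 φ)) = -(2 * Real.pi * Complex.I) *
        ∫ ξ : R3, φ ξ * (((ξ i : ℝ) : ℂ) *
          (𝓕 (toC (hh i)) : Lp ℂ 2 (volume : Measure R3)) ξ) := by
      intro i
      have htg : (fun ξ : R3 => inner ℝ ξ (e i)).HasTemperateGrowth := by fun_prop
      rw [SchwartzMap.lineDerivOp_fourier_eq, ← TemperedDistribution.fourier_apply,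
        Lp.fourier_toTemperedDistribution_eq, map_smul, Lp.toTemperedDistribution_apply,
        smul_eq_mul]
      congr 1
      refine integral_congr_ae (Eventually.of_forall fun ξ => ?_)
      simp only [SchwartzMap.smulLeftCLM_apply_apply htg]
      simp [EuclideanSpace.inner_single_right]
      ring
    simp_rw [h2, ← Finset.mul_sum] at h1
    refine (mul_eq_zero.1 h1).resolve_left ?_
    simp [Real.pi_ne_zero]
  have hloc : ∀ i, LocallyIntegrable (fun ξ : R3 => ((ξ i : ℝ) : ℂ) *
      (𝓕 (toC (hh i)) : Lp ℂ 2 (volume : Measure R3)) ξ) volume := fun i => by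
    have := ((Lp.memLp (𝓕 (toC (hh i)) : Lp ℂ 2 (volume : Measure R3))).locallyIntegrable
      (by norm_num)).continuous_smul (g := fun ξ : R3 => ((ξ i : ℝ) : ℂ)) (by fun_prop)
    simpa using this
  refine ae_eq_zero_of_integral_contDiff_smul_eq_zero ?_ ?_
  · have : (fun ξ : R3 => ∑ i, ((ξ i : ℝ) : ℂ) *
        (𝓕 (toC (hh i)) : Lp ℂ 2 (volume : Measure R3)) ξ) =
      ∑ i, fun ξ : R3 => ((ξ i : ℝ) : ℂ) *
        (𝓕 (toC (hh i)) : Lp ℂ 2 (volume : Measure R3)) ξ := by ext; simp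
    rw [this]
    exact locallyIntegrable_finsetSum' _ fun i _ => hloc i
  · intro ψ hψ hψc
    let φ : 𝓢(R3, ℂ) := (hψc.comp_left (g := fun a : ℝ => (a : ℂ)) (by simp)).toSchwartzMap
      (Complex.ofRealCLM.contDiff.comp hψ)
    have hφ : ∀ x, φ x = (ψ x : ℂ) := fun x => rfl
    rw [← hF φ, ← integral_finsetSum]
    · refine integral_congr_ae (Eventually.of_forall fun ξ => ?_)
      simp only [hφ, Finset.smul_sum, Complex.real_smul]
    · intro i _
      have := (hloc i).integrable_smul_left_of_hasCompactSupport hψ.continuous hψc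
      refine this.congr (Eventually.of_forall fun ξ => ?_)
      simp only [hφ, Complex.real_smul]

/-- The Helmholtz decomposition is orthogonal: in `L²`, a weakly divergence free field is
orthogonal to a weakly curl free one. -/
theorem integral_divFree_mul_curlFree {w g : Fin 3 → R3 → ℝ} (hw2 : ∀ i, MemLp (w i) 2 volume)
    (hg2 : ∀ i, MemLp (g i) 2 volume)
    (hw : ∀ ψ : R3 → ℝ, ContDiff ℝ ∞ ψ → HasCompactSupport ψ →
      ∫ x, ∑ i, w i x * fderiv ℝ ψ x (e i) = 0)
    (hg : ∀ i j, ∀ ψ : R3 → ℝ, ContDiff ℝ ∞ ψ → HasCompactSupport ψ →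
      ∫ x, (g i x * fderiv ℝ ψ x (e j) - g j x * fderiv ℝ ψ x (e i)) = 0) :
    ∫ x, ∑ i, w i x * g i x = 0 := by
  have hwF := sum_mul_fourier_eq_zero hw2 hw
  -- `𝓕 g` is parallel to the frequency
  have hgF : ∀ i j, ∀ᵐ ξ : R3, ((ξ j : ℝ) : ℂ) * (𝓕 (toC (hg2 i)) : Lp ℂ 2 (volume : Measure R3)) ξ
      = ((ξ i : ℝ) : ℂ) * (𝓕 (toC (hg2 j)) : Lp ℂ 2 (volume : Measure R3)) ξ := by
    intro i j
    rcases eq_or_ne i j with rfl | hij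
    · exact Eventually.of_forall fun _ => rfl
    -- the field `g i • e j - g j • e i` is weakly divergence free
    let k : Fin 3 → R3 → ℝ := fun l x => if l = j then g i x else if l = i then - g j x else 0
    have hk : ∀ l, MemLp (k l) 2 volume := fun l => by
      by_cases h1 : l = j
      · simpa [k, h1] using hg2 i
      · by_cases h2 : l = i
        · have := (hg2 j).neg
          simp only [k, h2, hij, if_false, if_true]
          exact this
        · simp [k, h1, h2]
    have hsum : ∀ c : Fin 3 → ℝ, ∀ x, ∑ l, k l x * c l = g i x * c j - g j x * c i := by
      intro c x
      have : ∀ l, k l x * c l = (if l = j then g i x * c j else 0) +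
          (if l = i then - g j x * c i else 0) := by
        intro l
        by_cases h1 : l = j
        · subst h1; simp [k, hij.symm]
        · by_cases h2 : l = i
          · subst h2; simp [k, h1]
          · simp [k, h1, h2]
      simp_rw [this, Finset.sum_add_distrib]
      simp [sub_eq_add_neg]
    have := sum_mul_fourier_eq_zero hk (fun ψ h1 h2 => by
      simp_rw [fun x => hsum (fun l => fderiv ℝ ψ x (e l)) x]
      exact hg i j ψ h1 h2)
    have hkj : toC (hk j) = toC (hg2 i) := by
      unfold toC; congr 1; ext x; simp [k]
    have hki : toC (hk i) = - toC (hg2 j) := by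
      unfold toC
      rw [← MemLp.toLp_neg]
      congr 1; ext x; simp [k, hij]
    have hneg : (𝓕 (- toC (hg2 j)) : Lp ℂ 2 (volume : Measure R3)) = - 𝓕 (toC (hg2 j)) := by
      have := (Lp.fourierTransformₗᵢ R3 ℂ).map_neg (toC (hg2 j))
      exact this
    have hkl : ∀ l, l ≠ i → l ≠ j → toC (hk l) = 0 := by
      intro l h1 h2
      unfold toC
      rw [← MemLp.toLp_zero MemLp.zero']
      congr 1; ext x; simp [k, h1, h2]
    have hzero : (𝓕 (0 : Lp ℂ 2 (volume : Measure R3)) : Lp ℂ 2 (volume : Measure R3)) = 0 :=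
      (Lp.fourierTransformₗᵢ R3 ℂ).map_zero
    filter_upwards [this, Lp.coeFn_neg (𝓕 (toC (hg2 j)) : Lp ℂ 2 (volume : Measure R3)),
      Lp.coeFn_zero ℂ 2 (volume : Measure R3)] with ξ h1 h2 h3
    have h4 : ∀ l, ((ξ l : ℝ) : ℂ) * (𝓕 (toC (hk l)) : Lp ℂ 2 (volume : Measure R3)) ξ =
        (if l = j then ((ξ j : ℝ) : ℂ) * (𝓕 (toC (hg2 i)) : Lp ℂ 2 (volume : Measure R3)) ξ
          else 0) +
        (if l = i then - (((ξ i : ℝ) : ℂ) * (𝓕 (toC (hg2 j)) : Lp ℂ 2 (volume : Measure R3)) ξ)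
          else 0) := by
      intro l
      by_cases hl : l = j
      · subst hl; simp [hkj, hij.symm]
      · by_cases hl2 : l = i
        · subst hl2
          rw [hki, hneg, h2]
          simp [hl]
        · rw [hkl l hl2 hl, hzero, h3]; simp [hl, hl2]
    simp_rw [h4, Finset.sum_add_distrib] at h1
    simp only [Finset.sum_ite_eq', Finset.mem_univ, if_true] at h1
    linear_combination h1
  -- hence orthogonal to `𝓕 w` at almost every frequency, and Plancherel's theorem applies
  have hpt : ∀ᵐ ξ : R3, ∑ i, inner ℂ ((𝓕 (toC (hw2 i)) : Lp ℂ 2 (volume : Measure R3)) ξ)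
      ((𝓕 (toC (hg2 i)) : Lp ℂ 2 (volume : Measure R3)) ξ) = 0 := by
    have hne : ∀ᵐ ξ : R3, ξ ≠ 0 := by
      simp [ae_iff]
    have hgF' := ae_all_iff.2 fun i => ae_all_iff.2 fun j => hgF i j
    filter_upwards [hwF, hgF', hne] with ξ h1 h2 h3
    obtain ⟨j, hj⟩ : ∃ j, ξ j ≠ 0 := by
      by_contra! hcon
      exact h3 (by ext i; simpa using hcon i)
    have hj' : ((ξ j : ℝ) : ℂ) ≠ 0 := by exact_mod_cast hj
    refine (mul_eq_zero.1 ?_).resolve_left hj'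
    have h5 := congrArg (starRingEnd ℂ) h1
    simp only [map_sum, map_mul, Complex.conj_ofReal, map_zero] at h5
    rw [Finset.mul_sum]
    calc _ = ∑ i, ((ξ i : ℝ) : ℂ) *
          (starRingEnd ℂ) ((𝓕 (toC (hw2 i)) : Lp ℂ 2 (volume : Measure R3)) ξ) *
          (𝓕 (toC (hg2 j)) : Lp ℂ 2 (volume : Measure R3)) ξ := by
          refine Finset.sum_congr rfl fun i _ => ?_
          rw [RCLike.inner_apply]
          linear_combination (starRingEnd ℂ)
            ((𝓕 (toC (hw2 i)) : Lp ℂ 2 (volume : Measure R3)) ξ) * h2 i j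
      _ = 0 := by rw [← Finset.sum_mul, h5, zero_mul]
  have hinner : ∑ i, inner ℂ (toC (hw2 i)) (toC (hg2 i)) = 0 := by
    calc _ = ∑ i, inner ℂ (𝓕 (toC (hw2 i)) : Lp ℂ 2 (volume : Measure R3)) (𝓕 (toC (hg2 i))) :=
          Finset.sum_congr rfl fun i _ => (Lp.inner_fourier_eq _ _).symm
      _ = 0 := by
          simp_rw [L2.inner_def]
          rw [← integral_finsetSum _ fun i _ => L2.integrable_inner _ _]
          rw [integral_congr_ae hpt, integral_zero]
  have hreal : ∀ i, inner ℂ (toC (hw2 i)) (toC (hg2 i)) = ((∫ x, w i x * g i x : ℝ) : ℂ) := by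
    intro i
    rw [L2.inner_def, ← integral_complex_ofReal]
    refine integral_congr_ae ?_
    filter_upwards [coeFn_toC (hw2 i), coeFn_toC (hg2 i)] with x h1 h2
    rw [h1, h2, RCLike.inner_apply]
    simp [mul_comm]
  simp_rw [hreal] at hinner
  have hint : ∀ i, Integrable fun x => w i x * g i x := fun i => (hw2 i).integrable_mul (hg2 i)
  rw [integral_finsetSum _ fun i _ => hint i]
  exact_mod_cast hinner



/-! ### Symmetries of axisymmetric fields -/

theorem vec3_ext {a b : R3} (h0 : a 0 = b 0) (h1 : a 1 = b 1) (h2 : a 2 = b 2) : a = b := by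
  ext i; fin_cases i <;> assumption

theorem norm_sq_vec3 (a : R3) : ‖a‖ ^ 2 = a 0 ^ 2 + a 1 ^ 2 + a 2 ^ 2 := by
  rw [EuclideanSpace.real_norm_sq_eq, Fin.sum_univ_three]

theorem pderiv_eq {v : R3 → R3} {x : R3} (hv : DifferentiableAt ℝ v x) (i j : Fin 3) :
    pderiv v i j x = fderiv ℝ (fun y => v y j) x (e i) := by
  have := (EuclideanSpace.proj j : R3 →L[ℝ] ℝ).hasFDerivAt.comp x hv.hasFDerivAt
  rw [show (fun y => v y j) = (EuclideanSpace.proj j : R3 →L[ℝ] ℝ) ∘ v from rfl, this.fderiv]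
  rfl

theorem continuous_pderiv {v : R3 → R3} (hv : ContDiff ℝ 1 v) (i j : Fin 3) :
    Continuous (pderiv v i j) := by
  have h := (hv.continuous_fderiv (by simp)).clm_apply (continuous_const (y := e i))
  exact (EuclideanSpace.proj j : R3 →L[ℝ] ℝ).continuous.comp h

theorem continuous_curl {v : R3 → R3} (hv : ContDiff ℝ 1 v) : Continuous (curl v) := by
  have := continuous_pderiv hv
  unfold curl
  fun_prop

/-- The linear map with matrix `(c, -s; s, c)` in the horizontal plane and factor `k` along the
axis: rotations about the axis, and reflections. -/
def rotL (c s k : ℝ) : R3 →L[ℝ] R3 :=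
  LinearMap.toContinuousLinearMap
    { toFun := fun x => !₂[c * x 0 - s * x 1, s * x 0 + c * x 1, k * x 2]
      map_add' := fun x y => by apply vec3_ext <;> simp <;> ring
      map_smul' := fun a x => by apply vec3_ext <;> simp <;> ring }

@[simp] theorem rotL_apply_zero (c s k : ℝ) (x : R3) : rotL c s k x 0 = c * x 0 - s * x 1 := by
  simp [rotL]

@[simp] theorem rotL_apply_one (c s k : ℝ) (x : R3) : rotL c s k x 1 = s * x 0 + c * x 1 := by
  simp [rotL]

@[simp] theorem rotL_apply_two (c s k : ℝ) (x : R3) : rotL c s k x 2 = k * x 2 := by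
  simp [rotL]

/-- The mirror image in the plane `x₂ = 0`. -/
def mirrorL : R3 →L[ℝ] R3 :=
  LinearMap.toContinuousLinearMap
    { toFun := fun x => !₂[x 0, - x 1, x 2]
      map_add' := fun x y => by apply vec3_ext <;> simp; ring
      map_smul' := fun a x => by apply vec3_ext <;> simp }

@[simp] theorem mirrorL_apply_zero (x : R3) : mirrorL x 0 = x 0 := by simp [mirrorL]
@[simp] theorem mirrorL_apply_one (x : R3) : mirrorL x 1 = - x 1 := by simp [mirrorL]
@[simp] theorem mirrorL_apply_two (x : R3) : mirrorL x 2 = x 2 := by simp [mirrorL]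

/-- The derivative of an equivariant field is equivariant. -/
theorem fderiv_equivariant {v : R3 → R3} (hv : Differentiable ℝ v) (S S' : R3 →L[ℝ] R3)
    (hS : ∀ x, v (S x) = S' (v x)) (x h : R3) :
    fderiv ℝ v (S x) (S h) = S' (fderiv ℝ v x h) := by
  have h1 := (hv (S x)).hasFDerivAt.comp x S.hasFDerivAt
  have h2 := S'.hasFDerivAt.comp x (hv x).hasFDerivAt
  rw [show v ∘ S = S' ∘ v from funext hS] at h1
  exact congrArg (fun L : R3 →L[ℝ] R3 => L h) (h1.unique h2)

theorem radius_nonneg (x : R3) : 0 ≤ radius x := Real.sqrt_nonneg _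

theorem radius_sq (x : R3) : radius x ^ 2 = x 0 ^ 2 + x 1 ^ 2 :=
  Real.sq_sqrt (by positivity)

section Axisymmetric

variable {v : R3 → R3} (ha : IsAxisymmetricSwirlFree v)

include ha

theorem axisym_noSwirl (x : R3) : x 0 * v x 1 - x 1 * v x 0 = 0 := by
  obtain ⟨vr, vz, h⟩ := ha
  rw [h x]
  simp [eR, eZ]
  ring

theorem axisym_rot {c s : ℝ} (hcs : c ^ 2 + s ^ 2 = 1) (x : R3) :
    v (rotL c s 1 x) = rotL c s 1 (v x) := by
  obtain ⟨vr, vz, h⟩ := ha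
  have hr : radius (rotL c s 1 x) = radius x := by
    unfold radius
    congr 1
    simp only [rotL_apply_zero, rotL_apply_one]
    linear_combination (x 0 ^ 2 + x 1 ^ 2) * hcs
  rw [h x, h (rotL c s 1 x), hr]
  apply vec3_ext <;> simp [eR, eZ, hr] <;> left <;> ring

theorem axisym_mirror (x : R3) : v (mirrorL x) = mirrorL (v x) := by
  obtain ⟨vr, vz, h⟩ := ha
  have hr : radius (mirrorL x) = radius x := by simp [radius]
  rw [h x, h (mirrorL x), hr]
  apply vec3_ext <;> simp [eR, eZ, hr]
  ring

theorem axisym_horizontal_on_axis {x : R3} (h0 : x 0 = 0) (h1 : x 1 = 0) :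
    v x 0 = 0 ∧ v x 1 = 0 := by
  have h := axisym_rot ha (c := -1) (s := 0) (by norm_num) x
  have hx : rotL (-1) 0 1 x = x := by apply vec3_ext <;> simp [h0, h1]
  rw [hx] at h
  have e0 := congrArg (fun y : R3 => y 0) h
  have e1 := congrArg (fun y : R3 => y 1) h
  simp at e0 e1
  constructor <;> linarith

variable (hv : Differentiable ℝ v)

include hv

theorem curl_rot {c s : ℝ} (hcs : c ^ 2 + s ^ 2 = 1) (x : R3) :
    curl v (rotL c s 1 x) = rotL c s 1 (curl v x) := by
  have H := fderiv_equivariant hv (rotL c s 1) (rotL c s 1) (axisym_rot ha hcs) x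
  have s0 : rotL c s 1 (e 0) = c • e 0 + s • e 1 := by apply vec3_ext <;> simp
  have s1 : rotL c s 1 (e 1) = (-s) • e 0 + c • e 1 := by apply vec3_ext <;> simp
  have s2 : rotL c s 1 (e 2) = e 2 := by apply vec3_ext <;> simp
  have H0 := H (e 0)
  have H1 := H (e 1)
  have H2 := H (e 2)
  rw [s0, map_add, map_smul, map_smul] at H0
  rw [s1, map_add, map_smul, map_smul] at H1
  rw [s2] at H2
  have H00 := congrArg (fun y : R3 => y 0) H0
  have H01 := congrArg (fun y : R3 => y 1) H0
  have H02 := congrArg (fun y : R3 => y 2) H0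
  have H10 := congrArg (fun y : R3 => y 0) H1
  have H11 := congrArg (fun y : R3 => y 1) H1
  have H12 := congrArg (fun y : R3 => y 2) H1
  have H20 := congrArg (fun y : R3 => y 0) H2
  have H21 := congrArg (fun y : R3 => y 1) H2
  simp only [PiLp.add_apply, PiLp.smul_apply, smul_eq_mul, rotL_apply_zero, rotL_apply_one,
    rotL_apply_two] at H00 H01 H02 H10 H11 H12 H20 H21
  apply vec3_ext
  · simp [curl, pderiv]
    linear_combination (-1) * H21 + s * H02 + c * H12 -
      (fderiv ℝ v (rotL c s 1 x) (e 1) 2) * hcs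
  · simp [curl, pderiv]
    linear_combination H20 - c * H02 + s * H12 +
      (fderiv ℝ v (rotL c s 1 x) (e 0) 2) * hcs
  · simp [curl, pderiv]
    linear_combination (-s) * H00 - c * H10 + c * H01 - s * H11 +
      (fderiv ℝ v x (e 0) 1 - fderiv ℝ v x (e 1) 0
        - fderiv ℝ v (rotL c s 1 x) (e 0) 1 + fderiv ℝ v (rotL c s 1 x) (e 1) 0) * hcs

theorem curl_on_halfplane (r z : ℝ) :
    curl v !₂[r, 0, z] 0 = 0 ∧ curl v !₂[r, 0, z] 2 = 0 := by
  have H := fderiv_equivariant hv mirrorL mirrorL (axisym_mirror ha) !₂[r, 0, z]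
  have hx : mirrorL !₂[r, 0, z] = !₂[r, 0, z] := by apply vec3_ext <;> simp
  rw [hx] at H
  have s0 : mirrorL (e 0) = e 0 := by apply vec3_ext <;> simp
  have s1 : mirrorL (e 1) = - e 1 := by apply vec3_ext <;> simp
  have s2 : mirrorL (e 2) = e 2 := by apply vec3_ext <;> simp
  have H0 := H (e 0)
  have H1 := H (e 1)
  have H2 := H (e 2)
  rw [s0] at H0
  rw [s1, map_neg] at H1
  rw [s2] at H2
  have H01 := congrArg (fun y : R3 => y 1) H0
  have H10 := congrArg (fun y : R3 => y 0) H1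
  have H12 := congrArg (fun y : R3 => y 2) H1
  have H21 := congrArg (fun y : R3 => y 1) H2
  simp only [PiLp.neg_apply, mirrorL_apply_zero, mirrorL_apply_one, mirrorL_apply_two]
    at H01 H10 H12 H21
  constructor
  · simp [curl, pderiv]; linarith
  · simp [curl, pderiv]; linarith

/-- The vorticity is `ω_θ e_θ`, in polar coordinates. -/
theorem curl_polar (r θ z : ℝ) :
    curl v !₂[r * Real.cos θ, r * Real.sin θ, z] =
      omegaTheta v r z • !₂[-Real.sin θ, Real.cos θ, 0] := by
  have hcs : Real.cos θ ^ 2 + Real.sin θ ^ 2 = 1 := by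
    rw [add_comm]; exact Real.sin_sq_add_cos_sq θ
  have h := curl_rot ha hv hcs !₂[r, 0, z]
  have hx : rotL (Real.cos θ) (Real.sin θ) 1 !₂[r, 0, z] =
      !₂[r * Real.cos θ, r * Real.sin θ, z] := by
    apply vec3_ext <;> simp [mul_comm]
  obtain ⟨h0, h2⟩ := curl_on_halfplane ha hv r z
  rw [hx] at h
  rw [h]
  apply vec3_ext <;> simp only [rotL_apply_zero, rotL_apply_one, rotL_apply_two, h0, h2] <;>
    simp [omegaTheta, mul_comm]

omit ha hv in
theorem exists_polar (x : R3) :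
    ∃ θ, x = !₂[radius x * Real.cos θ, radius x * Real.sin θ, x 2] := by
  refine ⟨Complex.arg ⟨x 0, x 1⟩, ?_⟩
  have hn : ‖(⟨x 0, x 1⟩ : ℂ)‖ = radius x := by
    rw [Complex.norm_def, Complex.normSq_mk, radius]; ring_nf
  have h := Complex.norm_mul_cos_add_sin_mul_I (⟨x 0, x 1⟩ : ℂ)
  rw [hn] at h
  have hre := congrArg Complex.re h
  have him := congrArg Complex.im h
  apply vec3_ext
  · have := Complex.norm_mul_cos_arg (⟨x 0, x 1⟩ : ℂ)
    rw [hn] at this; simpa using this.symm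
  · have := Complex.norm_mul_sin_arg (⟨x 0, x 1⟩ : ℂ)
    rw [hn] at this; simpa using this.symm
  · simp

theorem curl_formula (x : R3) :
    radius x * curl v x 0 = - x 1 * omegaTheta v (radius x) (x 2) ∧
    radius x * curl v x 1 = x 0 * omegaTheta v (radius x) (x 2) ∧ curl v x 2 = 0 := by
  obtain ⟨θ, hθ⟩ := exists_polar x
  have h := curl_polar ha hv (radius x) θ (x 2)
  rw [← hθ] at h
  have h0 : x 0 = radius x * Real.cos θ := by
    have := congrArg (fun y : R3 => y 0) hθ; simpa using this
  have h1 : x 1 = radius x * Real.sin θ := by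
    have := congrArg (fun y : R3 => y 1) hθ; simpa using this
  have k0 := congrArg (fun y : R3 => y 0) h
  have k1 := congrArg (fun y : R3 => y 1) h
  have k2 := congrArg (fun y : R3 => y 2) h
  simp at k0 k1 k2
  refine ⟨?_, ?_, k2⟩
  · rw [k0, h1]; ring
  · rw [k1, h0]; ring

theorem curl_on_axis {x : R3} (h0 : x 0 = 0) (h1 : x 1 = 0) : curl v x = 0 := by
  have h := curl_rot ha hv (c := -1) (s := 0) (by norm_num) x
  have hx : rotL (-1) 0 1 x = x := by apply vec3_ext <;> simp [h0, h1]
  rw [hx] at h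
  have e0 := congrArg (fun y : R3 => y 0) h
  have e1 := congrArg (fun y : R3 => y 1) h
  simp at e0 e1
  apply vec3_ext
  · simp; linarith
  · simp; linarith
  · exact (curl_formula ha hv x).2.2

theorem norm_curl (x : R3) : ‖curl v x‖ = |omegaTheta v (radius x) (x 2)| := by
  obtain ⟨θ, hθ⟩ := exists_polar x
  have h := curl_polar ha hv (radius x) θ (x 2)
  rw [← hθ] at h
  have h1 : ‖(!₂[-Real.sin θ, Real.cos θ, 0] : R3)‖ = 1 := by
    rw [← sq_eq_sq₀ (norm_nonneg _) zero_le_one, norm_sq_vec3]; simp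
  rw [h, norm_smul, h1, mul_one, Real.norm_eq_abs]

end Axisymmetric

/-! ### Reflection in the plane `z = 0` -/

/-- The reflection `z ↦ -z`. -/
def refl : R3 ≃ₗᵢ[ℝ] R3 :=
  LinearIsometryEquiv.piLpCongrRight 2
    (fun i : Fin 3 => if i = 2 then LinearIsometryEquiv.neg ℝ else LinearIsometryEquiv.refl ℝ ℝ)

@[simp] theorem refl_apply_zero (x : R3) : refl x 0 = x 0 := by
  simp [refl]
@[simp] theorem refl_apply_one (x : R3) : refl x 1 = x 1 := by
  simp [refl]
@[simp] theorem refl_apply_two (x : R3) : refl x 2 = - x 2 := by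
  simp [refl]

@[simp] theorem refl_refl (x : R3) : refl (refl x) = x := by
  apply vec3_ext <;> simp

theorem measurePreserving_refl : MeasurePreserving refl (volume : Measure R3) volume :=
  LinearIsometryEquiv.measurePreserving _

/-- The mirror image of a field under the reflection `z ↦ -z`. -/
def reflField (v : R3 → R3) (x : R3) : R3 := refl (v (refl x))

theorem contDiff_reflField {v : R3 → R3} (hv : ContDiff ℝ 1 v) : ContDiff ℝ 1 (reflField v) :=
  refl.contDiff.comp (hv.comp refl.contDiff)

theorem fderiv_reflField {v : R3 → R3} (hv : Differentiable ℝ v) (x h : R3) :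
    fderiv ℝ (reflField v) x h = refl (fderiv ℝ v (refl x) (refl h)) := by
  have h1 : HasFDerivAt refl (refl.toContinuousLinearEquiv : R3 →L[ℝ] R3) x :=
    refl.toContinuousLinearEquiv.hasFDerivAt
  have h2 : HasFDerivAt refl (refl.toContinuousLinearEquiv : R3 →L[ℝ] R3) (v (refl x)) :=
    refl.toContinuousLinearEquiv.hasFDerivAt
  have := h2.comp x ((hv (refl x)).hasFDerivAt.comp x h1)
  rw [show reflField v = refl ∘ v ∘ refl from rfl, this.fderiv]
  rfl

theorem refl_e_zero : refl (e 0) = e 0 := by apply vec3_ext <;> simp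
theorem refl_e_one : refl (e 1) = e 1 := by apply vec3_ext <;> simp
theorem refl_e_two : refl (e 2) = - e 2 := by apply vec3_ext <;> simp

/-- The vorticity is a pseudovector: under reflection it changes sign relative to a vector field. -/
theorem curl_reflField {v : R3 → R3} (hv : Differentiable ℝ v) (x : R3) :
    curl (reflField v) x = - refl (curl v (refl x)) := by
  apply vec3_ext <;>
    simp [curl, pderiv, fderiv_reflField hv, refl_e_zero, refl_e_one, refl_e_two] <;> ring

theorem divergence_reflField {v : R3 → R3} (hv : Differentiable ℝ v) (x : R3) :
    divergence (reflField v) x = divergence v (refl x) := by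
  simp [divergence, Fin.sum_univ_three, pderiv, fderiv_reflField hv, refl_e_zero, refl_e_one,
    refl_e_two]



/-! ### Regularity of the solution and uniqueness -/

/-- A finite energy solution of the Euler equation which is continuous in time with values in
`C¹ ∩ L²`, bounded together with its derivatives. -/
structure RegularSolution (u : ℝ → R3 → R3) : Prop where
  contDiff : ∀ t, 0 ≤ t → ContDiff ℝ 1 (u t)
  memLp : ∀ t, 0 ≤ t → MemLp (u t) 2 (volume : Measure R3)
  div_eq_zero : ∀ t, 0 ≤ t → ∀ x, divergence (u t) x = 0
  bounded : ∀ t, 0 ≤ t → ∃ M, ∀ x, ‖u t x‖ ≤ M ∧ ‖fderiv ℝ (u t) x‖ ≤ M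
  sup_cont : ∀ t, 0 ≤ t → ∀ ε, 0 < ε → ∀ᶠ τ in 𝓝[Ici 0] t, ∀ x,
    ‖u τ x - u t x‖ ≤ ε ∧ ‖fderiv ℝ (u τ) x - fderiv ℝ (u t) x‖ ≤ ε
  l2_cont : ∀ t, 0 ≤ t → Tendsto (fun τ => eLpNorm (fun x => u τ x - u t x) 2
    (volume : Measure R3)) (𝓝[Ici 0] t) (𝓝 0)
  momentum : ∃ p : ℝ → R3 → ℝ, ∀ t, 0 < t → ContDiff ℝ 1 (p t) ∧
    HasL2DerivAt u (fun x => -(advect (u t) (u t) x) - gradient (p t) x) t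

/-- The Sobolev embedding turns continuity in time with values in `H^s` into uniform control of the
field and its gradient. -/
theorem IsGlobalEulerSolution.regularSolution {s : ℝ} (hs : 5 / 2 < s) {u : ℝ → R3 → R3}
    (hu : IsGlobalEulerSolution s u) : RegularSolution u := by
  obtain ⟨C, hC0, hC⟩ := exists_sobolev_bound s hs
  have hcont := hu.regular.continuous_slice
  have hmem : ∀ t, 0 ≤ t → MemHs s (u t) := fun t ht => (hu.regular.mem t ht).1
  have hsub : ∀ t τ, 0 ≤ t → 0 ≤ τ → MemLp (complexify fun x => u τ x - u t x) 2 volume := by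
    intro t τ ht hτ
    have : (complexify fun x => u τ x - u t x) = complexify (u τ) - complexify (u t) := by
      ext x i; simp [complexify]
    rw [this]
    exact (hmem τ hτ).1.sub (hmem t ht).1
  refine ⟨fun t ht => (hC _ (hcont t ht) (hmem t ht)).1,
    fun t ht => memLp_of_complexify (hcont t ht) (hmem t ht).1, hu.incompressible,
    fun t ht => ⟨_, fun x => ⟨(hC _ (hcont t ht) (hmem t ht)).2.1 x,
      (hC _ (hcont t ht) (hmem t ht)).2.2 x⟩⟩, ?_, ?_, hu.momentum⟩
  · intro t ht ε hε
    have hlim := hu.regular.continuous_time t ht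
    have hδ : (0 : ENNReal) < ENNReal.ofReal (ε / (C + 1)) := by
      rw [ENNReal.ofReal_pos]; positivity
    filter_upwards [hlim.eventually_lt_const hδ, self_mem_nhdsWithin] with τ hτ hτ0 x
    have hτ0 : 0 ≤ τ := hτ0
    have hm : MemHs s fun x => u τ x - u t x :=
      ⟨hsub t τ ht hτ0, hτ.trans ENNReal.ofReal_lt_top⟩
    obtain ⟨-, h1, h2⟩ := hC _ ((hcont τ hτ0).sub (hcont t ht)) hm
    have hle : C * (hsNorm s fun x => u τ x - u t x).toReal ≤ ε := by
      have : (hsNorm s fun x => u τ x - u t x).toReal ≤ ε / (C + 1) :=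
        ENNReal.toReal_le_of_le_ofReal (by positivity) hτ.le
      calc C * (hsNorm s fun x => u τ x - u t x).toReal ≤ (C + 1) * (ε / (C + 1)) := by
            gcongr; linarith
        _ = ε := by field_simp
    refine ⟨(h1 x).trans hle, ?_⟩
    have hd : fderiv ℝ (fun x => u τ x - u t x) x = fderiv ℝ (u τ) x - fderiv ℝ (u t) x :=
      fderiv_fun_sub ((hC _ (hcont τ hτ0) (hmem τ hτ0)).1.differentiable (by simp) x)
        ((hC _ (hcont t ht) (hmem t ht)).1.differentiable (by simp) x)
    rw [← hd]
    exact (h2 x).trans hle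
  · intro t ht
    refine tendsto_of_tendsto_of_tendsto_of_le_of_le' tendsto_const_nhds
      (hu.regular.continuous_time t ht) (Eventually.of_forall fun _ => zero_le) ?_
    filter_upwards [self_mem_nhdsWithin] with τ hτ
    exact eLpNorm_le_hsNorm (by linarith) (hsub t τ ht hτ)

theorem gradient_apply {p : R3 → ℝ} (x : R3) (i : Fin 3) :
    gradient p x i = fderiv ℝ p x (e i) := by
  have h : inner ℝ (gradient p x) (e i) = fderiv ℝ p x (e i) := by
    rw [gradient, InnerProductSpace.toDual_symm_apply]
  rw [← h, EuclideanSpace.inner_single_right]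
  simp

theorem continuous_gradient {p : R3 → ℝ} (hp : ContDiff ℝ 1 p) : Continuous (gradient p) :=
  (InnerProductSpace.toDual ℝ R3).symm.continuous.comp (hp.continuous_fderiv (by simp))

theorem eLpNorm_reflField (v : R3 → R3) (hv : AEStronglyMeasurable v volume) :
    eLpNorm (reflField v) 2 volume = eLpNorm v 2 volume := by
  rw [← eLpNorm_comp_measurePreserving hv measurePreserving_refl]
  exact eLpNorm_congr_norm_ae (Eventually.of_forall fun x => refl.norm_map _)

theorem continuous_advect {v : R3 → R3} (hv : ContDiff ℝ 1 v) : Continuous (advect v v) :=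
  (hv.continuous_fderiv (by simp)).clm_apply hv.continuous

namespace RegularSolution

variable {u : ℝ → R3 → R3} (hu : RegularSolution u)

include hu

theorem differentiable {t : ℝ} (ht : 0 ≤ t) : Differentiable ℝ (u t) :=
  (hu.contDiff t ht).differentiable (by simp)

theorem continuous {t : ℝ} (ht : 0 ≤ t) : Continuous (u t) := (hu.contDiff t ht).continuous

/-- Uniform bounds for the field and its gradient on compact time intervals, which follow from the
continuity in time and compactness. -/
theorem exists_bound (T : ℝ) : ∃ M, 0 < M ∧ ∀ t ∈ Icc 0 T, ∀ x,
    ‖u t x‖ ≤ M ∧ ‖fderiv ℝ (u t) x‖ ≤ M := by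
  refine (isCompact_Icc (a := (0 : ℝ)) (b := T)).induction_on
    (p := fun S => ∃ M, 0 < M ∧ ∀ t ∈ S, ∀ x, ‖u t x‖ ≤ M ∧ ‖fderiv ℝ (u t) x‖ ≤ M)
    ⟨1, one_pos, by simp⟩ ?_ ?_ ?_
  · rintro S S' hSS' ⟨M, hM, h⟩
    exact ⟨M, hM, fun t ht => h t (hSS' ht)⟩
  · rintro S S' ⟨M, hM, h⟩ ⟨M', hM', h'⟩
    refine ⟨max M M', lt_max_of_lt_left hM, ?_⟩
    rintro t (ht | ht) x
    · exact ⟨(h t ht x).1.trans (le_max_left _ _), (h t ht x).2.trans (le_max_left _ _)⟩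
    · exact ⟨(h' t ht x).1.trans (le_max_right _ _), (h' t ht x).2.trans (le_max_right _ _)⟩
  · intro t ht
    obtain ⟨M, hM⟩ := hu.bounded t ht.1
    refine ⟨_, nhdsWithin_mono t (fun τ hτ => hτ.1 : Icc 0 T ⊆ Ici 0)
      (hu.sup_cont t ht.1 1 one_pos), M + 1, by linarith [(norm_nonneg _).trans (hM 0).1], ?_⟩
    intro τ hτ x
    obtain ⟨h1, h2⟩ := hτ x
    obtain ⟨h3, h4⟩ := hM x
    constructor
    · calc ‖u τ x‖ = ‖u t x + (u τ x - u t x)‖ := by congr 1; abel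
        _ ≤ M + 1 := (norm_add_le _ _).trans (add_le_add h3 h1)
    · calc ‖fderiv ℝ (u τ) x‖ = ‖fderiv ℝ (u t) x + (fderiv ℝ (u τ) x - fderiv ℝ (u t) x)‖ := by
            congr 1; abel
        _ ≤ M + 1 := (norm_add_le _ _).trans (add_le_add h4 h2)

theorem reflect : RegularSolution (fun t => reflField (u t)) := by
  refine ⟨fun t ht => contDiff_reflField (hu.contDiff t ht), fun t ht => ?_, fun t ht x => ?_,
    fun t ht => ?_, fun t ht ε hε => ?_, fun t ht => ?_, ?_⟩
  · refine ⟨(contDiff_reflField (hu.contDiff t ht)).continuous.aestronglyMeasurable, ?_⟩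
    rw [eLpNorm_reflField _ (hu.memLp t ht).1]
    exact (hu.memLp t ht).2
  · rw [divergence_reflField (hu.differentiable ht), hu.div_eq_zero t ht]
  · obtain ⟨M, hM⟩ := hu.bounded t ht
    have hM0 : 0 ≤ M := (norm_nonneg _).trans (hM 0).1
    refine ⟨M, fun x => ⟨(refl.norm_map _).le.trans (hM _).1, ?_⟩⟩
    refine ContinuousLinearMap.opNorm_le_bound _ hM0 fun h => ?_
    rw [fderiv_reflField (hu.differentiable ht), refl.norm_map]
    refine (ContinuousLinearMap.le_of_opNorm_le _ (hM _).2 _).trans ?_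
    rw [refl.norm_map]
  · filter_upwards [hu.sup_cont t ht ε hε, self_mem_nhdsWithin] with τ hτ hτ0 x
    have hτ0 : 0 ≤ τ := hτ0
    obtain ⟨h1, h2⟩ := hτ (refl x)
    constructor
    · simp only [reflField]
      rw [← map_sub, refl.norm_map]; exact h1
    · refine ContinuousLinearMap.opNorm_le_bound _ hε.le fun h => ?_
      rw [_root_.sub_apply, fderiv_reflField (hu.differentiable ht),
        fderiv_reflField (hu.differentiable hτ0), ← map_sub, refl.norm_map,
        ← _root_.sub_apply]
      refine (ContinuousLinearMap.le_of_opNorm_le _ h2 _).trans ?_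
      rw [refl.norm_map]
  · refine (hu.l2_cont t ht).congr' ?_
    filter_upwards [self_mem_nhdsWithin] with τ hτ
    have hτ : 0 ≤ τ := hτ
    rw [← eLpNorm_reflField (fun x => u τ x - u t x)
      ((hu.continuous hτ).sub (hu.continuous ht)).aestronglyMeasurable]
    congr 1; ext1 x; simp [reflField]
  · obtain ⟨p, hp⟩ := hu.momentum
    refine ⟨fun t x => p t (refl x), fun t ht => ⟨(hp t ht).1.comp refl.contDiff, ?_⟩⟩
    have hc := hu.contDiff t ht.le
    have hgrad : ∀ x, gradient (fun x => p t (refl x)) x = refl (gradient (p t) (refl x)) := by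
      intro x
      have h1 : HasFDerivAt refl (refl.toContinuousLinearEquiv : R3 →L[ℝ] R3) x :=
        refl.toContinuousLinearEquiv.hasFDerivAt
      have h2 := ((hp t ht).1.differentiable (by simp) (refl x)).hasFDerivAt.comp x h1
      have h3 : ∀ h, fderiv ℝ (fun x => p t (refl x)) x h = fderiv ℝ (p t) (refl x) (refl h) := by
        intro h
        rw [show (fun x => p t (refl x)) = p t ∘ refl from rfl, h2.fderiv]; rfl
      apply vec3_ext <;>
        simp [gradient_apply, h3, refl_e_zero, refl_e_one, refl_e_two]
    have hw : (fun x => -(advect (reflField (u t)) (reflField (u t)) x)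
        - gradient (fun x => p t (refl x)) x) =
        reflField (fun x => -(advect (u t) (u t) x) - gradient (p t) x) := by
      ext1 x
      simp only [advect, fderiv_reflField (hu.differentiable ht.le), hgrad]
      simp [reflField]
    rw [hw]
    unfold HasL2DerivAt
    refine ((hp t ht).2).congr' ?_
    have hev : ∀ᶠ h : ℝ in 𝓝[≠] 0, 0 ≤ t + h :=
      (nhdsWithin_le_nhds : 𝓝[≠] (0 : ℝ) ≤ 𝓝 0) ((tendsto_const_nhds.add tendsto_id :
        Tendsto (fun h : ℝ => t + h) (𝓝 0) (𝓝 (t + 0))).eventually_const_le (by simpa using ht))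
    filter_upwards [hev] with h hh
    rw [← eLpNorm_reflField]
    · congr 1; ext1 x; simp [reflField]
    · refine Continuous.aestronglyMeasurable ?_
      exact (((hu.continuous hh).sub (hu.continuous ht.le)).const_smul h⁻¹).sub
        ((continuous_advect hc).neg.sub (continuous_gradient (hp t ht).1))

end RegularSolution

open Classical in
/-- The class in `L²` of a vector field, and `0` if the field is not square integrable. -/
def toL2 (f : R3 → R3) : Lp R3 2 (volume : Measure R3) :=
  if h : MemLp f 2 (volume : Measure R3) then h.toLp f else 0

theorem toL2_eq {f : R3 → R3} (h : MemLp f 2 (volume : Measure R3)) : toL2 f = h.toLp f := by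
  rw [toL2, dif_pos h]

theorem inner_toL2 {f g : R3 → R3} (hf : MemLp f 2 (volume : Measure R3))
    (hg : MemLp g 2 (volume : Measure R3)) :
    inner ℝ (toL2 f) (toL2 g) = ∫ x, inner ℝ (f x) (g x) := by
  rw [toL2_eq hf, toL2_eq hg, L2.inner_def]
  refine integral_congr_ae ?_
  filter_upwards [hf.coeFn_toLp, hg.coeFn_toLp] with x h1 h2
  rw [h1, h2]

theorem inner_vec3 (a b : R3) : inner ℝ a b = ∑ i, a i * b i := by
  rw [PiLp.inner_apply]; simp [mul_comm]

/-- Differentiability in `L²`, as differentiability of a curve in a Banach space. -/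
theorem HasL2DerivAt.hasDerivAt {u : ℝ → R3 → R3} {w : R3 → R3} {t : ℝ} (ht : 0 < t)
    (hmem : ∀ τ, 0 ≤ τ → MemLp (u τ) 2 (volume : Measure R3)) (hw : Continuous w)
    (h : HasL2DerivAt u w t) :
    MemLp w 2 (volume : Measure R3) ∧ HasDerivAt (fun τ => toL2 (u τ)) (toL2 w) t := by
  have hev : ∀ᶠ h : ℝ in 𝓝[≠] 0, 0 ≤ t + h :=
    (nhdsWithin_le_nhds : 𝓝[≠] (0 : ℝ) ≤ 𝓝 0) ((tendsto_const_nhds.add tendsto_id :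
      Tendsto (fun h : ℝ => t + h) (𝓝 0) (𝓝 (t + 0))).eventually_const_le (by simpa using ht))
  have hq : ∀ h, 0 ≤ t + h → MemLp (fun x => h⁻¹ • (u (t + h) x - u t x)) 2 volume :=
    fun h hh => ((hmem _ hh).sub (hmem t ht.le)).const_smul h⁻¹
  have hwm : MemLp w 2 (volume : Measure R3) := by
    obtain ⟨k, hk1, hk2⟩ := (hev.and (h.eventually_lt_const ENNReal.zero_lt_top)).exists
    have h1 : MemLp (fun x => k⁻¹ • (u (t + k) x - u t x) - w x) 2 volume :=
      ⟨(hq k hk1).1.sub hw.aestronglyMeasurable, hk2⟩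
    have h2 := (hq k hk1).sub h1
    refine (memLp_congr_ae (Eventually.of_forall fun x => ?_)).1 h2
    simp
  refine ⟨hwm, ?_⟩
  rw [hasDerivAt_iff_tendsto_slope_zero, tendsto_iff_norm_sub_tendsto_zero]
  have h0 : Tendsto (fun k : ℝ => (eLpNorm (fun x => k⁻¹ • (u (t + k) x - u t x) - w x) 2
      (volume : Measure R3)).toReal) (𝓝[≠] 0) (𝓝 0) :=
    (ENNReal.tendsto_toReal ENNReal.zero_ne_top).comp h
  refine h0.congr' ?_
  filter_upwards [hev] with k hk
  rw [toL2_eq (hmem _ hk), toL2_eq (hmem t ht.le), toL2_eq hwm, ← MemLp.toLp_sub,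
    ← MemLp.toLp_const_smul, ← MemLp.toLp_sub, Lp.norm_toLp]
  rfl

/-- Integration by parts against a test function. -/
theorem integral_sum_mul_fderiv {f : Fin 3 → R3 → ℝ} (hf : ∀ i, ContDiff ℝ 1 (f i)) {ψ : R3 → ℝ}
    (hψ : ContDiff ℝ 1 ψ) (hc : HasCompactSupport ψ) :
    ∫ x, ∑ i, f i x * fderiv ℝ ψ x (e i) = - ∫ x, ψ x * ∑ i, fderiv ℝ (f i) x (e i) := by
  have hder : ∀ x i, fderiv ℝ (fun x => ψ x * f i x) x (e i) =
      ψ x * fderiv ℝ (f i) x (e i) + f i x * fderiv ℝ ψ x (e i) := by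
    intro x i
    rw [fderiv_fun_mul (hψ.differentiable (by simp) x) ((hf i).differentiable (by simp) x)]
    simp
  have hi1 : Integrable fun x => ∑ i, f i x * fderiv ℝ ψ x (e i) :=
    integrable_finsetSum _ fun i _ => ((hf i).continuous.mul
      (continuous_fderiv_e hψ _)).integrable_of_hasCompactSupport (hc.fderiv_apply ℝ _).mul_left
  have hi2 : Integrable fun x => ψ x * ∑ i, fderiv ℝ (f i) x (e i) :=
    (hψ.continuous.mul (continuous_finsetSum _ fun i _ =>
      continuous_fderiv_e (hf i) _)).integrable_of_hasCompactSupport hc.mul_right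
  have hsum : ∀ x, ∑ i, fderiv ℝ (fun x => ψ x * f i x) x (e i) =
      ψ x * ∑ i, fderiv ℝ (f i) x (e i) + ∑ i, f i x * fderiv ℝ ψ x (e i) := by
    intro x
    simp_rw [hder, Finset.sum_add_distrib, Finset.mul_sum]
  have key := integral_div_eq_zero (f := fun i x => ψ x * f i x) (fun i => hψ.mul (hf i))
    (fun i => (hψ.continuous.mul (hf i).continuous).integrable_of_hasCompactSupport hc.mul_right)
    (by simp_rw [hsum]; exact hi2.add hi1)
  simp_rw [hsum] at key
  rw [integral_add hi2 hi1] at key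
  linarith

theorem contDiff_comp {v : R3 → R3} (hv : ContDiff ℝ 1 v) (i : Fin 3) :
    ContDiff ℝ 1 fun x => v x i :=
  (EuclideanSpace.proj i : R3 →L[ℝ] ℝ).contDiff.comp hv

theorem memLp_comp {v : R3 → R3} (hv : MemLp v 2 (volume : Measure R3)) (i : Fin 3) :
    MemLp (fun x => v x i) 2 (volume : Measure R3) := by
  refine hv.of_le ((EuclideanSpace.proj i : R3 →L[ℝ] ℝ).continuous.comp_aestronglyMeasurable hv.1)
    (Eventually.of_forall fun x => ?_)
  exact PiLp.norm_apply_le (v x) i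

theorem sum_fderiv_comp {v : R3 → R3} (hv : Differentiable ℝ v) (x : R3) :
    ∑ i, fderiv ℝ (fun y => v y i) x (e i) = divergence v x := by
  simp_rw [divergence, pderiv_eq (hv x)]

theorem weakDiv_of_divergence {v : R3 → R3} (hv : ContDiff ℝ 1 v)
    (hd : ∀ x, divergence v x = 0) {ψ : R3 → ℝ} (hψ : ContDiff ℝ ∞ ψ)
    (hc : HasCompactSupport ψ) : ∫ x, ∑ i, v x i * fderiv ℝ ψ x (e i) = 0 := by
  rw [integral_sum_mul_fderiv (contDiff_comp hv) (hψ.of_le (by simp)) hc]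
  simp_rw [sum_fderiv_comp (hv.differentiable (by simp)), hd]
  simp

theorem weakCurl_of_gradient {q : R3 → ℝ} (hq : ContDiff ℝ 1 q) (i j : Fin 3) {ψ : R3 → ℝ}
    (hψ : ContDiff ℝ ∞ ψ) (hc : HasCompactSupport ψ) :
    ∫ x, (fderiv ℝ q x (e i) * fderiv ℝ ψ x (e j) -
      fderiv ℝ q x (e j) * fderiv ℝ ψ x (e i)) = 0 := by
  have hψ2 : ContDiff ℝ 2 ψ := contDiff_infty.1 hψ 2
  have hd1 : ∀ k, ContDiff ℝ 1 fun x => fderiv ℝ ψ x (e k) := fun k =>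
    (hψ2.fderiv_right (m := 1) (by norm_num)).clm_apply contDiff_const
  have hcs : ∀ k, HasCompactSupport fun x => fderiv ℝ ψ x (e k) := fun k => hc.fderiv_apply ℝ _
  have hint : ∀ k l, Integrable fun x => fderiv ℝ q x (e k) * fderiv ℝ ψ x (e l) := fun k l =>
    ((continuous_fderiv_e hq _).mul (hd1 l).continuous).integrable_of_hasCompactSupport
      (hcs l).mul_left
  have hibp : ∀ k l, ∫ x, fderiv ℝ q x (e k) * fderiv ℝ ψ x (e l) =
      - ∫ x, q x * fderiv ℝ (fun y => fderiv ℝ ψ y (e l)) x (e k) := by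
    intro k l
    have := integral_mul_fderiv_eq_neg_fderiv_mul_of_integrable (μ := (volume : Measure R3))
      (f := q) (g := fun x => fderiv ℝ ψ x (e l)) (v := e k) (hint k l)
      ((hq.continuous.mul (continuous_fderiv_e (hd1 l) _)).integrable_of_hasCompactSupport
        ((hcs l).fderiv_apply ℝ _).mul_left)
      ((hq.continuous.mul (hd1 l).continuous).integrable_of_hasCompactSupport (hcs l).mul_left)
      (fun x _ => hq.differentiable (by simp) x) (fun x _ => (hd1 l).differentiable (by simp) x)
    linarith
  have hsymm : ∀ x, fderiv ℝ (fun y => fderiv ℝ ψ y (e j)) x (e i) =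
      fderiv ℝ (fun y => fderiv ℝ ψ y (e i)) x (e j) := by
    intro x
    have hdd : DifferentiableAt ℝ (fderiv ℝ ψ) x :=
      (hψ2.fderiv_right (m := 1) (by norm_num)).differentiable (by simp) x
    have hc1 : ∀ k l, fderiv ℝ (fun y => fderiv ℝ ψ y (e l)) x (e k) =
        fderiv ℝ (fderiv ℝ ψ) x (e k) (e l) := by
      intro k l
      rw [fderiv_clm_apply hdd (differentiableAt_const _)]
      simp
    rw [hc1, hc1]
    exact (hψ2.contDiffAt.isSymmSndFDerivAt (by simp)).eq _ _
  rw [integral_sub (hint i j) (hint j i), hibp, hibp]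
  simp_rw [hsymm]
  ring

/-- A square integrable `C¹` field without divergence and curl vanishes. -/
theorem eq_zero_of_curl_divergence {w : R3 → R3} (hw : ContDiff ℝ 1 w)
    (hm : MemLp w 2 (volume : Measure R3)) (hd : ∀ x, divergence w x = 0)
    (hcurl : ∀ x, curl w x = 0) (x : R3) : w x = 0 := by
  have hsym : ∀ x i j, pderiv w i j x = pderiv w j i x := by
    intro x i j
    have h0 := congrArg (fun y : R3 => y 0) (hcurl x)
    have h1 := congrArg (fun y : R3 => y 1) (hcurl x)
    have h2 := congrArg (fun y : R3 => y 2) (hcurl x)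
    simp [curl] at h0 h1 h2
    fin_cases i <;> fin_cases j <;> simp <;> linarith
  have h0 : ∫ x, ∑ i, w x i * w x i = 0 := by
    refine integral_divFree_mul_curlFree (w := fun i x => w x i) (g := fun i x => w x i)
      (memLp_comp hm) (memLp_comp hm)
      (fun ψ h1 h2 => weakDiv_of_divergence hw hd h1 h2) ?_
    intro i j ψ hψ hc
    have hψ1 : ContDiff ℝ 1 ψ := hψ.of_le (by simp)
    have hw1 : ∀ k, Differentiable ℝ fun x => w x k := fun k =>
      (contDiff_comp hw k).differentiable (by simp)
    have hintc : ∀ k l, Integrable fun x => w x k * fderiv ℝ ψ x (e l) := fun k l =>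
      ((contDiff_comp hw k).continuous.mul
        (continuous_fderiv_e hψ1 _)).integrable_of_hasCompactSupport (hc.fderiv_apply ℝ _).mul_left
    have hibp : ∀ k l, ∫ x, w x k * fderiv ℝ ψ x (e l) = - ∫ x, pderiv w l k x * ψ x := by
      intro k l
      simp_rw [pderiv_eq (hw.differentiable (by simp) _)]
      refine integral_mul_fderiv_eq_neg_fderiv_mul_of_integrable ?_ (hintc k l) ?_
        (fun x _ => hw1 k x) (fun x _ => hψ1.differentiable (by simp) x)
      · exact ((continuous_fderiv_e (contDiff_comp hw k) _).mul
          hψ1.continuous).integrable_of_hasCompactSupport hc.mul_left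
      · exact ((contDiff_comp hw k).continuous.mul
          hψ1.continuous).integrable_of_hasCompactSupport hc.mul_left
    rw [integral_sub (hintc i j) (hintc j i), hibp, hibp]
    simp_rw [hsym _ i j]
    ring
  have hsq : ∀ x, ∑ i, w x i * w x i = ‖w x‖ ^ 2 := fun x => by
    rw [EuclideanSpace.real_norm_sq_eq]; simp [sq]
  simp_rw [hsq] at h0
  have hint : Integrable fun x => ‖w x‖ ^ 2 := by
    have := hm.integrable_norm_pow (by norm_num)
    simpa using this
  have h2 := (integral_eq_zero_iff_of_nonneg (fun x => sq_nonneg _) hint).1 h0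
  have h3 := ((hw.continuous.norm.pow 2).ae_eq_iff_eq volume (continuous_const (y := (0 : ℝ)))).1 h2
  have h4 : ‖w x‖ ^ 2 = 0 := congrFun h3 x
  simpa using h4



theorem sum_smul_e (a : R3) : a = ∑ i, a i • e i := by
  apply vec3_ext <;> simp [Fin.sum_univ_three]

theorem clm_apply_eq_sum (L : R3 →L[ℝ] ℝ) (a : R3) : L a = ∑ i, a i * L (e i) := by
  conv_lhs => rw [sum_smul_e a]
  simp

/-- A field with bounded derivative applied to a square integrable field. -/
theorem memLp_fderiv_apply {v w : R3 → R3} (hv : ContDiff ℝ 1 v) {M : ℝ}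
    (hM : ∀ x, ‖fderiv ℝ v x‖ ≤ M) (hw : MemLp w 2 (volume : Measure R3)) (hwc : Continuous w) :
    MemLp (fun x => fderiv ℝ v x (w x)) 2 (volume : Measure R3) := by
  refine hw.of_le_mul (c := M)
    ((hv.continuous_fderiv (by simp)).clm_apply hwc).aestronglyMeasurable
    (Eventually.of_forall fun x => ?_)
  exact (fderiv ℝ v x).le_of_opNorm_le (hM x) _

theorem integrable_inner_of_memLp {f g : R3 → R3} (hf : MemLp f 2 (volume : Measure R3))
    (hg : MemLp g 2 (volume : Measure R3)) : Integrable fun x => inner ℝ (f x) (g x) := by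
  have := L2.integrable_inner (𝕜 := ℝ) (hf.toLp f) (hg.toLp g)
  refine this.congr ?_
  filter_upwards [hf.coeFn_toLp, hg.coeFn_toLp] with x h1 h2
  rw [h1, h2]

/-- Transport by a bounded divergence free field preserves energy. -/
theorem integral_inner_transport_eq_zero {u w : R3 → R3} (hu : ContDiff ℝ 1 u)
    (hd : ∀ x, divergence u x = 0) {M : ℝ} (hM : ∀ x, ‖u x‖ ≤ M)
    (hu2 : MemLp u 2 (volume : Measure R3)) (hw : ContDiff ℝ 1 w)
    (hw2 : MemLp w 2 (volume : Measure R3)) {N : ℝ} (hN : ∀ x, ‖fderiv ℝ w x‖ ≤ N) :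
    ∫ x, inner ℝ (w x) (fderiv ℝ w x (u x)) = 0 := by
  have hwd : Differentiable ℝ w := hw.differentiable (by simp)
  have hud : Differentiable ℝ u := hu.differentiable (by simp)
  have hsq : ContDiff ℝ 1 fun x => ‖w x‖ ^ 2 := hw.norm_sq ℝ
  have hder : ∀ x h, fderiv ℝ (fun x => ‖w x‖ ^ 2) x h = 2 * inner ℝ (w x) (fderiv ℝ w x h) := by
    intro x h
    rw [(hwd x).hasFDerivAt.norm_sq.fderiv]
    simp
  have hsum : ∀ x, ∑ i, fderiv ℝ (fun x => u x i * ‖w x‖ ^ 2) x (e i) =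
      2 * inner ℝ (w x) (fderiv ℝ w x (u x)) := by
    intro x
    have h1 : ∀ i, fderiv ℝ (fun x => u x i * ‖w x‖ ^ 2) x (e i) =
        u x i * fderiv ℝ (fun x => ‖w x‖ ^ 2) x (e i) +
          ‖w x‖ ^ 2 * fderiv ℝ (fun x => u x i) x (e i) := by
      intro i
      rw [fderiv_fun_mul ((contDiff_comp hu i).differentiable (by simp) x)
        (hsq.differentiable (by simp) x)]
      simp
    simp_rw [h1, Finset.sum_add_distrib, ← Finset.mul_sum]
    rw [sum_fderiv_comp hud, hd, ← clm_apply_eq_sum, hder]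
    ring
  have hint : Integrable fun x => ‖w x‖ ^ 2 := by
    simpa using hw2.integrable_norm_pow (by norm_num)
  have hint2 : Integrable fun x => 2 * inner ℝ (w x) (fderiv ℝ w x (u x)) :=
    (integrable_inner_of_memLp hw2 (memLp_fderiv_apply hw hN hu2 hu.continuous)).const_mul 2
  have := integral_div_eq_zero (f := fun i x => u x i * ‖w x‖ ^ 2)
    (fun i => (contDiff_comp hu i).mul hsq) (fun i => ?_) (by simp_rw [hsum]; exact hint2)
  · simp_rw [hsum] at this
    rw [integral_const_mul] at this
    linarith
  · refine hint.bdd_mul (c := M) (contDiff_comp hu i).continuous.aestronglyMeasurable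
      (Eventually.of_forall fun x => ?_)
    exact (PiLp.norm_apply_le (u x) i).trans (hM x)

namespace RegularSolution

variable {u v : ℝ → R3 → R3} (hu : RegularSolution u) (hv : RegularSolution v)

include hu

theorem continuousOn_toL2 : ContinuousOn (fun t => toL2 (u t)) (Ici 0) := by
  intro t ht
  have ht : 0 ≤ t := ht
  rw [ContinuousWithinAt, tendsto_iff_norm_sub_tendsto_zero]
  have h0 : Tendsto (fun τ => (eLpNorm (fun x => u τ x - u t x) 2
      (volume : Measure R3)).toReal) (𝓝[Ici 0] t) (𝓝 0) :=
    (ENNReal.tendsto_toReal ENNReal.zero_ne_top).comp (hu.l2_cont t ht)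
  refine h0.congr' ?_
  filter_upwards [self_mem_nhdsWithin] with τ hτ
  rw [toL2_eq (hu.memLp τ hτ), toL2_eq (hu.memLp t ht), ← MemLp.toLp_sub, Lp.norm_toLp]
  rfl

include hv

set_option maxHeartbeats 1000000 in
/-- The energy inequality for the difference of two solutions: the pressure does no work on
divergence free fields, and the transport term vanishes. -/
theorem energy_deriv {T : ℝ} {M : ℝ}
    (hM : ∀ t ∈ Icc 0 T, ∀ x, ‖v t x‖ ≤ M ∧ ‖fderiv ℝ (v t) x‖ ≤ M) {t : ℝ} (ht : t ∈ Ioo 0 T) :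
    ∃ E', HasDerivAt (fun τ => ‖toL2 (u τ) - toL2 (v τ)‖ ^ 2) E' t ∧
      E' ≤ 2 * M * ‖toL2 (u t) - toL2 (v t)‖ ^ 2 := by
  have ht0 : 0 ≤ t := ht.1.le
  obtain ⟨p, hp⟩ := hu.momentum
  obtain ⟨q, hq⟩ := hv.momentum
  obtain ⟨hpc, hpd⟩ := hp t ht.1
  obtain ⟨hqc, hqd⟩ := hq t ht.1
  have huc := hu.contDiff t ht0
  have hvc := hv.contDiff t ht0
  set f : R3 → R3 := fun x => -(advect (u t) (u t) x) - gradient (p t) x with hf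
  set g : R3 → R3 := fun x => -(advect (v t) (v t) x) - gradient (q t) x with hg
  have hfc : Continuous f := (continuous_advect huc).neg.sub (continuous_gradient hpc)
  have hgc : Continuous g := (continuous_advect hvc).neg.sub (continuous_gradient hqc)
  obtain ⟨hfm, hfd⟩ := hpd.hasDerivAt ht.1 hu.memLp hfc
  obtain ⟨hgm, hgd⟩ := hqd.hasDerivAt ht.1 hv.memLp hgc
  refine ⟨_, (hfd.sub hgd).norm_sq, ?_⟩
  set w : R3 → R3 := fun x => u t x - v t x with hw
  have hwc : ContDiff ℝ 1 w := huc.sub hvc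
  have hwm : MemLp w 2 volume := (hu.memLp t ht0).sub (hv.memLp t ht0)
  have hWeq : toL2 (u t) - toL2 (v t) = toL2 w := by
    rw [toL2_eq (hu.memLp t ht0), toL2_eq (hv.memLp t ht0), toL2_eq hwm, ← MemLp.toLp_sub]
    rfl
  have hfgm : MemLp (fun x => f x - g x) 2 volume := hfm.sub hgm
  have hFeq : toL2 f - toL2 g = toL2 (fun x => f x - g x) := by
    rw [toL2_eq hfm, toL2_eq hgm, toL2_eq hfgm, ← MemLp.toLp_sub]
    rfl
  have hud := hu.differentiable ht0
  have hvd := hv.differentiable ht0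
  have hDw : ∀ x h, fderiv ℝ w x h = fderiv ℝ (u t) x h - fderiv ℝ (v t) x h := by
    intro x h
    rw [hw, fderiv_fun_sub (hud x) (hvd x)]; rfl
  obtain ⟨Mu, hMu⟩ := hu.bounded t ht0
  have hMv := hM t ⟨ht0, ht.2.le⟩
  have hDwb : ∀ x, ‖fderiv ℝ w x‖ ≤ Mu + M := by
    intro x
    rw [hw, fderiv_fun_sub (hud x) (hvd x)]
    exact (norm_sub_le _ _).trans (add_le_add (hMu x).2 (hMv x).2)
  have hwdiv : ∀ x, divergence w x = 0 := by
    intro x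
    have h1 := hu.div_eq_zero t ht0 x
    have h2 := hv.div_eq_zero t ht0 x
    simp only [divergence, pderiv, Fin.sum_univ_three, hDw, PiLp.sub_apply] at h1 h2 ⊢
    linarith
  have hm1 : MemLp (fun x => fderiv ℝ w x (u t x)) 2 volume :=
    memLp_fderiv_apply hwc hDwb (hu.memLp t ht0) huc.continuous
  have hm2 : MemLp (fun x => fderiv ℝ (v t) x (w x)) 2 volume :=
    memLp_fderiv_apply hvc (fun x => (hMv x).2) hwm hwc.continuous
  -- the difference of the pressures
  set P : R3 → ℝ := fun x => p t x - q t x with hP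
  have hPc : ContDiff ℝ 1 P := hpc.sub hqc
  have hPg : ∀ x, gradient P x = gradient (p t) x - gradient (q t) x := by
    intro x
    simp only [gradient, hP]
    rw [fderiv_fun_sub (hpc.differentiable (by simp) x) (hqc.differentiable (by simp) x), map_sub]
  have hsplit : ∀ x, f x - g x =
      -(fderiv ℝ w x (u t x)) - fderiv ℝ (v t) x (w x) - gradient P x := by
    intro x
    rw [hPg, hDw]
    simp only [hf, hg, advect, hw, map_sub]
    abel
  have hPm : MemLp (gradient P) 2 volume := by
    refine (memLp_congr_ae (Eventually.of_forall fun x => ?_)).1 ((hm1.neg.sub hm2).sub hfgm)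
    simp only [Pi.sub_apply, Pi.neg_apply, hsplit]
    abel
  have hz1 : ∫ x, inner ℝ (w x) (fderiv ℝ w x (u t x)) = 0 :=
    integral_inner_transport_eq_zero huc (hu.div_eq_zero t ht0) (fun x => (hMu x).1)
      (hu.memLp t ht0) hwc hwm hDwb
  have hz2 : ∫ x, inner ℝ (w x) (gradient P x) = 0 := by
    simp_rw [inner_vec3]
    refine integral_divFree_mul_curlFree (w := fun i x => w x i) (g := fun i x => gradient P x i)
      (memLp_comp hwm) (memLp_comp hPm) (fun ψ h1 h2 => weakDiv_of_divergence hwc hwdiv h1 h2) ?_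
    intro i j ψ h1 h2
    simp_rw [gradient_apply]
    exact weakCurl_of_gradient hPc i j h1 h2
  have hwsq : ‖toL2 w‖ ^ 2 = ∫ x, ‖w x‖ ^ 2 := by
    rw [← real_inner_self_eq_norm_sq, inner_toL2 hwm hwm]
    simp_rw [real_inner_self_eq_norm_sq]
  have hsqi : Integrable fun x => ‖w x‖ ^ 2 := by
    simpa using hwm.integrable_norm_pow (by norm_num)
  have hi1 := integrable_inner_of_memLp hwm hm1
  have hi2 := integrable_inner_of_memLp hwm hm2
  have hi3 := integrable_inner_of_memLp hwm hPm
  have hin : inner ℝ (toL2 w) (toL2 fun x => f x - g x) =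
      - ∫ x, inner ℝ (w x) (fderiv ℝ (v t) x (w x)) := by
    rw [inner_toL2 hwm hfgm]
    simp_rw [hsplit, inner_sub_right, inner_neg_right]
    have hi1' : Integrable fun x => -inner ℝ (w x) (fderiv ℝ w x (u t x)) := hi1.neg
    have hi12 : Integrable fun x => -inner ℝ (w x) (fderiv ℝ w x (u t x)) -
        inner ℝ (w x) (fderiv ℝ (v t) x (w x)) := hi1'.sub hi2
    rw [integral_sub hi12 hi3, integral_sub hi1' hi2, hz2, integral_neg, hz1]
    simp
  have hle : - ∫ x, inner ℝ (w x) (fderiv ℝ (v t) x (w x)) ≤ M * ∫ x, ‖w x‖ ^ 2 := by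
    rw [← integral_neg, ← integral_const_mul]
    refine integral_mono hi2.neg (hsqi.const_mul M) fun x => ?_
    have h1 := abs_real_inner_le_norm (w x) (fderiv ℝ (v t) x (w x))
    have h2 := (fderiv ℝ (v t) x).le_of_opNorm_le (hMv x).2 (w x)
    have h3 := neg_le_abs (inner ℝ (w x) (fderiv ℝ (v t) x (w x)))
    simp only [] at *
    calc -inner ℝ (w x) (fderiv ℝ (v t) x (w x)) ≤ ‖w x‖ * (M * ‖w x‖) := by
          refine h3.trans (h1.trans ?_); gcongr
      _ = M * ‖w x‖ ^ 2 := by ring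
  simp only [Pi.sub_apply, hWeq, hFeq]
  rw [hin, hwsq]
  linarith

/-- Uniqueness: the energy of the difference satisfies `E' ≤ 2 M E`, where `M` bounds the gradient
of one of the solutions. -/
theorem eq_of_eq_zero (h0 : u 0 = v 0) {t : ℝ} (ht : 0 ≤ t) : u t = v t := by
  rcases ht.eq_or_lt with rfl | htpos
  · exact h0
  obtain ⟨M, hM0, hM⟩ := hv.exists_bound t
  set E : ℝ → ℝ := fun τ => ‖toL2 (u τ) - toL2 (v τ)‖ ^ 2 with hE
  have hEc : ContinuousOn E (Icc 0 t) :=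
    (((hu.continuousOn_toL2.sub hv.continuousOn_toL2).norm).pow 2).mono fun τ hτ => hτ.1
  have hanti : AntitoneOn (fun τ => Real.exp (-(2 * M) * τ) * E τ) (Icc 0 t) := by
    have hder : ∀ τ ∈ Ioo 0 t, ∃ E', HasDerivAt (fun τ => Real.exp (-(2 * M) * τ) * E τ) E' τ ∧
        E' ≤ 0 := by
      intro τ hτ
      obtain ⟨E', h1, h2⟩ := energy_deriv hu hv hM hτ
      have hexp : HasDerivAt (fun τ : ℝ => Real.exp (-(2 * M) * τ))
          (Real.exp (-(2 * M) * τ) * (-(2 * M))) τ := by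
        have := ((hasDerivAt_id τ).const_mul (-(2 * M))).exp
        simpa using this
      refine ⟨_, hexp.mul h1, ?_⟩
      have : Real.exp (-(2 * M) * τ) * (-(2 * M)) * E τ + Real.exp (-(2 * M) * τ) * E' =
          Real.exp (-(2 * M) * τ) * (E' - 2 * M * E τ) := by ring
      exact this.le.trans (mul_nonpos_of_nonneg_of_nonpos (Real.exp_pos _).le (by linarith))
    refine antitoneOn_of_deriv_nonpos (convex_Icc 0 t) ?_ ?_ ?_
    · exact (Continuous.continuousOn (by fun_prop)).mul hEc
    · intro τ hτ
      rw [interior_Icc] at hτ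
      obtain ⟨E', h1, -⟩ := hder τ hτ
      exact h1.differentiableAt.differentiableWithinAt
    · intro τ hτ
      rw [interior_Icc] at hτ
      obtain ⟨E', h1, h2⟩ := hder τ hτ
      rw [h1.deriv]; exact h2
  have h1 := hanti (left_mem_Icc.2 ht) (right_mem_Icc.2 ht) ht
  have h2 : E 0 = 0 := by simp [hE, h0]
  simp only [h2, mul_zero] at h1
  have h3 : E t = 0 := le_antisymm
    (by by_contra hcon
        push Not at hcon
        have := mul_pos (Real.exp_pos (-(2 * M) * t)) hcon
        linarith) (sq_nonneg _)
  have h4 : toL2 (u t) = toL2 (v t) := by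
    rw [← sub_eq_zero, ← norm_eq_zero]
    exact pow_eq_zero_iff (n := 2) (by norm_num) |>.1 h3
  rw [toL2_eq (hu.memLp t ht), toL2_eq (hv.memLp t ht), MemLp.toLp_eq_toLp_iff] at h4
  exact ((hu.continuous ht).ae_eq_iff_eq volume (hv.continuous ht)).1 h4

omit hv

/-- If the initial vorticity is odd in `z`, the velocity is invariant under reflection for all
times. -/
theorem reflField_eq (haxi : IsAxisymmetricSwirlFree (u 0))
    (hodd : ∀ r z : ℝ, 0 ≤ r → omegaTheta (u 0) r (-z) = -omegaTheta (u 0) r z)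
    {t : ℝ} (ht : 0 ≤ t) : reflField (u t) = u t := by
  refine hu.reflect.eq_of_eq_zero hu ?_ ht
  have hd := hu.differentiable le_rfl
  have hc := hu.contDiff 0 le_rfl
  have hdr := (contDiff_reflField hc).differentiable (by simp : (1 : WithTop ℕ∞) ≠ 0)
  have hD : ∀ x h, fderiv ℝ (fun x => reflField (u 0) x - u 0 x) x h =
      fderiv ℝ (reflField (u 0)) x h - fderiv ℝ (u 0) x h := by
    intro x h
    rw [fderiv_fun_sub (hdr x) (hd x)]; rfl
  -- initially the difference has neither curl nor divergence, so it vanishes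
  have key := eq_zero_of_curl_divergence (w := fun x => reflField (u 0) x - u 0 x)
    ((contDiff_reflField hc).sub hc) ((hu.reflect.memLp 0 le_rfl).sub (hu.memLp 0 le_rfl)) ?_ ?_
  · ext1 x; exact sub_eq_zero.1 (key x)
  · intro x
    have h1 := hu.reflect.div_eq_zero 0 le_rfl x
    have h2 := hu.div_eq_zero 0 le_rfl x
    simp only [divergence, pderiv, Fin.sum_univ_three, hD, PiLp.sub_apply] at h1 h2 ⊢
    linarith
  · intro x
    have hcurl : curl (fun x => reflField (u 0) x - u 0 x) x =
        curl (reflField (u 0)) x - curl (u 0) x := by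
      apply vec3_ext <;> simp [curl, pderiv, hD] <;> ring
    rw [hcurl, sub_eq_zero, curl_reflField hd]
    obtain ⟨θ, hθ⟩ := exists_polar x
    have hx : refl x = !₂[radius x * Real.cos θ, radius x * Real.sin θ, -(x 2)] := by
      conv_lhs => rw [hθ]
      apply vec3_ext <;> simp
    rw [hx, curl_polar haxi hd, hodd _ _ (radius_nonneg x)]
    conv_rhs => rw [hθ, curl_polar haxi hd]
    apply vec3_ext <;> simp

end RegularSolution

theorem omegaTheta_neg_of_reflField {v : R3 → R3} (hv : Differentiable ℝ v)
    (h : reflField v = v) (r z : ℝ) : omegaTheta v r (-z) = - omegaTheta v r z := by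
  have h1 := curl_reflField hv !₂[r, 0, z]
  rw [h] at h1
  have h2 : refl !₂[r, 0, z] = !₂[r, 0, -z] := by apply vec3_ext <;> simp
  rw [h2] at h1
  have := congrArg (fun y : R3 => y 1) h1
  simp at this
  unfold omegaTheta
  linarith



/-! ### The weak vorticity equation -/

/-- The impulse density `Γ = r ω_θ`, in Cartesian coordinates. -/
def impulse (v : R3 → R3) (x : R3) : ℝ := x 0 * curl v x 1 - x 1 * curl v x 0

/-- The vertical component of `v × curl v`, which equals `v_r ω_θ` for an axisymmetric field. -/
def lamb (v : R3 → R3) (x : R3) : ℝ := v x 0 * curl v x 1 - v x 1 * curl v x 0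

/-- The curl of `ψ(x) (-x₁, x₀, 0)`. -/
def testCurl (ψ : R3 → ℝ) (x : R3) : R3 :=
  !₂[-(x 0 * fderiv ℝ ψ x (e 2)), -(x 1 * fderiv ℝ ψ x (e 2)),
    2 * ψ x + x 0 * fderiv ℝ ψ x (e 0) + x 1 * fderiv ℝ ψ x (e 1)]

theorem continuous_testCurl {ψ : R3 → ℝ} (hψ : ContDiff ℝ 1 ψ) : Continuous (testCurl ψ) := by
  have h0 := continuous_fderiv_e hψ
  have h1 := hψ.continuous
  unfold testCurl
  fun_prop

theorem memLp_testCurl {ψ : R3 → ℝ} (hψ : ContDiff ℝ 1 ψ) (hc : HasCompactSupport ψ) :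
    MemLp (testCurl ψ) 2 (volume : Measure R3) := by
  refine (continuous_testCurl hψ).memLp_of_hasCompactSupport
    (HasCompactSupport.intro hc fun x hx => ?_)
  have h0 : ψ x = 0 := image_eq_zero_of_notMem_tsupport hx
  have h1 : fderiv ℝ ψ x = 0 := by
    have : x ∉ tsupport (fderiv ℝ ψ) := fun h => hx (tsupport_fderiv_subset ℝ h)
    exact image_eq_zero_of_notMem_tsupport this
  apply vec3_ext <;> simp [testCurl, h0, h1]

theorem contDiff_coord (i : Fin 3) {n : WithTop ℕ∞} : ContDiff ℝ n fun y : R3 => y i :=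
  (EuclideanSpace.proj i : R3 →L[ℝ] ℝ).contDiff

theorem continuous_curl_comp {v : R3 → R3} (hv : ContDiff ℝ 1 v) (i : Fin 3) :
    Continuous fun x => curl v x i :=
  (EuclideanSpace.proj i : R3 →L[ℝ] ℝ).continuous.comp (continuous_curl hv)

theorem continuous_impulse {v : R3 → R3} (hv : ContDiff ℝ 1 v) : Continuous (impulse v) := by
  have h : ∀ i, Continuous fun x => curl v x i := continuous_curl_comp hv
  exact ((contDiff_coord 0 (n := 1)).continuous.mul (h 1)).sub
    ((contDiff_coord 1 (n := 1)).continuous.mul (h 0))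

theorem continuous_lamb {v : R3 → R3} (hv : ContDiff ℝ 1 v) : Continuous (lamb v) := by
  have h : ∀ i, Continuous fun x => curl v x i := continuous_curl_comp hv
  exact ((contDiff_comp hv 0).continuous.mul (h 1)).sub ((contDiff_comp hv 1).continuous.mul (h 0))

theorem fderiv_e_apply (x : R3) (i j : Fin 3) :
    fderiv ℝ (fun y : R3 => y j) x (e i) = if i = j then 1 else 0 := by
  have : fderiv ℝ (fun y : R3 => y j) x = (EuclideanSpace.proj j : R3 →L[ℝ] ℝ) :=
    (EuclideanSpace.proj j : R3 →L[ℝ] ℝ).fderiv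
  rw [this]
  simp [eq_comm]

theorem fderiv_mul_e {f g : R3 → ℝ} (hf : Differentiable ℝ f) (hg : Differentiable ℝ g) (x h : R3) :
    fderiv ℝ (fun y => f y * g y) x h = f x * fderiv ℝ g x h + g x * fderiv ℝ f x h := by
  rw [fderiv_fun_mul (hf x) (hg x)]; simp

/-- Testing the impulse density is testing the velocity against a curl. -/
theorem integral_impulse_mul {v : R3 → R3} (hv : ContDiff ℝ 1 v) {ψ : R3 → ℝ}
    (hψ : ContDiff ℝ 1 ψ) (hc : HasCompactSupport ψ) :
    ∫ x, impulse v x * ψ x = ∫ x, inner ℝ (v x) (testCurl ψ x) := by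
  have hvd : Differentiable ℝ v := hv.differentiable (by simp)
  have hcd : ∀ i, Differentiable ℝ fun y => v y i := fun i =>
    (contDiff_comp hv i).differentiable (by simp)
  have hxd : ∀ i, Differentiable ℝ fun y : R3 => y i := fun i =>
    (contDiff_coord i (n := 1)).differentiable (by simp)
  -- the field whose divergence is `Γ - 2 v₂`
  let f : Fin 3 → R3 → ℝ := ![fun x => -(x 0 * v x 2), fun x => -(x 1 * v x 2),
    fun x => x 0 * v x 0 + x 1 * v x 1]
  have hf : ∀ i, ContDiff ℝ 1 (f i) := by
    intro i
    fin_cases i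
    · exact ((contDiff_coord 0).mul (contDiff_comp hv 2)).neg
    · exact ((contDiff_coord 1).mul (contDiff_comp hv 2)).neg
    · exact ((contDiff_coord 0).mul (contDiff_comp hv 0)).add
        ((contDiff_coord 1).mul (contDiff_comp hv 1))
  have hdiv : ∀ x, ∑ i, fderiv ℝ (f i) x (e i) = impulse v x - 2 * v x 2 := by
    intro x
    have h0 : fderiv ℝ (f 0) x (e 0) = -(x 0 * pderiv v 0 2 x + v x 2) := by
      change fderiv ℝ (fun x => -(x 0 * v x 2)) x (e 0) = _
      rw [fderiv_fun_neg, _root_.neg_apply, fderiv_mul_e (hxd 0) (hcd 2), pderiv_eq (hvd x),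
        fderiv_e_apply]
      simp
    have h1 : fderiv ℝ (f 1) x (e 1) = -(x 1 * pderiv v 1 2 x + v x 2) := by
      change fderiv ℝ (fun x => -(x 1 * v x 2)) x (e 1) = _
      rw [fderiv_fun_neg, _root_.neg_apply, fderiv_mul_e (hxd 1) (hcd 2), pderiv_eq (hvd x),
        fderiv_e_apply]
      simp
    have h2 : fderiv ℝ (f 2) x (e 2) = x 0 * pderiv v 2 0 x + x 1 * pderiv v 2 1 x := by
      change fderiv ℝ (fun x => x 0 * v x 0 + x 1 * v x 1) x (e 2) = _
      rw [fderiv_fun_add ((hxd 0 x).fun_mul (hcd 0 x)) ((hxd 1 x).fun_mul (hcd 1 x)),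
        _root_.add_apply, fderiv_mul_e (hxd 0) (hcd 0), fderiv_mul_e (hxd 1) (hcd 1),
        pderiv_eq (hvd x), pderiv_eq (hvd x), fderiv_e_apply, fderiv_e_apply]
      simp
    rw [Fin.sum_univ_three, h0, h1, h2]
    simp [impulse, curl]
    ring
  have key := integral_sum_mul_fderiv hf hψ hc
  simp_rw [hdiv] at key
  have hi1 : Integrable fun x => impulse v x * ψ x :=
    ((continuous_impulse hv).mul hψ.continuous).integrable_of_hasCompactSupport hc.mul_left
  have hi2 : Integrable fun x => inner ℝ (v x) (testCurl ψ x) := by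
    refine (hv.continuous.inner (continuous_testCurl hψ)).integrable_of_hasCompactSupport
      (HasCompactSupport.intro hc fun x hx => ?_)
    have h0 : ψ x = 0 := image_eq_zero_of_notMem_tsupport hx
    have h1 : fderiv ℝ ψ x = 0 := by
      have : x ∉ tsupport (fderiv ℝ ψ) := fun h => hx (tsupport_fderiv_subset ℝ h)
      exact image_eq_zero_of_notMem_tsupport this
    have : testCurl ψ x = 0 := by apply vec3_ext <;> simp [testCurl, h0, h1]
    rw [this, inner_zero_right]
  have hpt : ∀ x, impulse v x * ψ x - inner ℝ (v x) (testCurl ψ x) =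
      ψ x * (impulse v x - 2 * v x 2) + ∑ i, f i x * fderiv ℝ ψ x (e i) := by
    intro x
    rw [inner_vec3, Fin.sum_univ_three, Fin.sum_univ_three]
    simp [testCurl, f]
    ring
  rw [← sub_eq_zero, ← integral_sub hi1 hi2]
  simp_rw [hpt]
  rw [integral_add, key]
  · ring
  · refine Continuous.integrable_of_hasCompactSupport ?_ hc.mul_right
    exact hψ.continuous.mul ((continuous_impulse hv).sub
      (continuous_const.mul (contDiff_comp hv 2).continuous))
  · exact integrable_finsetSum _ fun i _ => ((hf i).continuous.mul
      (continuous_fderiv_e hψ _)).integrable_of_hasCompactSupport (hc.fderiv_apply ℝ _).mul_left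

/-- Gradients are orthogonal to the curl of a test field. -/
theorem integral_gradient_testCurl {q : R3 → ℝ} (hq : ContDiff ℝ 1 q) {ψ : R3 → ℝ}
    (hψ : ContDiff ℝ ∞ ψ) (hc : HasCompactSupport ψ) :
    ∫ x, inner ℝ (gradient q x) (testCurl ψ x) = 0 := by
  have hψd : Differentiable ℝ ψ := hψ.differentiable (by simp)
  have hxd : ∀ i, Differentiable ℝ fun y : R3 => y i := fun i =>
    (contDiff_coord i (n := 1)).differentiable (by simp)
  have hs : ∀ i, ContDiff ℝ ∞ fun y : R3 => y i * ψ y := fun i => (contDiff_coord i).mul hψ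
  have h0 := weakCurl_of_gradient hq 2 0 (hs 0) hc.mul_left
  have h1 := weakCurl_of_gradient hq 2 1 (hs 1) hc.mul_left
  have hint : ∀ i j k, Integrable fun x =>
      fderiv ℝ q x (e i) * fderiv ℝ (fun y : R3 => y k * ψ y) x (e j) := fun i j k =>
    ((continuous_fderiv_e hq _).mul
      (continuous_fderiv_e ((hs k).of_le (by simp)) _)).integrable_of_hasCompactSupport
      ((hc.mul_left (f := fun y : R3 => y k)).fderiv_apply ℝ _).mul_left
  have hpt : ∀ x, inner ℝ (gradient q x) (testCurl ψ x) =
      (fderiv ℝ q x (e 2) * fderiv ℝ (fun y : R3 => y 0 * ψ y) x (e 0) -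
        fderiv ℝ q x (e 0) * fderiv ℝ (fun y : R3 => y 0 * ψ y) x (e 2)) +
      (fderiv ℝ q x (e 2) * fderiv ℝ (fun y : R3 => y 1 * ψ y) x (e 1) -
        fderiv ℝ q x (e 1) * fderiv ℝ (fun y : R3 => y 1 * ψ y) x (e 2)) := by
    intro x
    rw [inner_vec3, Fin.sum_univ_three]
    simp only [fderiv_mul_e (hxd _) hψd, fderiv_e_apply, gradient_apply]
    simp [testCurl]
    ring
  simp_rw [hpt]
  rw [integral_add, h0, h1, add_zero]
  · exact (hint 2 0 0).sub (hint 0 2 0)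
  · exact (hint 2 1 1).sub (hint 1 2 1)

/-- The flux of impulse through a test function, i.e. the time derivative of `∫ Γ ψ`. -/
def impulseFlux (v : R3 → R3) (ψ : R3 → ℝ) (x : R3) : ℝ :=
  impulse v x * fderiv ℝ ψ x (v x) + 2 * lamb v x * ψ x

theorem continuous_impulseFlux {v : R3 → R3} (hv : ContDiff ℝ 1 v) {ψ : R3 → ℝ}
    (hψ : ContDiff ℝ 1 ψ) : Continuous (impulseFlux v ψ) :=
  ((continuous_impulse hv).mul ((hψ.continuous_fderiv (by simp)).clm_apply hv.continuous)).add
    ((continuous_const.mul (continuous_lamb hv)).mul hψ.continuous)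

theorem impulseFlux_eq_zero {v : R3 → R3} {ψ : R3 → ℝ} {x : R3} (hx : x ∉ tsupport ψ) :
    impulseFlux v ψ x = 0 := by
  have h0 : ψ x = 0 := image_eq_zero_of_notMem_tsupport hx
  have h1 : fderiv ℝ ψ x = 0 := by
    have : x ∉ tsupport (fderiv ℝ ψ) := fun h => hx (tsupport_fderiv_subset ℝ h)
    exact image_eq_zero_of_notMem_tsupport this
  simp [impulseFlux, h0, h1]

/-- The nonlinearity, tested against a curl: `(v·∇)v = ∇|v|²/2 - v × curl v`. -/
theorem inner_advect_testCurl {v : R3 → R3} (hv : ContDiff ℝ 1 v)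
    (hns : ∀ x, x 0 * v x 1 - x 1 * v x 0 = 0) (ψ : R3 → ℝ) (x : R3) :
    inner ℝ (advect v v x) (testCurl ψ x) =
      inner ℝ (gradient (fun y => ‖v y‖ ^ 2 / 2) x) (testCurl ψ x) - impulseFlux v ψ x := by
  have hvd : Differentiable ℝ v := hv.differentiable (by simp)
  have hadv : ∀ j, advect v v x j = ∑ i, v x i * pderiv v i j x := by
    intro j
    have := clm_apply_eq_sum ((EuclideanSpace.proj j : R3 →L[ℝ] ℝ) ∘L fderiv ℝ v x) (v x)
    exact this
  have hgr : ∀ j, gradient (fun y => ‖v y‖ ^ 2 / 2) x j = ∑ i, v x i * pderiv v j i x := by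
    intro j
    rw [gradient_apply]
    have h1 : HasFDerivAt (fun y => ‖v y‖ ^ 2 / 2) _ x :=
      (hvd x).hasFDerivAt.norm_sq.mul_const (2⁻¹ : ℝ)
    rw [h1.fderiv]
    simp only [_root_.smul_apply, ContinuousLinearMap.comp_apply, innerSL_apply_apply]
    rw [inner_vec3]
    simp [pderiv]
  have hψ3 := clm_apply_eq_sum (fderiv ℝ ψ x) (v x)
  rw [inner_vec3, inner_vec3, impulseFlux, hψ3]
  simp only [hadv, hgr, Fin.sum_univ_three]
  simp only [testCurl, impulse, lamb, curl]
  simp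
  have h := hns x
  linear_combination (fderiv ℝ ψ x (e 2) * (pderiv v 0 1 x - pderiv v 1 0 x)
    + fderiv ℝ ψ x (e 0) * (pderiv v 1 2 x - pderiv v 2 1 x)
    + fderiv ℝ ψ x (e 1) * (pderiv v 2 0 x - pderiv v 0 2 x)) * h

namespace RegularSolution

variable {u : ℝ → R3 → R3} (hu : RegularSolution u)

include hu

/-- The weak form of the equation `∂ₜ Γ + div(Γ u) = 2 u_r ω_θ` of the impulse density. -/
theorem hasDerivAt_integral_impulse (haxi : ∀ t, 0 ≤ t → IsAxisymmetricSwirlFree (u t))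
    {ψ : R3 → ℝ} (hψ : ContDiff ℝ ∞ ψ) (hc : HasCompactSupport ψ) {t : ℝ} (ht : 0 < t) :
    HasDerivAt (fun τ => ∫ x, impulse (u τ) x * ψ x) (∫ x, impulseFlux (u t) ψ x) t := by
  obtain ⟨p, hp⟩ := hu.momentum
  obtain ⟨hpc, hpd⟩ := hp t ht
  have huc := hu.contDiff t ht.le
  have hψ1 : ContDiff ℝ 1 ψ := hψ.of_le (by simp)
  set f : R3 → R3 := fun x => -(advect (u t) (u t) x) - gradient (p t) x with hf
  have hfc : Continuous f := (continuous_advect huc).neg.sub (continuous_gradient hpc)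
  obtain ⟨hfm, hfd⟩ := hpd.hasDerivAt ht hu.memLp hfc
  have hΦ := memLp_testCurl hψ1 hc
  have h1 := hfd.inner ℝ (hasDerivAt_const t (toL2 (testCurl ψ)))
  rw [inner_zero_right, zero_add, inner_toL2 hfm hΦ] at h1
  have h2 : ∫ x, inner ℝ (f x) (testCurl ψ x) = ∫ x, impulseFlux (u t) ψ x := by
    set q : R3 → ℝ := fun y => ‖u t y‖ ^ 2 / 2 + p t y with hq
    have hsqc : ContDiff ℝ 1 fun y => ‖u t y‖ ^ 2 / 2 := (huc.norm_sq ℝ).div_const 2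
    have hqc : ContDiff ℝ 1 q := hsqc.add hpc
    have hgrad : ∀ x, gradient q x = gradient (fun y => ‖u t y‖ ^ 2 / 2) x + gradient (p t) x := by
      intro x
      simp only [gradient, hq]
      rw [fderiv_fun_add (hsqc.differentiable (by simp) x) (hpc.differentiable (by simp) x),
        map_add]
    have hpt : ∀ x, inner ℝ (f x) (testCurl ψ x) =
        impulseFlux (u t) ψ x - inner ℝ (gradient q x) (testCurl ψ x) := by
      intro x
      simp only [hf]
      rw [inner_sub_left, inner_neg_left,
        inner_advect_testCurl huc (axisym_noSwirl (haxi t ht.le)), hgrad, inner_add_left]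
      ring
    simp_rw [hpt]
    rw [integral_sub, integral_gradient_testCurl hqc hψ hc, sub_zero]
    · exact (continuous_impulseFlux huc hψ1).integrable_of_hasCompactSupport
        (HasCompactSupport.intro hc fun x hx => impulseFlux_eq_zero hx)
    · have := integrable_inner_of_memLp hfm hΦ
      simp_rw [hpt] at this
      have h3 : Integrable (impulseFlux (u t) ψ) :=
        (continuous_impulseFlux huc hψ1).integrable_of_hasCompactSupport
          (HasCompactSupport.intro hc fun x hx => impulseFlux_eq_zero hx)
      exact (h3.sub this).congr (Eventually.of_forall fun x => by simp)
  rw [h2] at h1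
  refine h1.congr_of_eventuallyEq ?_
  filter_upwards [lt_mem_nhds ht] with τ hτ
  rw [integral_impulse_mul (hu.contDiff τ hτ.le) hψ1 hc, inner_toL2 (hu.memLp τ hτ.le) hΦ]

/-! ### Joint continuity -/

theorem continuousOn_uncurry : ContinuousOn (fun p : ℝ × R3 => u p.1 p.2) (Ici 0 ×ˢ univ) := by
  rintro ⟨t, x⟩ ⟨ht, -⟩
  have ht : 0 ≤ t := ht
  rw [Metric.continuousWithinAt_iff']
  intro ε hε
  have h1 : ∀ᶠ p : ℝ × R3 in 𝓝[Ici 0 ×ˢ univ] (t, x), ∀ x, ‖u p.1 x - u t x‖ ≤ ε / 2 ∧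
      ‖fderiv ℝ (u p.1) x - fderiv ℝ (u t) x‖ ≤ ε / 2 := by
    have : Tendsto Prod.fst (𝓝[Ici (0 : ℝ) ×ˢ (univ : Set R3)] (t, x)) (𝓝[Ici 0] t) := by
      rw [nhdsWithin_prod_eq]; exact tendsto_fst
    exact this.eventually (hu.sup_cont t ht (ε / 2) (half_pos hε))
  have h2 : ∀ᶠ p : ℝ × R3 in 𝓝[Ici 0 ×ˢ univ] (t, x), ‖u t p.2 - u t x‖ < ε / 2 := by
    have hc : ContinuousAt (fun p : ℝ × R3 => u t p.2) (t, x) :=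
      ((hu.continuous ht).comp continuous_snd).continuousAt
    have := (Metric.continuousAt_iff'.1 hc) (ε / 2) (half_pos hε)
    simp only [dist_eq_norm] at this
    exact nhdsWithin_le_nhds this
  filter_upwards [h1, h2] with p hp1 hp2
  rw [dist_eq_norm]
  calc ‖u p.1 p.2 - u t x‖ = ‖(u p.1 p.2 - u t p.2) + (u t p.2 - u t x)‖ := by congr 1; abel
    _ < ε := (norm_add_le _ _).trans_lt (by linarith [(hp1 p.2).1])

theorem continuousOn_fderiv :
    ContinuousOn (fun p : ℝ × R3 => fderiv ℝ (u p.1) p.2) (Ici 0 ×ˢ univ) := by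
  rintro ⟨t, x⟩ ⟨ht, -⟩
  have ht : 0 ≤ t := ht
  rw [Metric.continuousWithinAt_iff']
  intro ε hε
  have h1 : ∀ᶠ p : ℝ × R3 in 𝓝[Ici 0 ×ˢ univ] (t, x), ∀ x, ‖u p.1 x - u t x‖ ≤ ε / 2 ∧
      ‖fderiv ℝ (u p.1) x - fderiv ℝ (u t) x‖ ≤ ε / 2 := by
    have : Tendsto Prod.fst (𝓝[Ici (0 : ℝ) ×ˢ (univ : Set R3)] (t, x)) (𝓝[Ici 0] t) := by
      rw [nhdsWithin_prod_eq]; exact tendsto_fst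
    exact this.eventually (hu.sup_cont t ht (ε / 2) (half_pos hε))
  have h2 : ∀ᶠ p : ℝ × R3 in 𝓝[Ici 0 ×ˢ univ] (t, x),
      ‖fderiv ℝ (u t) p.2 - fderiv ℝ (u t) x‖ < ε / 2 := by
    have hc : ContinuousAt (fun p : ℝ × R3 => fderiv ℝ (u t) p.2) (t, x) :=
      (((hu.contDiff t ht).continuous_fderiv (by simp)).comp continuous_snd).continuousAt
    have := (Metric.continuousAt_iff'.1 hc) (ε / 2) (half_pos hε)
    simp only [dist_eq_norm] at this
    exact nhdsWithin_le_nhds this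
  filter_upwards [h1, h2] with p hp1 hp2
  rw [dist_eq_norm]
  calc ‖fderiv ℝ (u p.1) p.2 - fderiv ℝ (u t) x‖ =
        ‖(fderiv ℝ (u p.1) p.2 - fderiv ℝ (u t) p.2) +
          (fderiv ℝ (u t) p.2 - fderiv ℝ (u t) x)‖ := by congr 1; abel
    _ < ε := (norm_add_le _ _).trans_lt (by linarith [(hp1 p.2).2])

theorem continuousOn_curl (i : Fin 3) :
    ContinuousOn (fun p : ℝ × R3 => curl (u p.1) p.2 i) (Ici 0 ×ˢ univ) := by
  have h : ∀ i j, ContinuousOn (fun p : ℝ × R3 => pderiv (u p.1) i j p.2) (Ici 0 ×ˢ univ) :=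
    fun i j => (EuclideanSpace.proj j : R3 →L[ℝ] ℝ).continuous.comp_continuousOn
      (hu.continuousOn_fderiv.clm_apply continuousOn_const)
  fin_cases i
  · simpa [curl] using (h 1 2).fun_sub (h 2 1)
  · simpa [curl] using (h 2 0).fun_sub (h 0 2)
  · simpa [curl] using (h 0 1).fun_sub (h 1 0)

theorem continuousOn_comp (i : Fin 3) :
    ContinuousOn (fun p : ℝ × R3 => u p.1 p.2 i) (Ici 0 ×ˢ univ) :=
  (EuclideanSpace.proj i : R3 →L[ℝ] ℝ).continuous.comp_continuousOn hu.continuousOn_uncurry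

theorem continuousOn_impulse :
    ContinuousOn (fun p : ℝ × R3 => impulse (u p.1) p.2) (Ici 0 ×ˢ univ) := by
  have hx : ∀ i, ContinuousOn (fun p : ℝ × R3 => p.2 i) (Ici 0 ×ˢ univ) := fun i =>
    Continuous.continuousOn (by fun_prop)
  exact ((hx 0).mul (hu.continuousOn_curl 1)).sub ((hx 1).mul (hu.continuousOn_curl 0))

theorem continuousOn_lamb :
    ContinuousOn (fun p : ℝ × R3 => lamb (u p.1) p.2) (Ici 0 ×ˢ univ) :=
  ((hu.continuousOn_comp 0).mul (hu.continuousOn_curl 1)).sub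
    ((hu.continuousOn_comp 1).mul (hu.continuousOn_curl 0))

end RegularSolution



/-! ### Transport of the relative vorticity along trajectories -/

/-- Nonnegative mollifiers `η` at every scale `ε`, with `‖∇η‖₁ ≤ C / ε`. -/
theorem exists_mollifier : ∃ C : ℝ, 0 ≤ C ∧ ∀ ε, 0 < ε → ∃ η : R3 → ℝ,
    ContDiff ℝ ∞ η ∧ (∀ y, ε < ‖y‖ → η y = 0) ∧ (∀ y, ε < ‖y‖ → fderiv ℝ η y = 0) ∧
    (∀ y, 0 ≤ η y) ∧ ∫ y, η y = 1 ∧ ∫ y, ‖fderiv ℝ η y‖ ≤ C / ε := by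
  let b : ContDiffBump (0 : R3) := ⟨1 / 2, 1, by norm_num, by norm_num⟩
  set g : R3 → ℝ := b.normed volume with hg
  have hgc : ContDiff ℝ ∞ g := b.contDiff_normed
  have hgt : tsupport g = Metric.closedBall 0 1 := b.tsupport_normed_eq
  refine ⟨∫ y, ‖fderiv ℝ g y‖, integral_nonneg fun _ => norm_nonneg _, fun ε hε => ?_⟩
  set η : R3 → ℝ := fun y => (ε ^ 3)⁻¹ * g (ε⁻¹ • y) with hη
  have hε0 : ε⁻¹ ≠ 0 := by positivity
  have hηc : ContDiff ℝ ∞ η := contDiff_const.mul (hgc.comp (contDiff_const_smul _))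
  have hd : ∀ y, fderiv ℝ η y = ((ε ^ 3)⁻¹ * ε⁻¹) • fderiv ℝ g (ε⁻¹ • y) := by
    intro y
    have h1 : HasFDerivAt (fun x : R3 => ε⁻¹ • x) (ε⁻¹ • ContinuousLinearMap.id ℝ R3) y :=
      (ε⁻¹ • ContinuousLinearMap.id ℝ R3).hasFDerivAt
    have h2 :=
      (((hgc.differentiable (by simp)) (ε⁻¹ • y)).hasFDerivAt.comp y h1).const_mul (ε ^ 3)⁻¹
    have h3 : fderiv ℝ η y = _ := h2.fderiv
    rw [h3]
    ext v; simp [mul_assoc]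
  have hfar : ∀ y : R3, ε < ‖y‖ → ε⁻¹ • y ∉ tsupport g := by
    intro y hy
    rw [hgt, mem_closedBall_zero_iff, norm_smul, Real.norm_of_nonneg (by positivity), not_le,
      lt_inv_mul_iff₀ hε]
    simpa using hy
  have hfr : Module.finrank ℝ R3 = 3 := by simp
  refine ⟨η, hηc, fun y hy => ?_, fun y hy => ?_, fun y => ?_, ?_, ?_⟩
  · simp [hη, image_eq_zero_of_notMem_tsupport (hfar y hy)]
  · have : ε⁻¹ • y ∉ tsupport (fderiv ℝ g) := fun h => hfar y hy (tsupport_fderiv_subset ℝ h)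
    rw [hd, image_eq_zero_of_notMem_tsupport this, smul_zero]
  · exact mul_nonneg (by positivity) (b.nonneg_normed _)
  · rw [hη, integral_const_mul, Measure.integral_comp_smul, hfr, hg, b.integral_normed,
      abs_of_pos (by positivity)]
    simp only [smul_eq_mul]
    field_simp
  · simp_rw [hd, norm_smul]
    rw [integral_const_mul, Measure.integral_comp_smul volume (fun y => ‖fderiv ℝ g y‖), hfr,
      abs_of_pos (by positivity), Real.norm_of_nonneg (by positivity), smul_eq_mul]
    refine le_of_eq ?_
    field_simp

theorem hasCompactSupport_of_far {F : Type*} [Zero F] {f : R3 → F} {R : ℝ}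
    (h : ∀ y, R < ‖y‖ → f y = 0) : HasCompactSupport f :=
  HasCompactSupport.intro (isCompact_closedBall (0 : R3) R) fun x hx =>
    h x (by simpa using hx)

theorem fderiv_translate (η : R3 → ℝ) (a y : R3) :
    fderiv ℝ (fun y => η (y - a)) y = fderiv ℝ η (y - a) := by
  simpa using fderiv_comp_sub (f := η) (x := y) a

/-- The commutator of mollification and transport at the point `a` is controlled by the
oscillation of the transported quantity. -/
theorem abs_mollified_flux_sub_le {v : R3 → R3} (hv : ContDiff ℝ 1 v)
    (hd : ∀ x, divergence v x = 0) {M : ℝ} (hM : ∀ x, ‖fderiv ℝ v x‖ ≤ M) {C ε δ : ℝ}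
    (hε : 0 < ε) (hδ : 0 ≤ δ) {η : R3 → ℝ} (hη : ContDiff ℝ ∞ η)
    (hη0 : ∀ y, ε < ‖y‖ → η y = 0) (hη1 : ∀ y, ε < ‖y‖ → fderiv ℝ η y = 0)
    (hηn : ∀ y, 0 ≤ η y) (hηi : ∫ y, η y = 1) (hηd : ∫ y, ‖fderiv ℝ η y‖ ≤ C / ε) {a : R3}
    (hosc : ∀ y, ‖y - a‖ ≤ ε → |impulse v y - impulse v a| ≤ δ ∧ |lamb v y - lamb v a| ≤ δ) :
    |(∫ y, impulse v y * η (y - a)) - impulse v a| ≤ δ ∧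
    |(∫ y, (impulse v y * fderiv ℝ η (y - a) (v y - v a) + 2 * lamb v y * η (y - a))) -
      2 * lamb v a| ≤ δ * (M * C + 2) := by
  have hvd : Differentiable ℝ v := hv.differentiable (by simp)
  have hM0 : 0 ≤ M := (norm_nonneg _).trans (hM 0)
  have hη' : ContDiff ℝ 1 η := hη.of_le (by simp)
  have hηc : Continuous fun y => η (y - a) := hη.continuous.comp (by fun_prop)
  have hηdc : Continuous fun y => fderiv ℝ η (y - a) :=
    (hη'.continuous_fderiv (by simp)).comp (by fun_prop)
  have hcs : HasCompactSupport fun y => η (y - a) :=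
    (hasCompactSupport_of_far hη0).comp_homeomorph (Homeomorph.subRight a)
  have hcsd : HasCompactSupport fun y => fderiv ℝ η (y - a) :=
    (hasCompactSupport_of_far hη1).comp_homeomorph (Homeomorph.subRight a)
  have hηint : Integrable fun y => η (y - a) := hηc.integrable_of_hasCompactSupport hcs
  have hηa : ∫ y, η (y - a) = 1 := by rw [integral_sub_right_eq_self η a, hηi]
  have hηda : ∫ y, ‖fderiv ℝ η (y - a)‖ ≤ C / ε := by
    rw [integral_sub_right_eq_self (fun y => ‖fderiv ℝ η y‖) a]; exact hηd
  -- averages of a continuous function against the mollifier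
  have havg : ∀ f : R3 → ℝ, Continuous f → (∀ y, ‖y - a‖ ≤ ε → |f y - f a| ≤ δ) →
      |(∫ y, f y * η (y - a)) - f a| ≤ δ := by
    intro f hf hfo
    have hfi : Integrable fun y => f y * η (y - a) :=
      (hf.mul hηc).integrable_of_hasCompactSupport hcs.mul_left
    have h1 : (∫ y, f y * η (y - a)) - f a = ∫ y, (f y - f a) * η (y - a) := by
      simp_rw [sub_mul]
      rw [integral_sub hfi (hηint.const_mul _), integral_const_mul, hηa, mul_one]
    rw [h1, ← Real.norm_eq_abs]
    calc _ ≤ ∫ y, δ * η (y - a) := by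
          refine norm_integral_le_of_norm_le (hηint.const_mul δ) (Eventually.of_forall fun y => ?_)
          rw [norm_mul, Real.norm_of_nonneg (hηn _)]
          by_cases hy : ‖y - a‖ ≤ ε
          · exact mul_le_mul_of_nonneg_right (hfo y hy) (hηn _)
          · simp [hη0 _ (not_le.1 hy)]
      _ = δ := by rw [integral_const_mul, hηa, mul_one]
  refine ⟨havg _ (continuous_impulse hv) fun y hy => (hosc y hy).1, ?_⟩
  have hlamb := havg _ (continuous_lamb hv) fun y hy => (hosc y hy).2
  have hvc : Continuous fun y => v y - v a := hv.continuous.sub continuous_const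
  have hdc : Continuous fun y => fderiv ℝ η (y - a) (v y - v a) := hηdc.clm_apply hvc
  have hdcs : HasCompactSupport fun y => fderiv ℝ η (y - a) (v y - v a) :=
    hcsd.mono fun y hy => by
      rw [Function.mem_support] at hy ⊢
      exact fun h => hy (by rw [h, _root_.zero_apply])
  -- the divergence condition allows subtracting the value of the impulse density at `a`
  have hzero : ∫ y, fderiv ℝ η (y - a) (v y - v a) = 0 := by
    have hηa' : ContDiff ℝ 1 fun y => η (y - a) := hη'.comp (contDiff_id.sub contDiff_const)
    have h1 := integral_sum_mul_fderiv (f := fun i y => v y i - v a i)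
      (fun i => (contDiff_comp hv i).sub contDiff_const) hηa' hcs
    have h2 : ∀ y, ∑ i, fderiv ℝ (fun y => v y i - v a i) y (e i) = 0 := by
      intro y
      have h3 : ∀ i, fderiv ℝ (fun y => v y i - v a i) y = fderiv ℝ (fun y => v y i) y := fun i =>
        fderiv_sub_const (v a i)
      simp only [h3]
      rw [sum_fderiv_comp hvd, hd]
    simp_rw [h2, fderiv_translate] at h1
    simp only [mul_zero, integral_zero, neg_zero] at h1
    rw [← h1]
    refine integral_congr_ae (Eventually.of_forall fun y => ?_)
    exact (clm_apply_eq_sum _ _).trans (by simp)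
  have hi1 : Integrable fun y => impulse v y * fderiv ℝ η (y - a) (v y - v a) :=
    ((continuous_impulse hv).mul hdc).integrable_of_hasCompactSupport hdcs.mul_left
  have hi2 : Integrable fun y => 2 * lamb v y * η (y - a) :=
    ((continuous_const.mul (continuous_lamb hv)).mul hηc).integrable_of_hasCompactSupport
      hcs.mul_left
  have hi3 : Integrable fun y => fderiv ℝ η (y - a) (v y - v a) :=
    hdc.integrable_of_hasCompactSupport hdcs
  have hcomm : |∫ y, impulse v y * fderiv ℝ η (y - a) (v y - v a)| ≤ δ * (M * C) := by
    have h1 : ∫ y, impulse v y * fderiv ℝ η (y - a) (v y - v a) =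
        ∫ y, (impulse v y - impulse v a) * fderiv ℝ η (y - a) (v y - v a) := by
      simp_rw [sub_mul]
      rw [integral_sub hi1 (hi3.const_mul _), integral_const_mul, hzero, mul_zero, sub_zero]
    rw [h1, ← Real.norm_eq_abs]
    have hni : Integrable fun y => ‖fderiv ℝ η (y - a)‖ :=
      (hηdc.integrable_of_hasCompactSupport hcsd).norm
    calc _ ≤ ∫ y, δ * (M * ε) * ‖fderiv ℝ η (y - a)‖ := by
          refine norm_integral_le_of_norm_le (hni.const_mul _) (Eventually.of_forall fun y => ?_)
          by_cases hy : ‖y - a‖ ≤ ε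
          · have hlip : ‖v y - v a‖ ≤ M * ε := by
              refine (Convex.norm_image_sub_le_of_norm_fderiv_le (fun x _ => hvd x)
                (fun x _ => hM x) convex_univ (mem_univ a) (mem_univ y)).trans ?_
              gcongr
            rw [norm_mul]
            calc _ ≤ δ * (‖fderiv ℝ η (y - a)‖ * (M * ε)) := by
                  refine mul_le_mul (hosc y hy).1 ?_ (norm_nonneg _) hδ
                  exact (ContinuousLinearMap.le_opNorm _ _).trans (by gcongr)
              _ = _ := by ring
          · simp [hη1 _ (not_le.1 hy)]
      _ ≤ δ * (M * ε) * (C / ε) := by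
          rw [integral_const_mul]; gcongr
      _ = δ * (M * C) := by field_simp
  have hl2 : ∫ y, 2 * lamb v y * η (y - a) = 2 * ∫ y, lamb v y * η (y - a) := by
    rw [← integral_const_mul]; congr 1; ext1 y; ring
  rw [integral_add hi1 hi2, hl2]
  calc _ = |(∫ y, impulse v y * fderiv ℝ η (y - a) (v y - v a)) +
        2 * ((∫ y, lamb v y * η (y - a)) - lamb v a)| := by congr 1; ring
    _ ≤ δ * (M * C) + 2 * δ := by
        refine (abs_add_le _ _).trans (add_le_add hcomm ?_)
        rw [abs_mul, abs_of_pos (by norm_num : (0 : ℝ) < 2)]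
        gcongr
    _ = _ := by ring

namespace RegularSolution

variable {u : ℝ → R3 → R3} (hu : RegularSolution u)

include hu

/-- Trajectories of the flow exist on every time interval, through every point. -/
theorem exists_trajectory {T t₀ : ℝ} (ht₀ : t₀ ∈ Icc 0 T) (x : R3) :
    ∃ X : ℝ → R3, X t₀ = x ∧
      ∀ t ∈ Icc 0 T, HasDerivWithinAt X (u t (X t)) (Icc 0 T) t := by
  obtain ⟨M, hM0, hM⟩ := hu.exists_bound T
  have hT : 0 ≤ T := ht₀.1.trans ht₀.2
  lift M to NNReal using hM0.le
  lift T to NNReal using hT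
  have hpl : IsPicardLindelof u (tmin := 0) (tmax := (T : ℝ)) ⟨t₀, ht₀⟩ x (M * T) 0 M M := by
    refine ⟨fun t ht => ?_, fun y _ => ?_, fun t ht y _ => (hM t ht y).1, ?_⟩
    · refine LipschitzWith.lipschitzOnWith ?_
      refine lipschitzWith_of_nnnorm_fderiv_le (hu.differentiable ht.1) fun y => ?_
      exact_mod_cast (hM t ht y).2
    · exact (hu.continuousOn_uncurry.comp (f := fun t : ℝ => (t, y))
        (Continuous.continuousOn (by fun_prop)) fun t ht => ⟨ht.1, mem_univ _⟩)
    · have h1 := ht₀.1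
      have h2 := ht₀.2
      have : max ((T : ℝ) - t₀) (t₀ - 0) ≤ T := max_le (by linarith) (by linarith)
      push_cast
      rw [sub_zero]
      simpa using mul_le_mul_of_nonneg_left this M.2
  obtain ⟨X, hX0, hX⟩ := hpl.exists_eq_forall_mem_Icc_hasDerivWithinAt₀
  exact ⟨X, hX0, hX⟩

theorem continuousOn_mollified {η : R3 → ℝ} (hη : ContDiff ℝ ∞ η)
    (hη0 : ∀ y, 1 < ‖y‖ → η y = 0) (ρ : ℝ) :
    ContinuousOn (fun p : ℝ × R3 => ∫ y, impulse (u p.1) y * η (y - p.2))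
      (Ici 0 ×ˢ Metric.closedBall 0 ρ) := by
  refine continuousOn_integral_of_compact_support (k := Metric.closedBall 0 (ρ + 1))
    (isCompact_closedBall _ _) ?_ ?_
  · have h1 : ContinuousOn (fun q : (ℝ × R3) × R3 => impulse (u q.1.1) q.2)
        ((Ici 0 ×ˢ Metric.closedBall 0 ρ) ×ˢ univ) :=
      hu.continuousOn_impulse.comp (f := fun q : (ℝ × R3) × R3 => (q.1.1, q.2))
        (Continuous.continuousOn (by fun_prop)) fun q hq => ⟨hq.1.1, mem_univ _⟩
    have h2 : Continuous fun q : (ℝ × R3) × R3 => η (q.2 - q.1.2) :=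
      hη.continuous.comp (by fun_prop)
    exact h1.mul h2.continuousOn
  · rintro p y hp hy
    have h1 : ‖p.2‖ ≤ ρ := by simpa using hp.2
    have h2 : ρ + 1 < ‖y‖ := by simpa using hy
    have : 1 < ‖y - p.2‖ := by linarith [norm_sub_norm_le y p.2]
    simp [hη0 _ this]

/-- The derivative of the mollified impulse density along a curve that moves with the flow. -/
theorem hasDerivAt_mollified (haxi : ∀ t, 0 ≤ t → IsAxisymmetricSwirlFree (u t))
    {η : R3 → ℝ} (hη : ContDiff ℝ ∞ η)
    (hη0 : ∀ y, 1 < ‖y‖ → η y = 0) (hη1 : ∀ y, 1 < ‖y‖ → fderiv ℝ η y = 0)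
    {X : ℝ → R3} {t : ℝ} (ht : 0 < t) (hX : HasDerivAt X (u t (X t)) t) :
    HasDerivAt (fun τ => ∫ y, impulse (u τ) y * η (y - X τ))
      (∫ y, (impulse (u t) y * fderiv ℝ η (y - X t) (u t y - u t (X t)) +
        2 * lamb (u t) y * η (y - X t))) t := by
  set ρ : ℝ := ‖X t‖ + 1 with hρ
  have hη' : ContDiff ℝ 1 η := hη.of_le (by simp)
  have hηfc : Continuous (fderiv ℝ η) := hη'.continuous_fderiv (by simp)
  have hcsa : ∀ a, HasCompactSupport fun y => η (y - a) := fun a =>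
    (hasCompactSupport_of_far hη0).comp_homeomorph (Homeomorph.subRight a)
  have hcsd : ∀ a, HasCompactSupport fun y => fderiv ℝ η (y - a) := fun a =>
    (hasCompactSupport_of_far hη1).comp_homeomorph (Homeomorph.subRight a)
  have hsm : ∀ a, ContDiff ℝ ∞ fun y => η (y - a) := fun a =>
    hη.comp (contDiff_id.sub contDiff_const)
  set f : ℝ → R3 → ℝ := fun τ a => ∫ y, impulse (u τ) y * η (y - a) with hf
  set P : ℝ → R3 → ℝ := fun τ a => ∫ y, impulseFlux (u τ) (fun y => η (y - a)) y with hP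
  set f₁ : ℝ → R3 → ℝ →L[ℝ] ℝ := fun τ a => ContinuousLinearMap.toSpanSingleton ℝ (P τ a) with hf₁
  set f₂ : ℝ → R3 → R3 →L[ℝ] ℝ := fun τ a =>
    ∫ y, (-(impulse (u τ) y)) • fderiv ℝ η (y - a) with hf₂
  have hS : Ioi (0 : ℝ) ×ˢ Metric.ball (0 : R3) ρ ∈ 𝓝 (t, X t) :=
    prod_mem_nhds (Ioi_mem_nhds ht) (Metric.isOpen_ball.mem_nhds (by simp [hρ]))
  have hsub : Ioi (0 : ℝ) ×ˢ Metric.ball (0 : R3) ρ ⊆ Ici 0 ×ˢ Metric.closedBall 0 ρ :=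
    prod_mono (fun τ hτ => (mem_Ioi.1 hτ).le) Metric.ball_subset_closedBall
  have hgc : ContinuousOn (fun q : (ℝ × R3) × R3 => impulse (u q.1.1) q.2)
      ((Ici 0 ×ˢ Metric.closedBall 0 ρ) ×ˢ univ) :=
    hu.continuousOn_impulse.comp (f := fun q : (ℝ × R3) × R3 => (q.1.1, q.2))
      (Continuous.continuousOn (by fun_prop)) fun q hq => ⟨hq.1.1, mem_univ _⟩
  have hlc : ContinuousOn (fun q : (ℝ × R3) × R3 => lamb (u q.1.1) q.2)
      ((Ici 0 ×ˢ Metric.closedBall 0 ρ) ×ˢ univ) :=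
    hu.continuousOn_lamb.comp (f := fun q : (ℝ × R3) × R3 => (q.1.1, q.2))
      (Continuous.continuousOn (by fun_prop)) fun q hq => ⟨hq.1.1, mem_univ _⟩
  have huc : ContinuousOn (fun q : (ℝ × R3) × R3 => u q.1.1 q.2)
      ((Ici 0 ×ˢ Metric.closedBall 0 ρ) ×ˢ univ) :=
    hu.continuousOn_uncurry.comp (f := fun q : (ℝ × R3) × R3 => (q.1.1, q.2))
      (Continuous.continuousOn (by fun_prop)) fun q hq => ⟨hq.1.1, mem_univ _⟩
  have hηq : Continuous fun q : (ℝ × R3) × R3 => η (q.2 - q.1.2) :=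
    hη.continuous.comp (by fun_prop)
  have hηdq : Continuous fun q : (ℝ × R3) × R3 => fderiv ℝ η (q.2 - q.1.2) :=
    hηfc.comp (by fun_prop)
  have hfar : ∀ p : ℝ × R3, ∀ y, p ∈ Ici (0 : ℝ) ×ˢ Metric.closedBall 0 ρ →
      y ∉ Metric.closedBall (0 : R3) (ρ + 1) → 1 < ‖y - p.2‖ := by
    rintro p y hp hy
    have h1 : ‖p.2‖ ≤ ρ := by simpa using hp.2
    have h2 : ρ + 1 < ‖y‖ := by simpa using hy
    linarith [norm_sub_norm_le y p.2]
  have hPc : ContinuousOn (fun p : ℝ × R3 => P p.1 p.2) (Ici 0 ×ˢ Metric.closedBall 0 ρ) := by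
    refine continuousOn_integral_of_compact_support (k := Metric.closedBall 0 (ρ + 1))
      (isCompact_closedBall _ _) ?_ ?_
    · have hE : (Function.uncurry fun (p : ℝ × R3) y =>
            impulseFlux (u p.1) (fun y => η (y - p.2)) y) =
          fun q : (ℝ × R3) × R3 => impulse (u q.1.1) q.2 * fderiv ℝ η (q.2 - q.1.2) (u q.1.1 q.2) +
            2 * lamb (u q.1.1) q.2 * η (q.2 - q.1.2) := by
        ext q
        simp only [Function.uncurry, impulseFlux, fderiv_translate]
      rw [hE]
      exact (hgc.mul (hηdq.continuousOn.clm_apply huc)).add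
        ((continuousOn_const.mul hlc).mul hηq.continuousOn)
    · intro p y hp hy
      have := hfar p y hp hy
      simp only [impulseFlux, fderiv_translate, hη0 _ this, hη1 _ this]
      simp
  have hf₂c : ContinuousOn (fun p : ℝ × R3 => f₂ p.1 p.2) (Ici 0 ×ˢ Metric.closedBall 0 ρ) := by
    refine continuousOn_integral_of_compact_support (k := Metric.closedBall 0 (ρ + 1))
      (isCompact_closedBall _ _) ?_ ?_
    · exact hgc.neg.smul hηdq.continuousOn
    · intro p y hp hy
      simp only [hη1 _ (hfar p y hp hy), smul_zero]
  have hf₁c : ContinuousOn (fun p : ℝ × R3 => f₁ p.1 p.2) (Ici 0 ×ˢ Metric.closedBall 0 ρ) :=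
    (ContinuousLinearMap.toSpanSingletonCLE (𝕜 := ℝ) (E := ℝ)).continuous.comp_continuousOn hPc
  have hd₁ : ∀ᶠ p : ℝ × R3 in 𝓝 (t, X t), HasFDerivAt (f · p.2) (f₁ p.1 p.2) p.1 := by
    filter_upwards [hS] with p hp
    exact (hu.hasDerivAt_integral_impulse haxi (hsm p.2) (hcsa p.2) hp.1).hasFDerivAt
  have hd₂ : ∀ᶠ p : ℝ × R3 in 𝓝 (t, X t), HasFDerivAt (f p.1 ·) (f₂ p.1 p.2) p.2 := by
    filter_upwards [hS] with p hp
    have hp0 : 0 ≤ p.1 := (mem_Ioi.1 hp.1).le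
    have hic : Continuous (impulse (u p.1)) := continuous_impulse (hu.contDiff _ hp0)
    obtain ⟨B, hB⟩ := hηfc.bounded_above_of_compact_support (hasCompactSupport_of_far hη1)
    refine hasFDerivAt_integral_of_dominated_of_fderiv_le (s := Metric.ball 0 ρ)
      (F := fun a y => impulse (u p.1) y * η (y - a))
      (F' := fun a y => (-(impulse (u p.1) y)) • fderiv ℝ η (y - a))
      (bound := (Metric.closedBall (0 : R3) (ρ + 1)).indicator fun y => |impulse (u p.1) y| * B)
      (Metric.isOpen_ball.mem_nhds hp.2) ?_ ?_ ?_ ?_ ?_ ?_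
    · exact Eventually.of_forall fun a =>
        (hic.mul (hη.continuous.comp (by fun_prop))).aestronglyMeasurable
    · exact (hic.mul (hη.continuous.comp (by fun_prop))).integrable_of_hasCompactSupport
        (hcsa p.2).mul_left
    · exact (hic.neg.smul (hηfc.comp (by fun_prop))).aestronglyMeasurable
    · refine Eventually.of_forall fun y a ha => ?_
      by_cases hy : y ∈ Metric.closedBall (0 : R3) (ρ + 1)
      · rw [indicator_of_mem hy, norm_smul, norm_neg, Real.norm_eq_abs]
        gcongr
        exact hB _
      · rw [hη1 _ (hfar (p.1, a) y ⟨hp0, Metric.ball_subset_closedBall ha⟩ hy), smul_zero,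
          norm_zero, indicator_of_notMem hy]
    · rw [integrable_indicator_iff Metric.isClosed_closedBall.measurableSet]
      exact (hic.abs.mul continuous_const).continuousOn.integrableOn_compact
        (isCompact_closedBall _ _)
    · refine Eventually.of_forall fun y a _ => ?_
      have h1 : HasFDerivAt (fun a : R3 => y - a) (-ContinuousLinearMap.id ℝ R3) a :=
        (hasFDerivAt_id a).const_sub y
      have h2 := ((hη'.differentiable (by simp) (y - a)).hasFDerivAt.comp a h1).const_mul
        (impulse (u p.1) y)
      refine h2.congr_fderiv ?_
      ext v; simp
  have hstrict := hasStrictFDerivAt_uncurry_coprod (f := f) (f₁ := f₁) (f₂ := f₂) hd₁ hd₂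
    ((hf₁c.mono hsub).continuousAt hS) ((hf₂c.mono hsub).continuousAt hS)
  have hcomp := hstrict.hasFDerivAt.comp_hasDerivAt t ((hasDerivAt_id t).prodMk hX)
  refine hcomp.congr_deriv ?_
  have hic : Continuous (impulse (u t)) := continuous_impulse (hu.contDiff _ ht.le)
  have hint2 : Integrable fun y => (-(impulse (u t) y)) • fderiv ℝ η (y - X t) :=
    (hic.neg.smul (hηfc.comp (by fun_prop))).integrable_of_hasCompactSupport (hcsd _).smul_left
  have hint1 : Integrable fun y => impulseFlux (u t) (fun y => η (y - X t)) y :=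
    (continuous_impulseFlux (hu.contDiff t ht.le)
      ((hsm _).of_le (by simp))).integrable_of_hasCompactSupport
      (HasCompactSupport.intro (hcsa (X t)) fun x hx => impulseFlux_eq_zero hx)
  change (f₁ t (X t)) 1 + (f₂ t (X t)) (u t (X t)) = _
  simp only [hf₁, hf₂, hP, ContinuousLinearMap.toSpanSingleton_apply, one_smul]
  rw [ContinuousLinearMap.integral_apply hint2,
    ← integral_add hint1 (hint2.apply_continuousLinearMap _)]
  refine integral_congr_ae (Eventually.of_forall fun y => ?_)
  simp only [impulseFlux, fderiv_translate, map_sub, _root_.smul_apply, smul_eq_mul]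
  ring

/-- Along trajectories the impulse density `Γ` grows at the rate `2 u_r ω_θ`. -/
theorem impulse_trajectory (haxi : ∀ t, 0 ≤ t → IsAxisymmetricSwirlFree (u t)) {T : ℝ} {X : ℝ → R3}
    (hX : ∀ t ∈ Icc 0 T, HasDerivWithinAt X (u t (X t)) (Icc 0 T) t) {t : ℝ} (ht : t ∈ Icc 0 T) :
    impulse (u t) (X t) - impulse (u 0) (X 0) = ∫ τ in (0 : ℝ)..t, 2 * lamb (u τ) (X τ) := by
  have hT : 0 ≤ T := ht.1.trans ht.2
  obtain ⟨M, hM0, hM⟩ := hu.exists_bound T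
  obtain ⟨C, hC0, hmol⟩ := exists_mollifier
  have hXc : ContinuousOn X (Icc 0 T) := fun τ hτ => (hX τ hτ).continuousWithinAt
  obtain ⟨ρ, hρ⟩ := (isCompact_Icc.image_of_continuousOn hXc).isBounded.subset_closedBall 0
  have hXρ : ∀ τ ∈ Icc 0 T, ‖X τ‖ ≤ ρ := fun τ hτ => by
    simpa using hρ (mem_image_of_mem X hτ)
  have hpair : ContinuousOn (fun τ => (τ, X τ)) (Icc 0 T) := continuousOn_id.prodMk hXc
  set h : ℝ → ℝ := fun τ => 2 * lamb (u τ) (X τ) with hh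
  have hhc : ContinuousOn h (Icc 0 T) :=
    continuousOn_const.mul (hu.continuousOn_lamb.comp hpair fun τ hτ => ⟨hτ.1, mem_univ _⟩)
  set H : ℝ → ℝ := fun t => ∫ τ in (0 : ℝ)..t, h τ with hH
  have hHc : ContinuousOn H (Icc 0 T) := by
    have := intervalIntegral.continuousOn_primitive_interval (μ := volume) (f := h)
      (a := 0) (b := T)
      (by rw [uIcc_of_le hT]; exact hhc.integrableOn_compact isCompact_Icc)
    rwa [uIcc_of_le hT] at this
  have hHd : ∀ τ ∈ Ioo 0 T, HasDerivAt H (h τ) τ := by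
    intro τ hτ
    have hsub : uIcc 0 τ ⊆ Icc 0 T := by
      rw [uIcc_of_le hτ.1.le]; exact Icc_subset_Icc_right hτ.2.le
    refine intervalIntegral.integral_hasDerivAt_right ((hhc.mono hsub).intervalIntegrable) ?_
      (hhc.continuousAt (Icc_mem_nhds hτ.1 hτ.2))
    exact (hhc.mono Ioo_subset_Icc_self).stronglyMeasurableAtFilter isOpen_Ioo τ hτ
  have hKc : IsCompact (Icc 0 T ×ˢ Metric.closedBall (0 : R3) (ρ + 1)) :=
    isCompact_Icc.prod (isCompact_closedBall _ _)
  have hKsub : Icc 0 T ×ˢ Metric.closedBall (0 : R3) (ρ + 1) ⊆ Ici 0 ×ˢ univ :=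
    prod_mono (fun τ hτ => hτ.1) (subset_univ _)
  have hui := hKc.uniformContinuousOn_of_continuous (hu.continuousOn_impulse.mono hKsub)
  have hul := hKc.uniformContinuousOn_of_continuous (hu.continuousOn_lamb.mono hKsub)
  rw [Metric.uniformContinuousOn_iff] at hui hul
  have key : ∀ δ, 0 < δ → |impulse (u t) (X t) - impulse (u 0) (X 0) - H t| ≤
      2 * δ + δ * (M * C + 2) * T := by
    intro δ hδ
    obtain ⟨ε₁, hε₁, h1⟩ := hui δ hδ
    obtain ⟨ε₂, hε₂, h2⟩ := hul δ hδ
    set ε : ℝ := min 1 (min (ε₁ / 2) (ε₂ / 2)) with hε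
    have hεpos : 0 < ε := by positivity
    have hε1 : ε ≤ 1 := min_le_left _ _
    have hεa : ε < ε₁ := by
      have : ε ≤ ε₁ / 2 := (min_le_right _ _).trans (min_le_left _ _)
      linarith
    have hεb : ε < ε₂ := by
      have : ε ≤ ε₂ / 2 := (min_le_right _ _).trans (min_le_right _ _)
      linarith
    obtain ⟨η, hηs, hη0, hη1, hηn, hηi, hηd⟩ := hmol ε hεpos
    have hosc : ∀ τ ∈ Icc 0 T, ∀ y, ‖y - X τ‖ ≤ ε →
        |impulse (u τ) y - impulse (u τ) (X τ)| ≤ δ ∧ |lamb (u τ) y - lamb (u τ) (X τ)| ≤ δ := by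
      intro τ hτ y hy
      have hmem1 : (τ, y) ∈ Icc 0 T ×ˢ Metric.closedBall (0 : R3) (ρ + 1) := by
        refine ⟨hτ, ?_⟩
        rw [mem_closedBall_zero_iff]
        have := norm_sub_norm_le y (X τ)
        linarith [hXρ τ hτ]
      have hmem2 : (τ, X τ) ∈ Icc 0 T ×ˢ Metric.closedBall (0 : R3) (ρ + 1) := by
        refine ⟨hτ, ?_⟩
        rw [mem_closedBall_zero_iff]
        linarith [hXρ τ hτ]
      have hdist : dist (τ, y) (τ, X τ) ≤ ε := by
        rw [Prod.dist_eq, dist_self, dist_eq_norm]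
        exact max_le hεpos.le hy
      exact ⟨(h1 _ hmem1 _ hmem2 (hdist.trans_lt hεa)).le,
        (h2 _ hmem1 _ hmem2 (hdist.trans_lt hεb)).le⟩
    have hest : ∀ τ (hτ : τ ∈ Icc 0 T), _ := fun τ hτ =>
      abs_mollified_flux_sub_le (hu.contDiff τ hτ.1) (hu.div_eq_zero τ hτ.1)
        (fun x => (hM τ hτ x).2) hεpos hδ.le hηs hη0 hη1 hηn hηi hηd (hosc τ hτ)
    set G : ℝ → ℝ := fun τ => ∫ y, impulse (u τ) y * η (y - X τ) with hG
    have hη0' : ∀ y, 1 < ‖y‖ → η y = 0 := fun y hy => hη0 y (hε1.trans_lt hy)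
    have hη1' : ∀ y, 1 < ‖y‖ → fderiv ℝ η y = 0 := fun y hy => hη1 y (hε1.trans_lt hy)
    have hGc : ContinuousOn G (Icc 0 T) :=
      ContinuousOn.comp (g := fun p : ℝ × R3 => ∫ y, impulse (u p.1) y * η (y - p.2))
        (f := fun τ => (τ, X τ)) (hu.continuousOn_mollified hηs hη0' ρ) hpair fun τ hτ =>
          ⟨hτ.1, mem_closedBall_zero_iff.2 (hXρ τ hτ)⟩
    have hGd : ∀ τ ∈ Ioo 0 T, ∃ G', HasDerivAt (fun τ => G τ - H τ) G' τ ∧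
        ‖G'‖ ≤ δ * (M * C + 2) := by
      intro τ hτ
      have hτ' : τ ∈ Icc 0 T := Ioo_subset_Icc_self hτ
      have hXd : HasDerivAt X (u τ (X τ)) τ := (hX τ hτ').hasDerivAt (Icc_mem_nhds hτ.1 hτ.2)
      exact ⟨_, (hu.hasDerivAt_mollified haxi hηs hη0' hη1' hτ.1 hXd).sub (hHd τ hτ),
        (hest τ hτ').2⟩
    have hlip : |(G t - H t) - (G 0 - H 0)| ≤ δ * (M * C + 2) * (t - 0) := by
      choose! G' hG1 hG2 using hGd
      rcases ht.1.eq_or_lt with h0 | h0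
      · rw [← h0]; simp
      -- mean value inequality on the closed interval, with derivatives in the interior only
      obtain ⟨c, hc, hc'⟩ := exists_hasDerivAt_eq_slope (fun τ => G τ - H τ) G' h0
        ((hGc.sub hHc).mono (Icc_subset_Icc_right ht.2))
        (fun τ hτ => hG1 τ ⟨hτ.1, hτ.2.trans_le ht.2⟩)
      have h5 := hG2 c ⟨hc.1, hc.2.trans_le ht.2⟩
      have ht0 : (0 : ℝ) < t - 0 := by linarith
      rw [eq_div_iff ht0.ne'] at hc'
      rw [← hc', abs_mul, abs_of_pos ht0]
      exact mul_le_mul_of_nonneg_right h5 ht0.le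
    have hH0 : H 0 = 0 := by simp [hH]
    have e1 := (hest t ht).1
    have e0 := (hest 0 (left_mem_Icc.2 hT)).1
    have hfin : δ * (M * C + 2) * (t - 0) ≤ δ * (M * C + 2) * T := by
      have : 0 ≤ δ * (M * C + 2) := by positivity
      refine mul_le_mul_of_nonneg_left ?_ this
      linarith [ht.2]
    rw [hH0] at hlip
    rw [abs_le] at *
    simp only [hG] at hlip
    constructor <;> linarith [e1.1, e1.2, e0.1, e0.2, hlip.1, hlip.2]
  have hzero : |impulse (u t) (X t) - impulse (u 0) (X 0) - H t| ≤ 0 := by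
    refine le_of_forall_pos_le_add fun κ hκ => ?_
    have hden : 0 < 2 + (M * C + 2) * T := by positivity
    have := key (κ / (2 + (M * C + 2) * T)) (by positivity)
    rw [zero_add]
    refine this.trans (le_of_eq ?_)
    field_simp
  have := abs_nonpos_iff.1 hzero
  linarith

end RegularSolution



/-! ### Persistence of the support and the sign of the vorticity -/

theorem impulse_eq {v : R3 → R3} (ha : IsAxisymmetricSwirlFree v) (hv : Differentiable ℝ v)
    (x : R3) : impulse v x = radius x * omegaTheta v (radius x) (x 2) := by
  obtain ⟨θ, hθ⟩ := exists_polar x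
  have h := curl_polar ha hv (radius x) θ (x 2)
  rw [← hθ] at h
  have h0 : x 0 = radius x * Real.cos θ := by
    have := congrArg (fun y : R3 => y 0) hθ; simpa using this
  have h1 : x 1 = radius x * Real.sin θ := by
    have := congrArg (fun y : R3 => y 1) hθ; simpa using this
  rw [impulse, h]
  simp
  linear_combination (omegaTheta v (radius x) (x 2) * Real.cos θ) * h0 +
    (omegaTheta v (radius x) (x 2) * Real.sin θ) * h1 +
    (omegaTheta v (radius x) (x 2) * radius x) * Real.sin_sq_add_cos_sq θ

/-- Away from the axis, `Γ (v_r r) = r² (v_r ω_θ)`, cleared of denominators. -/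
theorem radius_sq_mul_lamb {v : R3 → R3} (ha : IsAxisymmetricSwirlFree v)
    (hv : Differentiable ℝ v) (x : R3) :
    radius x ^ 2 * lamb v x = impulse v x * (x 0 * v x 0 + x 1 * v x 1) := by
  obtain ⟨h0, h1, -⟩ := curl_formula ha hv x
  have hi := impulse_eq ha hv x
  rw [hi, lamb]
  linear_combination radius x * v x 0 * h1 - radius x * v x 1 * h0

theorem radius_vec (r z : ℝ) (hr : 0 ≤ r) : radius !₂[r, 0, z] = r := by
  simp [radius, Real.sqrt_sq hr]

/-- A function `g` with `|g'| ≤ K |g|` varies at most exponentially. -/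
theorem exp_comparison {g g' : ℝ → ℝ} {T K : ℝ} (hK : 0 ≤ K) (hg0 : ∀ t ∈ Icc 0 T, 0 ≤ g t)
    (hg : ∀ t ∈ Icc 0 T, HasDerivWithinAt g (g' t) (Icc 0 T) t)
    (hb : ∀ t ∈ Icc 0 T, |g' t| ≤ K * g t) {s t : ℝ} (hs : s ∈ Icc 0 T) (ht : t ∈ Icc 0 T) :
    g s ≤ Real.exp (K * T) * g t := by
  have hgc : ContinuousOn g (Icc 0 T) := fun τ hτ => (hg τ hτ).continuousWithinAt
  have hd : ∀ c : ℝ, ∀ τ ∈ interior (Icc 0 T), HasDerivWithinAt (fun τ => Real.exp (c * τ) * g τ)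
      (Real.exp (c * τ) * (c * g τ + g' τ)) (interior (Icc 0 T)) τ := by
    intro c τ hτ
    have h1 := (((hasDerivAt_id τ).const_mul c).exp).hasDerivWithinAt (s := interior (Icc 0 T))
    have h2 := h1.mul ((hg τ (interior_subset hτ)).mono interior_subset)
    refine h2.congr_deriv ?_
    simp
    ring
  have hc : ∀ c : ℝ, ContinuousOn (fun τ => Real.exp (c * τ) * g τ) (Icc 0 T) := fun c =>
    (Continuous.continuousOn (by fun_prop)).mul hgc
  rcases le_total s t with hst | hst
  · have hm : MonotoneOn (fun τ => Real.exp (K * τ) * g τ) (Icc 0 T) := by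
      refine monotoneOn_of_hasDerivWithinAt_nonneg (convex_Icc _ _) (hc K) (hd K) fun τ hτ => ?_
      have := neg_le_of_abs_le (hb τ (interior_subset hτ))
      exact mul_nonneg (Real.exp_pos _).le (by linarith)
    have h := hm hs ht hst
    simp only at h
    have h1 : 1 ≤ Real.exp (K * s) := Real.one_le_exp (mul_nonneg hK hs.1)
    have h2 : Real.exp (K * t) ≤ Real.exp (K * T) := by
      gcongr; exact ht.2
    calc g s ≤ Real.exp (K * s) * g s := le_mul_of_one_le_left (hg0 s hs) h1
      _ ≤ _ := h
      _ ≤ _ := mul_le_mul_of_nonneg_right h2 (hg0 t ht)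
  · have hm : AntitoneOn (fun τ => Real.exp (-K * τ) * g τ) (Icc 0 T) := by
      refine antitoneOn_of_hasDerivWithinAt_nonpos (convex_Icc _ _) (hc (-K)) (hd (-K))
        fun τ hτ => ?_
      have := le_of_abs_le (hb τ (interior_subset hτ))
      exact mul_nonpos_of_nonneg_of_nonpos (Real.exp_pos _).le (by linarith)
    have h := hm ht hs hst
    simp only at h
    calc g s = Real.exp (K * s) * (Real.exp (-K * s) * g s) := by
          rw [← mul_assoc, ← Real.exp_add]; simp
      _ ≤ Real.exp (K * s) * (Real.exp (-K * t) * g t) := by gcongr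
      _ ≤ Real.exp (K * T) * (1 * g t) := by
          have h0 := hg0 t ht
          gcongr
          · exact hs.2
          · rw [Real.exp_le_one_iff]; nlinarith [ht.1]
      _ = _ := by ring

theorem norm_sub_le_of_fderiv {v : R3 → R3} (hv : Differentiable ℝ v) {M : ℝ}
    (hM : ∀ x, ‖fderiv ℝ v x‖ ≤ M) (x a : R3) : ‖v x - v a‖ ≤ M * ‖x - a‖ :=
  Convex.norm_image_sub_le_of_norm_fderiv_le (fun x _ => hv x) (fun x _ => hM x) convex_univ
    (mem_univ a) (mem_univ x)

/-- The vertical velocity vanishes on the plane `z = 0`, so a bound on the gradient gives a linear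
bound in the height. -/
theorem abs_vertical_le {v : R3 → R3} (hv : Differentiable ℝ v) (hr : reflField v = v) {M : ℝ}
    (hM : ∀ x, ‖fderiv ℝ v x‖ ≤ M) (x : R3) : |v x 2| ≤ M * |x 2| := by
  have h0 : v !₂[x 0, x 1, 0] 2 = 0 := by
    have h := congrArg (fun y : R3 => y 2) (congrFun hr !₂[x 0, x 1, 0])
    have h2 : refl !₂[x 0, x 1, 0] = !₂[x 0, x 1, 0] := by apply vec3_ext <;> simp
    simp only [reflField, refl_apply_two, h2] at h
    linarith
  have h1 := norm_sub_le_of_fderiv hv hM x !₂[x 0, x 1, 0]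
  have h2 : ‖x - !₂[x 0, x 1, 0]‖ = |x 2| := by
    rw [← sq_eq_sq₀ (norm_nonneg _) (abs_nonneg _), norm_sq_vec3]; simp
  have h3 : |(v x - v !₂[x 0, x 1, 0]) 2| ≤ ‖v x - v !₂[x 0, x 1, 0]‖ :=
    PiLp.norm_apply_le (v x - v !₂[x 0, x 1, 0]) 2
  rw [h2] at h1
  simpa [h0] using h3.trans h1

/-- The horizontal velocity vanishes on the axis, so a bound on the gradient gives a linear bound
in the radius. -/
theorem abs_horizontal_le {v : R3 → R3} (ha : IsAxisymmetricSwirlFree v) (hv : Differentiable ℝ v)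
    {M : ℝ} (hM : ∀ x, ‖fderiv ℝ v x‖ ≤ M) (x : R3) :
    |x 0 * v x 0 + x 1 * v x 1| ≤ M * radius x ^ 2 := by
  obtain ⟨h0, h1⟩ := axisym_horizontal_on_axis ha (x := !₂[0, 0, x 2]) (by simp) (by simp)
  have h2 := norm_sub_le_of_fderiv hv hM x !₂[0, 0, x 2]
  have h3 : ‖x - !₂[0, 0, x 2]‖ = radius x := by
    rw [← sq_eq_sq₀ (norm_nonneg _) (radius_nonneg _), norm_sq_vec3, radius_sq]; simp
  rw [h3] at h2
  have h4 : v x 0 ^ 2 + v x 1 ^ 2 ≤ (M * radius x) ^ 2 := by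
    have := pow_le_pow_left₀ (norm_nonneg _) h2 2
    rw [norm_sq_vec3] at this
    simp [h0, h1] at this
    nlinarith [sq_nonneg (v x 2 - v !₂[0, 0, x 2] 2)]
  have hM0 : 0 ≤ M := (norm_nonneg _).trans (hM 0)
  refine abs_le_of_sq_le_sq ?_ (by positivity)
  have h5 := radius_sq x
  calc (x 0 * v x 0 + x 1 * v x 1) ^ 2 ≤ (x 0 ^ 2 + x 1 ^ 2) * (v x 0 ^ 2 + v x 1 ^ 2) := by
        nlinarith [sq_nonneg (x 0 * v x 1 - x 1 * v x 0)]
    _ ≤ radius x ^ 2 * (M * radius x) ^ 2 := by rw [← h5]; gcongr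
    _ = _ := by ring

/-- The configurations of the problem at a fixed time: an odd axisymmetric swirl-free vorticity,
nonpositive and not zero in the upper half space, living at distance at least `a` from the axis and
the plane `z = 0`, and in the cylinder `r, |z| ≤ ρ`. -/
structure OddVortex (v : R3 → R3) (a ρ : ℝ) : Prop where
  contDiff : ContDiff ℝ 1 v
  memLp : MemLp v 2 (volume : Measure R3)
  div_eq_zero : ∀ x, divergence v x = 0
  axisym : IsAxisymmetricSwirlFree v
  refl_eq : reflField v = v
  bounded : ∃ M, ∀ x, ‖v x‖ ≤ M
  pos : 0 < a
  bound : ∀ r z : ℝ, 0 ≤ r → omegaTheta v r z ≠ 0 → a ≤ r ∧ a ≤ |z| ∧ r ≤ ρ ∧ |z| ≤ ρ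
  nonpos : ∀ r z : ℝ, 0 ≤ r → 0 ≤ z → omegaTheta v r z ≤ 0
  ne_zero : ∃ r z : ℝ, 0 ≤ r ∧ 0 ≤ z ∧ omegaTheta v r z ≠ 0

namespace RegularSolution

variable {u : ℝ → R3 → R3} (hu : RegularSolution u)

include hu

section Trajectory

variable (haxi : ∀ t, 0 ≤ t → IsAxisymmetricSwirlFree (u t))
  {T : ℝ} {X : ℝ → R3} (hX : ∀ t ∈ Icc 0 T, HasDerivWithinAt X (u t (X t)) (Icc 0 T) t)

include hX

omit hu in
theorem hasDerivWithinAt_coord (i : Fin 3) {t : ℝ} (ht : t ∈ Icc 0 T) :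
    HasDerivWithinAt (fun t => X t i) (u t (X t) i) (Icc 0 T) t :=
  (EuclideanSpace.proj i : R3 →L[ℝ] ℝ).hasFDerivAt.comp_hasDerivWithinAt t (hX t ht)

omit hu in
theorem hasDerivWithinAt_radius_sq {t : ℝ} (ht : t ∈ Icc 0 T) :
    HasDerivWithinAt (fun t => radius (X t) ^ 2)
      (2 * (X t 0 * u t (X t) 0 + X t 1 * u t (X t) 1)) (Icc 0 T) t := by
  have h0 := hasDerivWithinAt_coord hX 0 ht
  have h1 := hasDerivWithinAt_coord hX 1 ht
  simp only [radius_sq]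
  refine ((h0.fun_pow 2).fun_add (h1.fun_pow 2)).congr_deriv ?_
  simp
  ring

include haxi

theorem radius_sq_le {M : ℝ} (hM0 : 0 ≤ M)
    (hM : ∀ t ∈ Icc 0 T, ∀ x, ‖u t x‖ ≤ M ∧ ‖fderiv ℝ (u t) x‖ ≤ M) {s t : ℝ}
    (hs : s ∈ Icc 0 T) (ht : t ∈ Icc 0 T) :
    radius (X s) ^ 2 ≤ Real.exp (2 * M * T) * radius (X t) ^ 2 := by
  refine exp_comparison (g := fun t => radius (X t) ^ 2) (by positivity) (fun _ _ => sq_nonneg _)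
    (fun τ hτ => hasDerivWithinAt_radius_sq hX hτ) (fun τ hτ => ?_) hs ht
  have := abs_horizontal_le (haxi τ hτ.1) (hu.differentiable hτ.1) (fun x => (hM τ hτ x).2) (X τ)
  rw [abs_mul, abs_of_pos (by norm_num : (0 : ℝ) < 2)]
  linarith

omit haxi in
theorem height_sq_le (hrefl : ∀ t, 0 ≤ t → reflField (u t) = u t) {M : ℝ} (hM0 : 0 ≤ M)
    (hM : ∀ t ∈ Icc 0 T, ∀ x, ‖u t x‖ ≤ M ∧ ‖fderiv ℝ (u t) x‖ ≤ M) {s t : ℝ}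
    (hs : s ∈ Icc 0 T) (ht : t ∈ Icc 0 T) :
    X s 2 ^ 2 ≤ Real.exp (2 * M * T) * X t 2 ^ 2 := by
  refine exp_comparison (g := fun t => X t 2 ^ 2) (g' := fun t => 2 * X t 2 * u t (X t) 2)
    (by positivity) (fun _ _ => sq_nonneg _)
    (fun τ hτ => ?_) (fun τ hτ => ?_) hs ht
  · refine ((hasDerivWithinAt_coord hX 2 hτ).fun_pow 2).congr_deriv ?_
    simp
  · have := abs_vertical_le (hu.differentiable hτ.1) (hrefl τ hτ.1) (fun x => (hM τ hτ x).2) (X τ)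
    rw [abs_mul, abs_mul, abs_of_pos (by norm_num : (0 : ℝ) < 2), ← sq_abs (X τ 2)]
    nlinarith [abs_nonneg (X τ 2)]

/-- The relative vorticity `ω_θ / r = Γ / r²` is constant along trajectories. -/
theorem impulse_div_radius_sq_const (hr : ∀ t ∈ Icc 0 T, radius (X t) ≠ 0) {t : ℝ}
    (ht : t ∈ Icc 0 T) :
    impulse (u t) (X t) / radius (X t) ^ 2 = impulse (u 0) (X 0) / radius (X 0) ^ 2 := by
  have hT : 0 ≤ T := ht.1.trans ht.2
  have hXc : ContinuousOn X (Icc 0 T) := fun τ hτ => (hX τ hτ).continuousWithinAt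
  have hpair : ContinuousOn (fun τ => (τ, X τ)) (Icc 0 T) := continuousOn_id.prodMk hXc
  have hlc : ContinuousOn (fun τ => 2 * lamb (u τ) (X τ)) (Icc 0 T) :=
    continuousOn_const.mul (hu.continuousOn_lamb.comp hpair fun τ hτ => ⟨hτ.1, mem_univ _⟩)
  have hic : ContinuousOn (fun τ => impulse (u τ) (X τ)) (Icc 0 T) :=
    hu.continuousOn_impulse.comp hpair fun τ hτ => ⟨hτ.1, mem_univ _⟩
  have hrc : ContinuousOn (fun τ => radius (X τ) ^ 2) (Icc 0 T) := fun τ hτ =>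
    (hasDerivWithinAt_radius_sq hX hτ).continuousWithinAt
  have hqc : ContinuousOn (fun τ => impulse (u τ) (X τ) / radius (X τ) ^ 2) (Icc 0 T) :=
    hic.div hrc fun τ hτ => pow_ne_zero 2 (hr τ hτ)
  have hd : ∀ τ ∈ Ioo 0 T, HasDerivAt (fun τ => impulse (u τ) (X τ)) (2 * lamb (u τ) (X τ)) τ := by
    intro τ hτ
    have hsub : uIcc 0 τ ⊆ Icc 0 T := by
      rw [uIcc_of_le hτ.1.le]; exact Icc_subset_Icc_right hτ.2.le
    have h1 : HasDerivAt (fun t => ∫ τ in (0 : ℝ)..t, 2 * lamb (u τ) (X τ))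
        (2 * lamb (u τ) (X τ)) τ :=
      intervalIntegral.integral_hasDerivAt_right ((hlc.mono hsub).intervalIntegrable)
        ((hlc.mono Ioo_subset_Icc_self).stronglyMeasurableAtFilter isOpen_Ioo τ hτ)
        (hlc.continuousAt (Icc_mem_nhds hτ.1 hτ.2))
    refine (h1.const_add (impulse (u 0) (X 0))).congr_of_eventuallyEq ?_
    filter_upwards [Icc_mem_nhds hτ.1 hτ.2] with σ hσ
    rw [← hu.impulse_trajectory haxi hX hσ]
    ring
  rcases ht.1.eq_or_lt with h0 | h0
  · rw [← h0]
  obtain ⟨c, hc, hc'⟩ := exists_hasDerivAt_eq_slope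
    (fun τ => impulse (u τ) (X τ) / radius (X τ) ^ 2) (fun _ => 0) h0
    (hqc.mono (Icc_subset_Icc_right ht.2)) (fun τ hτ => by
      have hτ' : τ ∈ Ioo 0 T := ⟨hτ.1, hτ.2.trans_le ht.2⟩
      have hτ'' : τ ∈ Icc 0 T := Ioo_subset_Icc_self hτ'
      have h1 := (hasDerivWithinAt_radius_sq hX hτ'').hasDerivAt (Icc_mem_nhds hτ'.1 hτ'.2)
      refine ((hd τ hτ').fun_div h1 (pow_ne_zero 2 (hr τ hτ''))).congr_deriv ?_
      have h2 := radius_sq_mul_lamb (haxi τ hτ''.1) (hu.differentiable hτ''.1) (X τ)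
      rw [div_eq_zero_iff]
      left
      linear_combination 2 * h2)
  rw [eq_comm, div_eq_zero_iff] at hc'
  rcases hc' with h | h
  · linarith
  · linarith

end Trajectory

variable (haxi : ∀ t, 0 ≤ t → IsAxisymmetricSwirlFree (u t))
  (hrefl : ∀ t, 0 ≤ t → reflField (u t) = u t)

include haxi hrefl

/-- Through every point off the axis and off the plane `z = 0`, at any time `t₀ ∈ [0,T]`, passes a
trajectory on `[0,T]` which changes `r²` and `z²` by bounded factors, does not cross `z = 0`, and
along which `ω_θ / r` has the same value at times `t` and `0`. -/
theorem exists_transport (T : ℝ) : ∃ c : ℝ, 0 < c ∧ ∀ t ∈ Icc 0 T, ∀ t₀ ∈ Icc 0 T,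
    ∀ x : R3, radius x ≠ 0 → x 2 ≠ 0 → ∃ X : ℝ → R3, X t₀ = x ∧
      (∀ s ∈ Icc 0 T, ∀ s' ∈ Icc 0 T, radius (X s) ^ 2 ≤ c * radius (X s') ^ 2 ∧
        X s 2 ^ 2 ≤ c * X s' 2 ^ 2 ∧ 0 < X s 2 * X s' 2) ∧
      impulse (u t) (X t) / radius (X t) ^ 2 = impulse (u 0) (X 0) / radius (X 0) ^ 2 := by
  obtain ⟨M, hM0, hM⟩ := hu.exists_bound T
  refine ⟨Real.exp (2 * M * T), Real.exp_pos _, fun t ht t₀ ht₀ x hxr hx2 => ?_⟩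
  obtain ⟨X, hX0, hX⟩ := hu.exists_trajectory ht₀ x
  have hrle := fun s hs s' hs' => hu.radius_sq_le haxi hX hM0.le hM (s := s) (t := s') hs hs'
  have hzle := fun s hs s' hs' => hu.height_sq_le hX hrefl hM0.le hM (s := s) (t := s') hs hs'
  have hr : ∀ s ∈ Icc 0 T, radius (X s) ≠ 0 := by
    intro s hs h
    have := hrle t₀ ht₀ s hs
    rw [h, hX0] at this
    simp at this
    exact hxr this
  have hz : ∀ s ∈ Icc 0 T, X s 2 ≠ 0 := by
    intro s hs h
    have := hzle t₀ ht₀ s hs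
    rw [h, hX0] at this
    simp at this
    exact hx2 this
  have hzc : ContinuousOn (fun s => X s 2) (Icc 0 T) := fun s hs =>
    (hasDerivWithinAt_coord hX 2 hs).continuousWithinAt
  refine ⟨X, hX0, fun s hs s' hs' => ⟨hrle s hs s' hs', hzle s hs s' hs', ?_⟩,
    hu.impulse_div_radius_sq_const haxi hX hr ht⟩
  -- the height is continuous and does not vanish, hence keeps its sign
  have hconn := (isPreconnected_Icc (a := (0 : ℝ)) (b := T)).image _ hzc
  rcases (hz s hs).lt_or_gt with h1 | h1 <;> rcases (hz s' hs').lt_or_gt with h2 | h2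
  · exact mul_pos_of_neg_of_neg h1 h2
  · have h0 : (0 : ℝ) ∈ Icc (X s 2) (X s' 2) := ⟨h1.le, h2.le⟩
    obtain ⟨c, hc, hc'⟩ := hconn.Icc_subset (mem_image_of_mem _ hs) (mem_image_of_mem _ hs') h0
    exact absurd hc' (hz c hc)
  · have h0 : (0 : ℝ) ∈ Icc (X s' 2) (X s 2) := ⟨h2.le, h1.le⟩
    obtain ⟨c, hc, hc'⟩ := hconn.Icc_subset (mem_image_of_mem _ hs') (mem_image_of_mem _ hs) h0
    exact absurd hc' (hz c hc)
  · exact mul_pos h1 h2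

end RegularSolution

theorem omegaTheta_axis {v : R3 → R3} (ha : IsAxisymmetricSwirlFree v) (hv : Differentiable ℝ v)
    (z : ℝ) : omegaTheta v 0 z = 0 := by
  have := curl_on_axis ha hv (x := !₂[0, 0, z]) (by simp) (by simp)
  rw [omegaTheta, this]; simp

theorem curl_eq_zero_of_omegaTheta {v : R3 → R3} (ha : IsAxisymmetricSwirlFree v)
    (hv : Differentiable ℝ v) (hr : reflField v = v)
    (h : ∀ r z : ℝ, 0 ≤ r → 0 ≤ z → omegaTheta v r z = 0) (x : R3) : curl v x = 0 := by
  rw [← norm_eq_zero, norm_curl ha hv, abs_eq_zero]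
  rcases le_total 0 (x 2) with hx | hx
  · exact h _ _ (radius_nonneg x) hx
  · rw [← neg_neg (x 2), omegaTheta_neg_of_reflField hv hr, h _ _ (radius_nonneg x) (by linarith),
      neg_zero]

theorem omegaTheta_eq_impulse {v : R3 → R3} (ha : IsAxisymmetricSwirlFree v)
    (hv : Differentiable ℝ v) {x : R3} (hx : radius x ≠ 0) :
    omegaTheta v (radius x) (x 2) = radius x * (impulse v x / radius x ^ 2) := by
  rw [impulse_eq ha hv]; field_simp

namespace RegularSolution

variable {u : ℝ → R3 → R3} (hu : RegularSolution u)

include hu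

/-- The support and sign properties of the initial vorticity persist: where the vorticity does not
vanish, a trajectory leads back to the initial support. -/
theorem oddVortex (haxi : ∀ t, 0 ≤ t → IsAxisymmetricSwirlFree (u t))
    (hne : ∃ t, 0 ≤ t ∧ ∃ x, u t x ≠ 0)
    (hodd : ∀ r z : ℝ, 0 ≤ r → omegaTheta (u 0) r (-z) = -omegaTheta (u 0) r z)
    (hcpt : IsCompact (vortSupport (u 0)))
    (haway : ∀ q ∈ vortSupport (u 0), q.1 ≠ 0 ∧ q.2 ≠ 0)
    (hsign : ∀ r z : ℝ, 0 ≤ r → 0 ≤ z → omegaTheta (u 0) r z ≤ 0) (T : ℝ) :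
    ∃ a ρ : ℝ, ∀ t ∈ Icc 0 T, OddVortex (u t) a ρ := by
  have hrefl : ∀ t, 0 ≤ t → reflField (u t) = u t := fun t ht =>
    hu.reflField_eq (haxi 0 le_rfl) hodd ht
  have hdiff : ∀ t, 0 ≤ t → Differentiable ℝ (u t) := fun t ht => hu.differentiable ht
  -- the initial support is bounded and bounded away from the axis and the plane
  obtain ⟨a₀, ρ₀, ha₀, hρ₀⟩ : ∃ a₀ ρ₀ : ℝ, 0 < a₀ ∧ ∀ q ∈ vortSupport (u 0),
      a₀ ≤ |q.1| ∧ a₀ ≤ |q.2| ∧ |q.1| ≤ ρ₀ ∧ |q.2| ≤ ρ₀ := by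
    obtain ⟨ρ, hρ⟩ := hcpt.isBounded.exists_norm_le
    rcases (vortSupport (u 0)).eq_empty_or_nonempty with he | hne'
    · exact ⟨1, 1, one_pos, by simp [he]⟩
    obtain ⟨q, hq, hmin⟩ := hcpt.exists_isMinOn hne'
      (f := fun q : ℝ × ℝ => min |q.1| |q.2|) (Continuous.continuousOn (by fun_prop))
    refine ⟨min |q.1| |q.2|, ρ, lt_min (abs_pos.2 (haway q hq).1) (abs_pos.2 (haway q hq).2),
      fun p hp => ?_⟩
    have h1 : min |q.1| |q.2| ≤ min |p.1| |p.2| := hmin hp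
    have h2 := hρ p hp
    exact ⟨h1.trans (min_le_left _ _), h1.trans (min_le_right _ _),
      (norm_fst_le p).trans h2, (norm_snd_le p).trans h2⟩
  have hz0 : ∀ t, 0 ≤ t → ∀ r, omegaTheta (u t) r 0 = 0 := by
    intro t ht r
    have := omegaTheta_neg_of_reflField (hdiff t ht) (hrefl t ht) r 0
    rw [neg_zero] at this
    linarith
  -- backward transport of a point of the support
  have hback : ∀ S : ℝ, 0 ≤ S → ∃ c : ℝ, 0 < c ∧ ∀ t ∈ Icc 0 S, ∀ r z : ℝ, 0 ≤ r →
      omegaTheta (u t) r z ≠ 0 → ∃ r₀ z₀ : ℝ, 0 < r₀ ∧ omegaTheta (u 0) r₀ z₀ ≠ 0 ∧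
        0 < omegaTheta (u 0) r₀ z₀ * omegaTheta (u t) r z ∧ 0 < z₀ * z ∧
        r₀ ^ 2 ≤ c * r ^ 2 ∧ r ^ 2 ≤ c * r₀ ^ 2 ∧ z₀ ^ 2 ≤ c * z ^ 2 ∧ z ^ 2 ≤ c * z₀ ^ 2 := by
    intro S hS
    obtain ⟨c, hc, htr⟩ := hu.exists_transport haxi hrefl S
    refine ⟨c, hc, fun t ht r z hr hω => ?_⟩
    have hr0 : r ≠ 0 := by
      rintro rfl; exact hω (omegaTheta_axis (haxi t ht.1) (hdiff t ht.1) z)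
    have hz : z ≠ 0 := by
      rintro rfl; exact hω (hz0 t ht.1 r)
    have hrx := radius_vec r z hr
    obtain ⟨X, hX, hb, hconst⟩ := htr t ht t ht !₂[r, 0, z] (by rwa [hrx]) (by simpa using hz)
    have h0S : (0 : ℝ) ∈ Icc 0 S := ⟨le_rfl, hS⟩
    obtain ⟨b1, b2, b3⟩ := hb 0 h0S t ht
    obtain ⟨b4, b5, -⟩ := hb t ht 0 h0S
    rw [hX, hrx] at b1 b4 hconst
    rw [hX] at b2 b3 b5
    simp only [Matrix.cons_val] at b2 b3 b5
    have hr₀ : radius (X 0) ≠ 0 := by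
      intro h; rw [h] at b4
      have : 0 < r ^ 2 := by positivity
      simp at b4; exact hr0 b4
    have hr₀' : 0 < radius (X 0) := lt_of_le_of_ne (radius_nonneg _) (Ne.symm hr₀)
    have e0 := omegaTheta_eq_impulse (haxi 0 le_rfl) (hdiff 0 le_rfl) hr₀
    have et := omegaTheta_eq_impulse (haxi t ht.1) (hdiff t ht.1) (x := !₂[r, 0, z])
      (by rwa [hrx])
    rw [hrx] at et
    simp only [Matrix.cons_val] at et
    rw [← hconst] at e0
    set α := impulse (u t) !₂[r, 0, z] / r ^ 2 with hα
    have hα0 : α ≠ 0 := by rintro h; exact hω (by rw [et, h, mul_zero])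
    have hrpos : 0 < r := lt_of_le_of_ne hr (Ne.symm hr0)
    refine ⟨radius (X 0), X 0 2, hr₀', ?_, ?_, b3, b1, b4, b2, b5⟩
    · rw [e0]; exact mul_ne_zero hr₀ hα0
    · rw [e0, et]
      have : 0 < α ^ 2 := by positivity
      calc (0 : ℝ) < radius (X 0) * r * α ^ 2 := by positivity
        _ = _ := by ring
  -- the initial vorticity does not vanish identically
  have hne0 : ∃ r z : ℝ, 0 ≤ r ∧ 0 ≤ z ∧ omegaTheta (u 0) r z ≠ 0 := by
    by_contra! hcon
    obtain ⟨t, ht, x, hx⟩ := hne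
    refine hx (eq_zero_of_curl_divergence (hu.contDiff t ht) (hu.memLp t ht) (hu.div_eq_zero t ht)
      (curl_eq_zero_of_omegaTheta (haxi t ht) (hdiff t ht) (hrefl t ht) fun r z hr hz => ?_) x)
    by_contra hω
    obtain ⟨c, -, hb⟩ := hback t ht
    obtain ⟨r₀, z₀, hr₀, hω₀, -⟩ := hb t ⟨ht, le_rfl⟩ r z hr hω
    rcases le_total 0 z₀ with h | h
    · exact hω₀ (hcon r₀ z₀ hr₀.le h)
    · refine hω₀ ?_
      rw [← neg_neg z₀, hodd r₀ _ hr₀.le, hcon r₀ _ hr₀.le (by linarith), neg_zero]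
  rcases lt_or_ge T 0 with hT | hT
  · exact ⟨0, 0, fun t ht => absurd (ht.1.trans ht.2) (by linarith)⟩
  obtain ⟨c, hc, hb⟩ := hback T hT
  refine ⟨a₀ / Real.sqrt c, Real.sqrt c * ρ₀, fun t ht => ⟨hu.contDiff t ht.1, hu.memLp t ht.1,
    hu.div_eq_zero t ht.1, haxi t ht.1, hrefl t ht.1,
    (hu.bounded t ht.1).imp fun M hM x => (hM x).1, by positivity, fun r z hr hω => ?_,
    fun r z hr hz => ?_, ?_⟩⟩
  · obtain ⟨r₀, z₀, hr₀, hω₀, -, -, b1, b2, b3, b4⟩ := hb t ht r z hr hω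
    obtain ⟨c1, c2, c3, c4⟩ := hρ₀ (r₀, z₀) (subset_closure ⟨hr₀.le, hω₀⟩)
    simp only at c1 c2 c3 c4
    have hcs : 0 < Real.sqrt c := by positivity
    have hcc : Real.sqrt c ^ 2 = c := Real.sq_sqrt hc.le
    have hlow : ∀ p q : ℝ, a₀ ≤ |p| → p ^ 2 ≤ c * q ^ 2 → a₀ / Real.sqrt c ≤ |q| := by
      intro p q hp hpq
      rw [div_le_iff₀ hcs]
      refine hp.trans (abs_le_of_sq_le_sq ?_ (by positivity))
      rw [mul_pow, sq_abs, hcc]; linarith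
    have hupp : ∀ p q : ℝ, |p| ≤ ρ₀ → q ^ 2 ≤ c * p ^ 2 → |q| ≤ Real.sqrt c * ρ₀ := by
      intro p q hp hpq
      refine le_trans (abs_le_of_sq_le_sq ?_ (by positivity) : |q| ≤ Real.sqrt c * |p|) (by gcongr)
      rw [mul_pow, sq_abs, hcc]; linarith
    have hrr : |r| = r := abs_of_nonneg hr
    refine ⟨hrr ▸ hlow r₀ r c1 b1, hlow z₀ z c2 b3, hrr ▸ hupp r₀ r c3 b2, hupp z₀ z c4 b4⟩
  · by_contra hω
    rw [not_le] at hω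
    obtain ⟨r₀, z₀, hr₀, hω₀, hs, hzz, -⟩ := hb t ht r z hr hω.ne'
    have h1 : 0 < omegaTheta (u 0) r₀ z₀ := pos_of_mul_pos_left hs hω.le
    have h2 : 0 < z₀ := pos_of_mul_pos_left hzz hz
    linarith [hsign r₀ z₀ hr₀.le h2.le]
  -- forward transport of a point of the initial support
  · obtain ⟨r, z, hr, hz, hω⟩ := hne0
    have hr0 : r ≠ 0 := by
      rintro rfl; exact hω (omegaTheta_axis (haxi 0 le_rfl) (hdiff 0 le_rfl) z)
    have hz' : z ≠ 0 := by
      rintro rfl; exact hω (hz0 0 le_rfl r)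
    have hrx := radius_vec r z hr
    obtain ⟨c', hc', htr⟩ := hu.exists_transport haxi hrefl T
    have h0T : (0 : ℝ) ∈ Icc 0 T := ⟨le_rfl, hT⟩
    obtain ⟨X, hX, hb', hconst⟩ := htr t ht 0 h0T !₂[r, 0, z] (by rwa [hrx]) (by simpa using hz')
    obtain ⟨b1, b2, b3⟩ := hb' 0 h0T t ht
    rw [hX, hrx] at b1 hconst
    rw [hX] at b3
    simp only [Matrix.cons_val] at b3
    have hrt : radius (X t) ≠ 0 := by
      intro h; rw [h] at b1
      simp at b1; exact hr0 b1
    have et := omegaTheta_eq_impulse (haxi t ht.1) (hdiff t ht.1) hrt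
    have e0 := omegaTheta_eq_impulse (haxi 0 le_rfl) (hdiff 0 le_rfl) (x := !₂[r, 0, z])
      (by rwa [hrx])
    rw [hrx] at e0
    simp only [Matrix.cons_val] at e0
    rw [hconst] at et
    refine ⟨radius (X t), X t 2, radius_nonneg _, (pos_of_mul_pos_right b3 hz).le, ?_⟩
    rw [et]
    refine mul_ne_zero hrt fun h => hω ?_
    rw [e0, h, mul_zero]

end RegularSolution



/-! ### A regularized Biot–Savart law -/

/-- The density `3 (1 + |y|²)^(-5/2)`, of total mass `4π`: the divergence of the field
`y (1 + |y|²)^(-3/2)`. -/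
def plummer (y : R3) : ℝ := 3 * (1 + ‖y‖ ^ 2) ^ (-(5 : ℝ) / 2)

theorem one_add_norm_sq_pos (y : R3) : 0 < 1 + ‖y‖ ^ 2 := by positivity

theorem continuous_one_add_norm_sq_rpow (c : ℝ) : Continuous fun y : R3 => (1 + ‖y‖ ^ 2) ^ c :=
  Continuous.rpow_const (by fun_prop) fun y => Or.inl (one_add_norm_sq_pos y).ne'

theorem continuous_plummer : Continuous plummer :=
  continuous_const.mul (continuous_one_add_norm_sq_rpow _)

theorem plummer_nonneg (y : R3) : 0 ≤ plummer y := by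
  unfold plummer; positivity

theorem integrable_plummer : Integrable plummer := by
  have := integrable_rpow_neg_one_add_norm_sq (E := R3) (μ := volume) (r := 5) (by simp; norm_num)
  exact this.const_mul 3

theorem integral_plummer : ∫ y, plummer y = 4 * Real.pi := by
  have h1 := integral_fun_norm_addHaar (volume : Measure R3)
    (fun r : ℝ => 3 * (1 + r ^ 2) ^ (-(5 : ℝ) / 2))
  have hpos : ∀ r : ℝ, 0 < 1 + r ^ 2 := fun r => by positivity
  have hderiv : ∀ r ∈ Ici (0 : ℝ), HasDerivAt (fun r : ℝ => r ^ 3 * (1 + r ^ 2) ^ (-(3 : ℝ) / 2))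
      (r ^ 2 * (3 * (1 + r ^ 2) ^ (-(5 : ℝ) / 2))) r := by
    intro r _
    have h2 : HasDerivAt (fun r : ℝ => 1 + r ^ 2) (2 * r) r := by
      simpa using ((hasDerivAt_pow 2 r).const_add 1)
    have h3 := (hasDerivAt_pow 3 r).fun_mul (h2.rpow_const (p := -(3 : ℝ) / 2)
      (Or.inl (hpos r).ne'))
    refine h3.congr_deriv ?_
    have h4 : (1 + r ^ 2) ^ (-(3 : ℝ) / 2) = (1 + r ^ 2) * (1 + r ^ 2) ^ (-(5 : ℝ) / 2) := by
      rw [← Real.rpow_one_add' (hpos r).le (by norm_num)]; norm_num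
    have h5 : -(3 : ℝ) / 2 - 1 = -5 / 2 := by norm_num
    rw [h4, h5]
    push_cast
    ring
  have hlim : Tendsto (fun r : ℝ => r ^ 3 * (1 + r ^ 2) ^ (-(3 : ℝ) / 2)) atTop (𝓝 1) := by
    have h2 : Tendsto (fun r : ℝ => (1 - (1 + r ^ 2)⁻¹) ^ ((3 : ℝ) / 2)) atTop
        (𝓝 ((1 - 0) ^ ((3 : ℝ) / 2))) := by
      have : Tendsto (fun r : ℝ => 1 + r ^ 2) atTop atTop :=
        tendsto_atTop_add_const_left _ _ (tendsto_pow_atTop two_ne_zero)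
      exact ((tendsto_inv_atTop_zero.comp this).const_sub 1).rpow_const (Or.inl (by norm_num))
    simp only [sub_zero, Real.one_rpow] at h2
    refine h2.congr' ?_
    filter_upwards [eventually_gt_atTop 0] with r hr
    have h3 : 1 - (1 + r ^ 2)⁻¹ = r ^ 2 * (1 + r ^ 2)⁻¹ := by
      have := (hpos r).ne'
      field_simp; ring
    have h4 : (r ^ 2 : ℝ) ^ ((3 : ℝ) / 2) = r ^ 3 := by
      rw [← Real.rpow_natCast, ← Real.rpow_mul hr.le, ← Real.rpow_natCast]; norm_num
    rw [h3, Real.mul_rpow (by positivity) (inv_nonneg.2 (hpos r).le), h4,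
      Real.inv_rpow (hpos r).le, ← Real.rpow_neg (hpos r).le, neg_div]
  have h2 := integral_Ioi_of_hasDerivAt_of_nonneg' hderiv
    (fun r _ => by have := (hpos r).le; positivity) hlim
  have h3 : ∫ y, plummer y = _ := h1
  rw [h3]
  simp only [finrank_euclideanSpace, Fintype.card_fin, smul_eq_mul, Measure.real,
    EuclideanSpace.volume_ball_fin_three]
  rw [show (3 - 1 : ℕ) = 2 from rfl, h2]
  simp
  rw [ENNReal.toReal_ofReal (by positivity)]
  ring

/-- The components of the field `y (1 + |y|²)^(-3/2)`, a regularization of `y / |y|³`. -/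
def regKernel (j : Fin 3) (y : R3) : ℝ := y j * (1 + ‖y‖ ^ 2) ^ (-(3 : ℝ) / 2)

theorem contDiff_regKernel (j : Fin 3) : ContDiff ℝ 1 (regKernel j) :=
  (contDiff_coord j).mul ((contDiff_const.add (contDiff_norm_sq ℝ)).rpow_const_of_ne
    fun y => (one_add_norm_sq_pos y).ne')

theorem fderiv_regKernel (i j : Fin 3) (y : R3) : fderiv ℝ (regKernel j) y (e i) =
    (if i = j then (1 + ‖y‖ ^ 2) ^ (-(3 : ℝ) / 2) else 0) - y i * y j * plummer y := by
  have h1 : HasFDerivAt (fun y : R3 => 1 + ‖y‖ ^ 2) (2 • innerSL ℝ y) y :=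
    (hasStrictFDerivAt_norm_sq y).hasFDerivAt.const_add 1
  have h2 := h1.rpow_const (p := -(3 : ℝ) / 2) (Or.inl (one_add_norm_sq_pos y).ne')
  have h3 : HasFDerivAt (fun y : R3 => y j) (EuclideanSpace.proj j : R3 →L[ℝ] ℝ) y :=
    (EuclideanSpace.proj j : R3 →L[ℝ] ℝ).hasFDerivAt
  have h4 : fderiv ℝ (regKernel j) y = _ := (h3.fun_mul h2).fderiv
  have h5 : -(3 : ℝ) / 2 - 1 = -5 / 2 := by norm_num
  have h6 : inner ℝ y (e i) = y i := by simp [EuclideanSpace.inner_single_right]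
  rw [h4, h5]
  simp only [_root_.add_apply, _root_.smul_apply, innerSL_apply_apply, h6, smul_eq_mul, plummer]
  rcases eq_or_ne i j with rfl | hij
  · simp; ring
  · simp [hij, Ne.symm hij]; ring

theorem memLp_regKernel (j : Fin 3) : MemLp (regKernel j) 2 (volume : Measure R3) := by
  have hc : Continuous (regKernel j) := (contDiff_regKernel j).continuous
  rw [memLp_two_iff_integrable_sq hc.aestronglyMeasurable]
  have h4 := integrable_rpow_neg_one_add_norm_sq (E := R3) (μ := volume) (r := 4)
    (by simp; norm_num)
  refine h4.mono' (hc.pow 2).aestronglyMeasurable (Eventually.of_forall fun y => ?_)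
  have hp := one_add_norm_sq_pos y
  have h1 : ((1 + ‖y‖ ^ 2) ^ (-(3 : ℝ) / 2)) ^ 2 * (1 + ‖y‖ ^ 2) =
      (1 + ‖y‖ ^ 2) ^ (-(4 : ℝ) / 2) := by
    rw [← Real.rpow_natCast, ← Real.rpow_mul hp.le, ← Real.rpow_add_one hp.ne']
    norm_num
  have h2 : y j ^ 2 ≤ 1 + ‖y‖ ^ 2 := by
    rw [norm_sq_vec3]
    fin_cases j <;> simp <;> nlinarith [sq_nonneg (y 0), sq_nonneg (y 1), sq_nonneg (y 2)]
  rw [Real.norm_of_nonneg (sq_nonneg _), ← h1, regKernel, mul_pow, mul_comm]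
  gcongr

/-- The Biot–Savart law at unit scale, centred at the origin. With `k` the regularized kernel, it
is the divergence theorem for the field with components `k_j w_i + w_j k_i - δ_ij (k · w)`. -/
theorem integral_plummer_mul {w : R3 → R3} (hw : ContDiff ℝ 1 w)
    (hm : MemLp w 2 (volume : Measure R3)) (hd : ∀ x, divergence w x = 0) {M : ℝ}
    (hM : ∀ x, ‖w x‖ ≤ M) (hcs : HasCompactSupport (curl w)) (i : Fin 3) :
    ∫ y, plummer y * w y i =
      -∫ y, ∑ j, regKernel j y * (pderiv w j i y - pderiv w i j y) := by
  have hwd : Differentiable ℝ w := hw.differentiable (by simp)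
  have hcd : ∀ i, Differentiable ℝ fun y => w y i := fun i =>
    (contDiff_comp hw i).differentiable (by simp)
  have hkd : ∀ i, Differentiable ℝ (regKernel i) := fun i =>
    (contDiff_regKernel i).differentiable (by simp)
  -- as `∂_j k_i` is symmetric, the divergence of this field contains no derivative of `k` other
  -- than `div k`
  let f : Fin 3 → R3 → ℝ := fun j y => regKernel j y * w y i + w y j * regKernel i y -
    if j = i then ∑ l, regKernel l y * w y l else 0
  have hf : ∀ j, ContDiff ℝ 1 (f j) := by
    intro j
    refine (((contDiff_regKernel j).mul (contDiff_comp hw i)).add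
      ((contDiff_comp hw j).mul (contDiff_regKernel i))).sub ?_
    split_ifs
    · exact ContDiff.sum fun l _ => (contDiff_regKernel l).mul (contDiff_comp hw l)
    · exact contDiff_const
  have hint : ∀ j l, Integrable fun y => regKernel j y * w y l := fun j l =>
    (memLp_regKernel j).integrable_mul (memLp_comp hm l)
  have hfi : ∀ j, Integrable (f j) := by
    intro j
    refine ((hint j i).add ((hint i j).congr (Eventually.of_forall fun y => mul_comm _ _))).sub ?_
    split_ifs
    · exact integrable_finsetSum _ fun l _ => hint l l
    · exact integrable_zero _ _ _
  have hdiv : ∀ y, ∑ j, fderiv ℝ (f j) y (e j) =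
      plummer y * w y i + ∑ j, regKernel j y * (pderiv w j i y - pderiv w i j y) := by
    intro y
    have hsum : ∀ v, fderiv ℝ (fun y => ∑ l, regKernel l y * w y l) y v =
        ∑ l, (regKernel l y * fderiv ℝ (fun y => w y l) y v +
          w y l * fderiv ℝ (regKernel l) y v) := by
      intro v
      rw [fderiv_fun_sum fun l _ => (hkd l y).fun_mul (hcd l y)]
      simp [fderiv_mul_e (hkd _) (hcd _)]
    have hfj : ∀ j, fderiv ℝ (f j) y (e j) =
        regKernel j y * pderiv w j i y + w y i * fderiv ℝ (regKernel j) y (e j) +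
        (w y j * fderiv ℝ (regKernel i) y (e j) + regKernel i y * pderiv w j j y) -
        if j = i then ∑ l, (regKernel l y * pderiv w i l y +
          w y l * fderiv ℝ (regKernel l) y (e i)) else 0 := by
      intro j
      have h1 : DifferentiableAt ℝ (fun y => regKernel j y * w y i + w y j * regKernel i y) y :=
        ((hkd j y).fun_mul (hcd i y)).fun_add ((hcd j y).fun_mul (hkd i y))
      have h2 : DifferentiableAt ℝ
          (fun y => if j = i then ∑ l, regKernel l y * w y l else 0) y := by
        split_ifs
        · exact DifferentiableAt.fun_sum fun l _ => (hkd l y).fun_mul (hcd l y)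
        · exact differentiableAt_const _
      change fderiv ℝ (fun y => (regKernel j y * w y i + w y j * regKernel i y) -
        if j = i then ∑ l, regKernel l y * w y l else 0) y (e j) = _
      rw [fderiv_fun_sub h1 h2, fderiv_fun_add ((hkd j y).fun_mul (hcd i y))
        ((hcd j y).fun_mul (hkd i y)), _root_.sub_apply, _root_.add_apply,
        fderiv_mul_e (hkd j) (hcd i), fderiv_mul_e (hcd j) (hkd i), pderiv_eq (hwd y),
        pderiv_eq (hwd y)]
      congr 1
      split_ifs with hji
      · rw [hsum, hji]; simp only [pderiv_eq (hwd y)]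
      · simp
    have hdy := hd y
    rw [divergence, Fin.sum_univ_three] at hdy
    have hp := one_add_norm_sq_pos y
    have h35 : 3 * (1 + ‖y‖ ^ 2) ^ (-(3 : ℝ) / 2) = (1 + ‖y‖ ^ 2) * plummer y := by
      rw [plummer, mul_left_comm, ← Real.rpow_one_add' hp.le (by norm_num)]; norm_num
    rw [norm_sq_vec3] at h35
    simp only [hfj, fderiv_regKernel, Fin.sum_univ_three, norm_sq_vec3]
    fin_cases i <;> simp
    · linear_combination (w y 0) * h35 + (regKernel 0 y) * hdy
    · linear_combination (w y 1) * h35 + (regKernel 1 y) * hdy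
    · linear_combination (w y 2) * h35 + (regKernel 2 y) * hdy
  have hsumc : Continuous fun y => ∑ j, regKernel j y * (pderiv w j i y - pderiv w i j y) :=
    continuous_finsetSum _ fun j _ => (contDiff_regKernel j).continuous.mul
      ((continuous_pderiv hw j i).sub (continuous_pderiv hw i j))
  have hi1 : Integrable fun y => plummer y * w y i := by
    refine (integrable_plummer.mul_const M).mono'
      (continuous_plummer.mul (contDiff_comp hw i).continuous).aestronglyMeasurable
      (Eventually.of_forall fun y => ?_)
    rw [norm_mul, Real.norm_of_nonneg (plummer_nonneg y)]
    exact mul_le_mul_of_nonneg_left ((PiLp.norm_apply_le (w y) i).trans (hM y)) (plummer_nonneg y)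
  have hi2 : Integrable fun y => ∑ j, regKernel j y * (pderiv w j i y - pderiv w i j y) := by
    refine hsumc.integrable_of_hasCompactSupport (HasCompactSupport.intro hcs fun y hy => ?_)
    have h0 : curl w y = 0 := image_eq_zero_of_notMem_tsupport hy
    have c0 := congrArg (fun a : R3 => a 0) h0
    have c1 := congrArg (fun a : R3 => a 1) h0
    have c2 := congrArg (fun a : R3 => a 2) h0
    simp [curl] at c0 c1 c2
    refine Finset.sum_eq_zero fun j _ => ?_
    have : pderiv w j i y - pderiv w i j y = 0 := by
      fin_cases i <;> fin_cases j <;> simp <;> linarith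
    rw [this, mul_zero]
  have key := integral_div_eq_zero hf hfi (by simp_rw [hdiv]; exact hi1.add hi2)
  simp_rw [hdiv] at key
  rw [integral_add hi1 hi2] at key
  linarith

/-- The vertical component of the regularization `z (ε² + |z|²)^(-3/2)` of `z / |z|³`. -/
def vertKernel (ε : ℝ) (z : R3) : ℝ := z 2 * (ε ^ 2 + ‖z‖ ^ 2) ^ (-(3 : ℝ) / 2)

theorem vertKernel_neg (ε : ℝ) (z : R3) : vertKernel ε (-z) = -vertKernel ε z := by
  simp [vertKernel]

theorem continuous_vertKernel {ε : ℝ} (hε : 0 < ε) : Continuous (vertKernel ε) := by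
  refine (contDiff_coord 2 (n := 1)).continuous.mul
    (Continuous.rpow_const (by fun_prop) fun z => ?_)
  left; positivity

theorem vertKernel_smul {ε : ℝ} (hε : 0 < ε) (y : R3) :
    vertKernel ε (ε • y) = (ε ^ 2)⁻¹ * regKernel 2 y := by
  have h1 : ε ^ 2 + ‖ε • y‖ ^ 2 = ε ^ 2 * (1 + ‖y‖ ^ 2) := by
    rw [norm_smul, Real.norm_of_nonneg hε.le]; ring
  have h2 : (ε ^ 2 : ℝ) ^ (-(3 : ℝ) / 2) = (ε ^ 3)⁻¹ := by
    rw [← Real.rpow_natCast, ← Real.rpow_mul hε.le, ← Real.rpow_natCast, ← Real.rpow_neg hε.le]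
    norm_num
  rw [vertKernel, h1, Real.mul_rpow (by positivity) (by positivity), h2, regKernel]
  simp
  field_simp

theorem integral_vertKernel_mul {ε : ℝ} (hε : 0 < ε) (h : R3 → ℝ) (x : R3) :
    ∫ y, vertKernel ε (x - y) * h y = -(ε * ∫ y, regKernel 2 y * h (x + ε • y)) := by
  have h1 : ∫ y, vertKernel ε (x - y) * h y = ∫ z, -vertKernel ε z * h (x + z) := by
    rw [← integral_add_left_eq_self _ x]
    refine integral_congr_ae (Eventually.of_forall fun z => ?_)
    simp only
    rw [← vertKernel_neg]; congr 2; abel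
  have h2 := Measure.integral_comp_smul (volume : Measure R3)
    (fun z => -vertKernel ε z * h (x + z)) ε
  have h3 : ∀ y, -vertKernel ε (ε • y) * h (x + ε • y) =
      -(ε ^ 2)⁻¹ * (regKernel 2 y * h (x + ε • y)) := by
    intro y; rw [vertKernel_smul hε]; ring
  simp only [h3] at h2
  rw [integral_const_mul, finrank_euclideanSpace, Fintype.card_fin, abs_of_pos (by positivity),
    smul_eq_mul] at h2
  rw [h1]
  have h4 : (ε ^ 3)⁻¹ * (ε ^ 3) = 1 := by field_simp
  calc _ = ε ^ 3 * ((ε ^ 3)⁻¹ * ∫ z, -vertKernel ε z * h (x + z)) := by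
        rw [← mul_assoc, mul_comm (ε ^ 3), h4, one_mul]
    _ = _ := by rw [← h2]; field_simp

/-- The Biot–Savart law for the horizontal velocity, mollified at scale `ε`, when the vorticity is
horizontal. -/
theorem biotSavart_horizontal {v : R3 → R3} (hv : ContDiff ℝ 1 v)
    (hm : MemLp v 2 (volume : Measure R3)) (hd : ∀ x, divergence v x = 0) {M : ℝ}
    (hM : ∀ x, ‖v x‖ ≤ M) (hcs : HasCompactSupport (curl v)) (h2 : ∀ x, curl v x 2 = 0)
    {ε : ℝ} (hε : 0 < ε) (x : R3) :
    ∫ y, plummer y * v (x + ε • y) 0 = ∫ y, vertKernel ε (x - y) * curl v y 1 ∧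
    ∫ y, plummer y * v (x + ε • y) 1 = -∫ y, vertKernel ε (x - y) * curl v y 0 := by
  set w : R3 → R3 := fun y => v (x + ε • y) with hw
  have hvd : Differentiable ℝ v := hv.differentiable (by simp)
  have hwc : ContDiff ℝ 1 w := hv.comp (contDiff_const.add (contDiff_const_smul ε))
  have hp : ∀ i j y, pderiv w i j y = ε * pderiv v i j (x + ε • y) := by
    intro i j y
    have h1 : HasFDerivAt (fun y : R3 => x + ε • y) (ε • ContinuousLinearMap.id ℝ R3) y :=
      (ε • ContinuousLinearMap.id ℝ R3).hasFDerivAt.const_add x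
    have h3 : fderiv ℝ w y = _ := ((hvd (x + ε • y)).hasFDerivAt.comp y h1).fderiv
    rw [pderiv, h3]
    simp [pderiv]
  have hmeas : MemLp w 2 (volume : Measure R3) := by
    have h1 : MemLp (fun y => v (x + y)) 2 (volume : Measure R3) :=
      hm.comp_measurePreserving (measurePreserving_add_left volume x)
    rw [memLp_two_iff_integrable_sq_norm hwc.continuous.aestronglyMeasurable]
    have h3 : Continuous fun y => v (x + y) := hv.continuous.comp (by fun_prop)
    rw [memLp_two_iff_integrable_sq_norm h3.aestronglyMeasurable] at h1
    exact h1.comp_smul hε.ne'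
  have hcurl : ∀ y, curl w y = ε • curl v (x + ε • y) := by
    intro y
    apply vec3_ext <;> simp [curl, hp] <;> ring
  have hcsw : HasCompactSupport (curl w) := by
    have h1 : HasCompactSupport fun y => curl v (x + ε • y) :=
      hcs.comp_homeomorph ((Homeomorph.smulOfNeZero ε hε.ne').trans (Homeomorph.addLeft x))
    refine h1.mono fun y hy => ?_
    rw [Function.mem_support] at hy ⊢
    exact fun h => hy (by rw [hcurl, h, smul_zero])
  have hdw : ∀ y, divergence w y = 0 := by
    intro y
    have := hd (x + ε • y)
    simp only [divergence, hp] at this ⊢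
    rw [← Finset.mul_sum, this, mul_zero]
  have key := integral_plummer_mul hwc hmeas hdw (fun y => hM _) hcsw
  have hc2 : ∀ y, pderiv v 0 1 (x + ε • y) - pderiv v 1 0 (x + ε • y) = 0 := by
    intro y; simpa [curl] using h2 (x + ε • y)
  constructor
  · have k0 := key 0
    rw [integral_vertKernel_mul hε]
    rw [k0, ← integral_const_mul]
    congr 1
    refine integral_congr_ae (Eventually.of_forall fun y => ?_)
    have := hc2 y
    simp [Fin.sum_univ_three, hp, curl]
    linear_combination (-(ε * regKernel 1 y)) * this
  · have k1 := key 1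
    rw [integral_vertKernel_mul hε, neg_neg]
    rw [k1, ← integral_const_mul, ← integral_neg]
    refine integral_congr_ae (Eventually.of_forall fun y => ?_)
    have := hc2 y
    simp [Fin.sum_univ_three, hp, curl]
    linear_combination (-(ε * regKernel 0 y)) * this



/-! ### The interaction energy of the two half spaces -/

/-- The limit of mollification by the rescaled density `plummer`. -/
theorem tendsto_integral_plummer {f : R3 → ℝ} (hf : Continuous f) {M : ℝ} (hM : ∀ x, |f x| ≤ M)
    (x : R3) : Tendsto (fun ε : ℝ => ∫ y, plummer y * f (x + ε • y)) (𝓝[>] 0)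
      (𝓝 (4 * Real.pi * f x)) := by
  have h : Tendsto (fun ε : ℝ => ∫ y, plummer y * f (x + ε • y)) (𝓝[>] 0)
      (𝓝 (∫ y, plummer y * f x)) := by
    refine tendsto_integral_filter_of_dominated_convergence (fun y => plummer y * M)
      (Eventually.of_forall fun ε => ?_) (Eventually.of_forall fun ε =>
        Eventually.of_forall fun y => ?_) (integrable_plummer.mul_const M)
      (Eventually.of_forall fun y => ?_)
    · have : Continuous fun y : R3 => f (x + ε • y) := hf.comp (by fun_prop)
      exact (continuous_plummer.mul this).aestronglyMeasurable
    · rw [norm_mul, Real.norm_of_nonneg (plummer_nonneg y), Real.norm_eq_abs]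
      exact mul_le_mul_of_nonneg_left (hM _) (plummer_nonneg y)
    · have h1 : Continuous fun ε : ℝ => plummer y * f (x + ε • y) :=
        continuous_const.mul (hf.comp (by fun_prop))
      have h2 := h1.tendsto 0
      simp only [zero_smul, add_zero] at h2
      exact h2.mono_left nhdsWithin_le_nhds
  rwa [integral_mul_const, integral_plummer] at h

theorem abs_vertKernel_le {ε d : ℝ} (hd : 0 < d) {z : R3} (hz : d ≤ z 2) :
    |vertKernel ε z| ≤ (d ^ 2)⁻¹ := by
  have hz0 : 0 < z 2 := hd.trans_le hz
  have h1 : z 2 ^ 2 ≤ ε ^ 2 + ‖z‖ ^ 2 := by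
    rw [norm_sq_vec3]; nlinarith [sq_nonneg (z 0), sq_nonneg (z 1), sq_nonneg ε]
  have h2 : (ε ^ 2 + ‖z‖ ^ 2) ^ (-(3 : ℝ) / 2) ≤ (z 2 ^ 3)⁻¹ := by
    have h3 : (z 2 ^ 2 : ℝ) ^ (-(3 : ℝ) / 2) = (z 2 ^ 3)⁻¹ := by
      rw [← Real.rpow_natCast, ← Real.rpow_mul hz0.le, ← Real.rpow_natCast,
        ← Real.rpow_neg hz0.le]
      norm_num
    rw [← h3]
    exact Real.rpow_le_rpow_of_nonpos (by positivity) h1 (by norm_num)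
  rw [vertKernel, abs_mul, abs_of_pos hz0, abs_of_nonneg (by positivity)]
  calc z 2 * (ε ^ 2 + ‖z‖ ^ 2) ^ (-(3 : ℝ) / 2) ≤ z 2 * (z 2 ^ 3)⁻¹ := by gcongr
    _ = (z 2 ^ 2)⁻¹ := by field_simp
    _ ≤ (d ^ 2)⁻¹ := by gcongr

theorem measurable_vertKernel (ε : ℝ) : Measurable (vertKernel ε) := by
  unfold vertKernel
  exact (contDiff_coord 2 (n := 1)).continuous.measurable.mul
    ((measurable_const.add (measurable_norm.pow_const 2)).pow_const _)

section HalfSpace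

variable {g : R3 → ℝ} (hg : Continuous g) (hgc : HasCompactSupport g) {a : ℝ} (ha : 0 < a)
  (hga : ∀ x : R3, x 2 < a → g x = 0)

include hg hgc

theorem integrable_prod_mul_self :
    Integrable fun p : R3 × R3 => g p.1 * g p.2 := by
  have hi := hg.integrable_of_hasCompactSupport (μ := volume) hgc
  exact hi.mul_prod hi

include ha hga

omit hg hgc in
/-- The kernel is bounded on pairs of points at height at least `a`, one of them reflected. -/
theorem norm_vertKernel_mul_le (ε : ℝ) (p : R3 × R3) :
    ‖vertKernel ε (p.1 - refl p.2) * (g p.1 * g p.2)‖ ≤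
      ((2 * a) ^ 2)⁻¹ * ‖g p.1 * g p.2‖ := by
  by_cases h1 : p.1 2 < a
  · simp [hga _ h1]
  by_cases h2 : p.2 2 < a
  · simp [hga _ h2]
  rw [norm_mul]
  refine mul_le_mul_of_nonneg_right ?_ (norm_nonneg _)
  refine abs_vertKernel_le (by positivity) ?_
  simp
  linarith

theorem integrable_vertKernel_mul (ε : ℝ) :
    Integrable fun p : R3 × R3 => vertKernel ε (p.1 - refl p.2) * (g p.1 * g p.2) := by
  refine ((integrable_prod_mul_self hg hgc).norm.const_mul ((2 * a) ^ 2)⁻¹).mono' ?_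
    (Eventually.of_forall (norm_vertKernel_mul_le ha hga ε))
  refine (((measurable_vertKernel ε).comp ?_).aestronglyMeasurable).mul
    (integrable_prod_mul_self hg hgc).aestronglyMeasurable
  exact measurable_fst.sub (refl.continuous.measurable.comp measurable_snd)

theorem tendsto_integral_vertKernel :
    Tendsto (fun ε : ℝ => ∫ p : R3 × R3, vertKernel ε (p.1 - refl p.2) * (g p.1 * g p.2)) (𝓝[>] 0)
      (𝓝 (∫ p : R3 × R3, vertKernel 0 (p.1 - refl p.2) * (g p.1 * g p.2))) := by
  refine tendsto_integral_filter_of_dominated_convergence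
    (fun p => ((2 * a) ^ 2)⁻¹ * ‖g p.1 * g p.2‖)
    (Eventually.of_forall fun ε =>
      (integrable_vertKernel_mul hg hgc ha hga ε).aestronglyMeasurable)
    (Eventually.of_forall fun ε => Eventually.of_forall
      (norm_vertKernel_mul_le ha hga ε))
    ((integrable_prod_mul_self hg hgc).norm.const_mul _) (Eventually.of_forall fun p => ?_)
  by_cases h1 : p.1 2 < a
  · simp [hga _ h1]
  by_cases h2 : p.2 2 < a
  · simp [hga _ h2]
  refine Tendsto.mul_const _ ?_
  have hz : p.1 - refl p.2 ≠ 0 := by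
    intro h
    have := congrArg (fun y : R3 => y 2) h
    simp at this
    linarith
  have hz' : 0 < ‖p.1 - refl p.2‖ := norm_pos_iff.2 hz
  have : ContinuousAt (fun ε : ℝ => vertKernel ε (p.1 - refl p.2)) 0 := by
    unfold vertKernel
    refine continuousAt_const.mul (ContinuousAt.rpow_const (by fun_prop) (Or.inl ?_))
    positivity
  exact this.tendsto.mono_left nhdsWithin_le_nhds

omit hga ha in
/-- Self-interaction within a half space cancels by antisymmetry of the kernel, and only the
interaction with the mirror image remains. -/
theorem integral_mul_integral_vertKernel {ε : ℝ} (hε : 0 < ε) :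
    ∫ x, g x * ∫ y, vertKernel ε (x - y) * (g y - g (refl y)) =
      -∫ p : R3 × R3, vertKernel ε (p.1 - refl p.2) * (g p.1 * g p.2) := by
  have hk := continuous_vertKernel hε
  have hgr : Continuous fun y => g (refl y) := hg.comp refl.continuous
  have hgrc : HasCompactSupport fun y => g (refl y) := hgc.comp_homeomorph refl.toHomeomorph
  have hcs : ∀ k h : R3 → ℝ, HasCompactSupport k → HasCompactSupport h →
      HasCompactSupport fun p : R3 × R3 => k p.1 * h p.2 := by
    intro k h hk hh
    refine HasCompactSupport.intro (hk.prod hh) fun p hp => ?_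
    by_cases h1 : p.1 ∈ tsupport k
    · have h2 : p.2 ∉ tsupport h := fun h2 => hp ⟨h1, h2⟩
      rw [image_eq_zero_of_notMem_tsupport h2, mul_zero]
    · rw [image_eq_zero_of_notMem_tsupport h1, zero_mul]
  have hd : Continuous fun p : R3 × R3 => vertKernel ε (p.1 - p.2) :=
    hk.comp (continuous_fst.sub continuous_snd)
  have hF1 : Integrable fun p : R3 × R3 => vertKernel ε (p.1 - p.2) * (g p.1 * g p.2) :=
    (hd.mul ((hg.comp continuous_fst).mul
      (hg.comp continuous_snd))).integrable_of_hasCompactSupport (hcs g g hgc hgc).mul_left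
  have hF2 : Integrable fun p : R3 × R3 => vertKernel ε (p.1 - p.2) * (g p.1 * g (refl p.2)) :=
    (hd.mul ((hg.comp continuous_fst).mul
      (hgr.comp continuous_snd))).integrable_of_hasCompactSupport (hcs g _ hgc hgrc).mul_left
  have hF3 : Integrable fun p : R3 × R3 => vertKernel ε (p.1 - refl p.2) * (g p.1 * g p.2) := by
    have hd' : Continuous fun p : R3 × R3 => vertKernel ε (p.1 - refl p.2) :=
      hk.comp (continuous_fst.sub (refl.continuous.comp continuous_snd))
    exact (hd'.mul ((hg.comp continuous_fst).mul
      (hg.comp continuous_snd))).integrable_of_hasCompactSupport (hcs g g hgc hgc).mul_left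
  have h1 : ∫ p : R3 × R3, vertKernel ε (p.1 - p.2) * (g p.1 * g p.2) = 0 := by
    have h := integral_prod_swap (μ := (volume : Measure R3)) (ν := (volume : Measure R3))
      (fun p : R3 × R3 => vertKernel ε (p.1 - p.2) * (g p.1 * g p.2))
    have h2 : ∀ p : R3 × R3, vertKernel ε (p.swap.1 - p.swap.2) * (g p.swap.1 * g p.swap.2) =
        -(vertKernel ε (p.1 - p.2) * (g p.1 * g p.2)) := by
      intro p
      rw [Prod.fst_swap, Prod.snd_swap, ← neg_sub p.1 p.2, vertKernel_neg]; ring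
    simp only [h2] at h
    rw [integral_neg] at h
    rw [Measure.volume_eq_prod]
    linarith
  have h2 : ∫ p : R3 × R3, vertKernel ε (p.1 - p.2) * (g p.1 * g (refl p.2)) =
      ∫ p : R3 × R3, vertKernel ε (p.1 - refl p.2) * (g p.1 * g p.2) := by
    rw [Measure.volume_eq_prod, integral_prod _ hF2, integral_prod _ hF3]
    congr 1; ext1 x
    have := measurePreserving_refl.integral_comp refl.toHomeomorph.measurableEmbedding
      (fun y => vertKernel ε (x - refl y) * (g x * g y))
    rw [← this]
    refine integral_congr_ae (Eventually.of_forall fun y => ?_)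
    have hrr : refl (refl y) = y := by apply vec3_ext <;> simp
    simp only
    rw [hrr]
  have h3 : ∀ x, g x * ∫ y, vertKernel ε (x - y) * (g y - g (refl y)) =
      ∫ y, (vertKernel ε (x - y) * (g x * g y) - vertKernel ε (x - y) * (g x * g (refl y))) := by
    intro x
    rw [← integral_const_mul]
    congr 1; ext1 y; ring
  simp_rw [h3]
  have h4 := integral_prod _ (hF1.sub hF2)
  simp only [Pi.sub_apply] at h4
  rw [← h4]
  change ∫ p : R3 × R3, (vertKernel ε (p.1 - p.2) * (g p.1 * g p.2) -
    vertKernel ε (p.1 - p.2) * (g p.1 * g (refl p.2))) = _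
  rw [integral_sub hF1 hF2, h1, h2, zero_sub]

/-- Passage to the limit of vanishing regularization. -/
theorem integral_mul_of_biotSavart {f h : R3 → ℝ} (hf : Continuous f) {M : ℝ}
    (hM : ∀ x, |f x| ≤ M) (hh : ∀ y, h y = g y - g (refl y))
    (hbs : ∀ ε, 0 < ε → ∀ x, ∫ y, plummer y * f (x + ε • y) = ∫ y, vertKernel ε (x - y) * h y) :
    4 * Real.pi * ∫ x, g x * f x =
      -∫ p : R3 × R3, vertKernel 0 (p.1 - refl p.2) * (g p.1 * g p.2) := by
  have h1 : Tendsto (fun ε : ℝ => ∫ x, g x * ∫ y, plummer y * f (x + ε • y)) (𝓝[>] 0)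
      (𝓝 (∫ x, g x * (4 * Real.pi * f x))) := by
    have hgi := hg.integrable_of_hasCompactSupport (μ := volume) hgc
    refine tendsto_integral_filter_of_dominated_convergence
      (fun x => ‖g x‖ * (4 * Real.pi * M)) (Eventually.of_forall fun ε => ?_)
      (Eventually.of_forall fun ε => Eventually.of_forall fun x => ?_) (hgi.norm.mul_const _)
      (Eventually.of_forall fun x => (tendsto_integral_plummer hf hM x).const_mul _)
    · refine hg.aestronglyMeasurable.mul ?_
      have hc : Continuous fun q : R3 × R3 => plummer q.2 * f (q.1 + ε • q.2) :=
        (continuous_plummer.comp continuous_snd).mul (hf.comp (by fun_prop))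
      exact (hc.stronglyMeasurable.integral_prod_right
        (f := fun x y => plummer y * f (x + ε • y))).aestronglyMeasurable
    · rw [norm_mul]
      refine mul_le_mul_of_nonneg_left ?_ (norm_nonneg _)
      rw [← integral_plummer, ← integral_mul_const]
      refine norm_integral_le_of_norm_le (integrable_plummer.mul_const M)
        (Eventually.of_forall fun y => ?_)
      rw [norm_mul, Real.norm_of_nonneg (plummer_nonneg y), Real.norm_eq_abs]
      exact mul_le_mul_of_nonneg_left (hM _) (plummer_nonneg y)
  have h2 : Tendsto (fun ε : ℝ => ∫ x, g x * ∫ y, plummer y * f (x + ε • y)) (𝓝[>] 0)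
      (𝓝 (-∫ p : R3 × R3, vertKernel 0 (p.1 - refl p.2) * (g p.1 * g p.2))) := by
    refine (tendsto_integral_vertKernel hg hgc ha hga).neg.congr' ?_
    filter_upwards [self_mem_nhdsWithin] with ε hε
    rw [← integral_mul_integral_vertKernel hg hgc hε]
    congr 1; ext1 x
    rw [hbs ε hε]
    simp only [hh]
  rw [← tendsto_nhds_unique h1 h2, ← integral_const_mul]
  congr 1; ext1 x; ring

end HalfSpace



/-! ### Cylindrical coordinates -/

theorem exists_measurableEquiv_vec3 : ∃ E : ℝ × (ℝ × ℝ) ≃ᵐ R3,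
    MeasurePreserving E volume volume ∧ ∀ q, E q = !₂[q.2.1, q.2.2, q.1] := by
  refine ⟨(((MeasurableEquiv.refl ℝ).prodCongr MeasurableEquiv.finTwoArrow.symm).trans
    (MeasurableEquiv.piFinSuccAbove (fun _ : Fin 3 => ℝ) 2).symm).trans
    (MeasurableEquiv.toLp 2 (Fin 3 → ℝ)), ?_, fun q => ?_⟩
  · have h1 : MeasurePreserving ((MeasurableEquiv.refl ℝ).prodCongr
        (MeasurableEquiv.finTwoArrow (α := ℝ)).symm) volume volume :=
      (MeasurePreserving.id (volume : Measure ℝ)).prod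
        ((volume_preserving_finTwoArrow ℝ).symm MeasurableEquiv.finTwoArrow)
    have h2 := (volume_preserving_piFinSuccAbove (fun _ : Fin 3 => ℝ) 2).symm
    exact (PiLp.volume_preserving_toLp (Fin 3)).comp (h2.comp h1)
  · apply vec3_ext
    · change (Fin.insertNth (α := fun _ : Fin 3 => ℝ) 2 q.1 ![q.2.1, q.2.2]) 0 = q.2.1
      rw [show (0 : Fin 3) = Fin.succAbove 2 0 from rfl, Fin.insertNth_apply_succAbove]; rfl
    · change (Fin.insertNth (α := fun _ : Fin 3 => ℝ) 2 q.1 ![q.2.1, q.2.2]) 1 = q.2.2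
      rw [show (1 : Fin 3) = Fin.succAbove 2 1 from rfl, Fin.insertNth_apply_succAbove]; rfl
    · change (Fin.insertNth (α := fun _ : Fin 3 => ℝ) 2 q.1 ![q.2.1, q.2.2]) 2 = q.1
      rw [Fin.insertNth_apply_same]

/-- Integration over `ℝ³` as an integral over horizontal planes in polar coordinates. -/
theorem integral_cylindrical {h : R3 → ℝ} (hh : Integrable h) :
    ∫ x, h x = ∫ z : ℝ, ∫ p in Ioi (0 : ℝ) ×ˢ Ioo (-Real.pi) Real.pi,
      p.1 * h !₂[p.1 * Real.cos p.2, p.1 * Real.sin p.2, z] := by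
  obtain ⟨E, hE, hEq⟩ := exists_measurableEquiv_vec3
  have h1 : Integrable fun q : ℝ × (ℝ × ℝ) => h !₂[q.2.1, q.2.2, q.1] := by
    have := (hE.integrable_comp_emb E.measurableEmbedding).2 hh
    exact this.congr (Eventually.of_forall fun q => by simp only [Function.comp, hEq])
  rw [← hE.integral_comp E.measurableEmbedding]
  simp_rw [hEq]
  rw [Measure.volume_eq_prod, integral_prod _ h1]
  congr 1; ext1 z
  have := integral_comp_polarCoord_symm (fun p : ℝ × ℝ => h !₂[p.1, p.2, z])
  simp only [polarCoord_target, polarCoord_symm_apply, smul_eq_mul] at this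
  rw [← this]

/-- An integral is nonnegative if the integrals over all horizontal circles centred on the axis
are. -/
theorem integral_nonneg_of_circles {h : R3 → ℝ} (hh : Integrable h)
    (hc : ∀ r z : ℝ, 0 < r → 0 ≤ ∫ θ in Ioo (-Real.pi) Real.pi,
      h !₂[r * Real.cos θ, r * Real.sin θ, z]) : 0 ≤ ∫ x, h x := by
  rw [integral_cylindrical hh]
  refine integral_nonneg fun z => ?_
  by_cases hi : IntegrableOn (fun p : ℝ × ℝ =>
      p.1 * h !₂[p.1 * Real.cos p.2, p.1 * Real.sin p.2, z])
      (Ioi (0 : ℝ) ×ˢ Ioo (-Real.pi) Real.pi) (volume.prod volume)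
  · simp only [Pi.zero_apply]
    rw [Measure.volume_eq_prod, setIntegral_prod _ hi]
    refine setIntegral_nonneg measurableSet_Ioi fun r hr => ?_
    rw [integral_const_mul]
    exact mul_nonneg (mem_Ioi.1 hr).le (hc r z hr)
  · exact (integral_undef hi).ge

theorem integral_of_axisymmetric {h : R3 → ℝ} (hh : Integrable h) {H : ℝ → ℝ → ℝ}
    (hH : ∀ r θ z, 0 < r → h !₂[r * Real.cos θ, r * Real.sin θ, z] = H r z) :
    ∫ x, h x = 2 * Real.pi * ∫ z : ℝ, ∫ r in Ioi (0 : ℝ), r * H r z := by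
  rw [integral_cylindrical hh, ← integral_const_mul]
  congr 1; ext1 z
  have h1 := setIntegral_prod_mul (μ := (volume : Measure ℝ)) (ν := (volume : Measure ℝ))
    (fun r => r * H r z) (fun _ : ℝ => (1 : ℝ)) (Ioi 0) (Ioo (-Real.pi) Real.pi)
  have h2 : ∫ _ in Ioo (-Real.pi) Real.pi, (1 : ℝ) = 2 * Real.pi := by
    rw [setIntegral_const, measureReal_def, Real.volume_Ioo,
      ENNReal.toReal_ofReal (by linarith [Real.pi_pos]), smul_eq_mul]
    ring
  rw [h2] at h1
  rw [mul_comm, ← h1, ← Measure.volume_eq_prod]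
  refine setIntegral_congr_fun (measurableSet_Ioi.prod measurableSet_Ioo) fun p hp => ?_
  change p.1 * h _ = p.1 * H p.1 z * 1
  rw [hH _ _ _ hp.1, mul_one]

/-! ### The interaction kernel -/

/-- The interaction of two coaxial circles, as an integral over the angle. -/
def circleKernel (A B : ℝ) : ℝ :=
  ∫ θ in (0 : ℝ)..(Real.pi / 2), Real.cos θ *
    (1 / (A - B * Real.cos θ) ^ (3 / 2 : ℝ) - 1 / (A + B * Real.cos θ) ^ (3 / 2 : ℝ))

/-- The substitution `σ = cos θ`. -/
theorem kernel_eq (p q : ℝ × ℝ) : kernel p q = (p.2 + q.2) / (p.1 * q.1) *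
    circleKernel ((p.2 + q.2) ^ 2 + p.1 ^ 2 + q.1 ^ 2) (2 * p.1 * q.1) := by
  have himg : Real.cos '' Ioo 0 (Real.pi / 2) = Ioo 0 1 := by
    ext s
    constructor
    · rintro ⟨θ, hθ, rfl⟩
      refine ⟨Real.cos_pos_of_mem_Ioo ⟨by linarith [hθ.1, Real.pi_pos], hθ.2⟩, ?_⟩
      have := Real.cos_lt_cos_of_nonneg_of_le_pi_div_two le_rfl hθ.2.le hθ.1
      rwa [Real.cos_zero] at this
    · intro hs
      refine ⟨Real.arccos s, ⟨Real.arccos_pos.2 hs.2, Real.arccos_lt_pi_div_two.2 hs.1⟩,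
        Real.cos_arccos (by linarith [hs.1]) hs.2.le⟩
  have hinj : InjOn Real.cos (Ioo 0 (Real.pi / 2)) :=
    Real.injOn_cos.mono fun θ hθ =>
      mem_Icc.2 ⟨hθ.1.le, by linarith [hθ.2, Real.pi_pos]⟩
  rw [kernel, circleKernel, intervalIntegral.integral_of_le zero_le_one,
    integral_Ioc_eq_integral_Ioo, ← himg,
    integral_image_eq_integral_abs_deriv_smul measurableSet_Ioo
      (fun θ _ => (Real.hasDerivAt_cos θ).hasDerivWithinAt) hinj,
    ← intervalIntegral.integral_const_mul,
    intervalIntegral.integral_of_le (by positivity), integral_Ioc_eq_integral_Ioo]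
  refine setIntegral_congr_fun measurableSet_Ioo fun θ hθ => ?_
  have hs : 0 < Real.sin θ := Real.sin_pos_of_pos_of_lt_pi hθ.1 (by linarith [hθ.2, Real.pi_pos])
  have h1 : (1 - Real.cos θ ^ 2) ^ (-(1 / 2) : ℝ) = (Real.sin θ)⁻¹ := by
    rw [← Real.sin_sq, Real.rpow_neg (sq_nonneg _), ← Real.sqrt_eq_rpow, Real.sqrt_sq hs.le]
  simp only [smul_eq_mul, abs_neg, abs_of_pos hs, h1]
  field_simp

theorem circle_denominator_pos {A B : ℝ} (h : |B| < A) (θ : ℝ) : 0 < A - B * Real.cos θ := by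
  have h1 : |B * Real.cos θ| ≤ |B| := by
    rw [abs_mul]; exact mul_le_of_le_one_right (abs_nonneg _) (Real.abs_cos_le_one θ)
  linarith [le_abs_self (B * Real.cos θ)]

theorem circle_denominator_pos' {A B : ℝ} (h : |B| < A) (θ : ℝ) : 0 < A + B * Real.cos θ := by
  have := circle_denominator_pos (B := -B) (by rwa [abs_neg]) θ
  linarith

theorem continuousOn_circleKernel :
    ContinuousOn (fun p : ℝ × ℝ => circleKernel p.1 p.2) {p | |p.2| < p.1} := by
  rw [continuousOn_iff_continuous_domRestrict]
  refine intervalIntegral.continuous_parametric_intervalIntegral_of_continuous'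
    (f := fun (p : {p : ℝ × ℝ | |p.2| < p.1}) θ => Real.cos θ *
      (1 / (p.1.1 - p.1.2 * Real.cos θ) ^ (3 / 2 : ℝ) -
        1 / (p.1.1 + p.1.2 * Real.cos θ) ^ (3 / 2 : ℝ))) ?_ 0 (Real.pi / 2)
  simp only [Function.uncurry_def]
  refine Continuous.mul (by fun_prop) (Continuous.sub ?_ ?_)
  · refine continuous_const.div (Continuous.rpow_const (by fun_prop) fun p => Or.inr (by norm_num))
      fun p => (Real.rpow_pos_of_pos (circle_denominator_pos p.1.2 p.2) _).ne'
  · refine continuous_const.div (Continuous.rpow_const (by fun_prop) fun p => Or.inr (by norm_num))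
      fun p => (Real.rpow_pos_of_pos (circle_denominator_pos' p.1.2 p.2) _).ne'

theorem continuous_circle_integrand {A B : ℝ} (h : |B| < A) : Continuous fun θ : ℝ =>
    Real.cos θ * (1 / (A - B * Real.cos θ) ^ (3 / 2 : ℝ)) := by
  refine Continuous.mul (by fun_prop) (continuous_const.div (Continuous.rpow_const (by fun_prop)
    fun p => Or.inr (by norm_num))
    fun θ => (Real.rpow_pos_of_pos (circle_denominator_pos h θ) _).ne')

theorem circleKernel_pos {A B : ℝ} (hB : 0 < B) (h : B < A) : 0 < circleKernel A B := by
  have h' : |B| < A := by rwa [abs_of_pos hB]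
  have hn : |(-B)| < A := by rwa [abs_neg]
  have hc : Continuous fun θ : ℝ => Real.cos θ * (1 / (A - B * Real.cos θ) ^ (3 / 2 : ℝ) -
      1 / (A + B * Real.cos θ) ^ (3 / 2 : ℝ)) := by
    have := (continuous_circle_integrand h').sub (continuous_circle_integrand hn)
    refine this.congr fun θ => ?_
    rw [mul_sub]; simp
  refine intervalIntegral.intervalIntegral_pos_of_pos_on (hc.intervalIntegrable _ _)
    (fun θ hθ => ?_) (by positivity)
  have hcos : 0 < Real.cos θ :=
    Real.cos_pos_of_mem_Ioo ⟨by linarith [hθ.1, Real.pi_pos], hθ.2⟩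
  refine mul_pos hcos (sub_pos.2 ?_)
  have := circle_denominator_pos h' θ
  refine one_div_lt_one_div_of_lt (Real.rpow_pos_of_pos this _)
    (Real.rpow_lt_rpow this.le ?_ (by norm_num))
  nlinarith [mul_pos hB hcos]

/-- The full circle contributes twice the kernel, whatever the starting angle. -/
theorem integral_circle {A B : ℝ} (h : |B| < A) (φ : ℝ) :
    ∫ θ in Ioo (-Real.pi) Real.pi,
      Real.cos (θ - φ) * (1 / (A - B * Real.cos (θ - φ)) ^ (3 / 2 : ℝ)) =
      2 * circleKernel A B := by
  set f : ℝ → ℝ := fun θ => Real.cos θ * (1 / (A - B * Real.cos θ) ^ (3 / 2 : ℝ)) with hf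
  have hfc : Continuous f := continuous_circle_integrand h
  have hfi : ∀ a b, IntervalIntegrable f volume a b := fun a b => hfc.intervalIntegrable a b
  have hper : Function.Periodic f (2 * Real.pi) := fun θ => by simp [hf]
  have hpi := Real.pi_pos
  rw [← integral_Ioc_eq_integral_Ioo, ← intervalIntegral.integral_of_le (by linarith)]
  change ∫ θ in (-Real.pi)..Real.pi, f (θ - φ) = _
  rw [intervalIntegral.integral_comp_sub_right f φ]
  have h1 := hper.intervalIntegral_add_eq (-Real.pi - φ) (-(Real.pi / 2))
  have e1 : -Real.pi - φ + 2 * Real.pi = Real.pi - φ := by ring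
  rw [e1] at h1
  rw [h1, ← intervalIntegral.integral_add_adjacent_intervals (hfi _ (Real.pi / 2)) (hfi _ _)]
  -- each half circle is symmetric about its midpoint
  have hsym : ∀ g : ℝ → ℝ, Continuous g → (∀ θ, g (-θ) = g θ) →
      ∫ θ in (-(Real.pi / 2))..(Real.pi / 2), g θ = 2 * ∫ θ in (0 : ℝ)..(Real.pi / 2), g θ := by
    intro g hg hs
    rw [← intervalIntegral.integral_add_adjacent_intervals (hg.intervalIntegrable _ 0)
      (hg.intervalIntegrable _ _)]
    have := intervalIntegral.integral_comp_neg (a := 0) (b := Real.pi / 2) g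
    rw [neg_zero] at this
    rw [← this]
    simp only [hs]
    ring
  have e2 : -(Real.pi / 2) + 2 * Real.pi = Real.pi / 2 + Real.pi := by ring
  have h2 : ∫ θ in (Real.pi / 2)..(-(Real.pi / 2) + 2 * Real.pi), f θ =
      ∫ θ in (-(Real.pi / 2))..(Real.pi / 2), f (θ + Real.pi) := by
    rw [intervalIntegral.integral_comp_add_right f Real.pi, e2]
    congr 1; ring
  have hfc' : Continuous fun θ => f (θ + Real.pi) := hfc.comp (by fun_prop)
  rw [h2, hsym f hfc fun θ => by simp [hf], hsym _ hfc' fun θ => by simp [hf, Real.cos_add_pi],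
    ← mul_add, ← intervalIntegral.integral_add (hfi _ _) (hfc'.intervalIntegrable _ _),
    circleKernel]
  congr 1
  refine intervalIntegral.integral_congr fun θ _ => ?_
  simp only [hf, Real.cos_add_pi]
  rw [mul_neg, sub_neg_eq_add]
  ring

theorem abs_lt_of_height {p q : ℝ × ℝ} (hz : 0 < p.2 + q.2) :
    |2 * p.1 * q.1| < (p.2 + q.2) ^ 2 + p.1 ^ 2 + q.1 ^ 2 := by
  have := pow_pos hz 2
  rw [abs_lt]
  constructor <;> nlinarith [sq_nonneg (p.1 - q.1), sq_nonneg (p.1 + q.1)]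

theorem kernel_pos {p q : ℝ × ℝ} (hp : 0 < p.1) (hq : 0 < q.1) (hz : 0 < p.2 + q.2) :
    0 < kernel p q := by
  rw [kernel_eq]
  have h := abs_lt_of_height (p := p) (q := q) hz
  exact mul_pos (by positivity) (circleKernel_pos (by positivity) ((le_abs_self _).trans_lt h))

theorem continuousOn_kernel : ContinuousOn (fun pq : (ℝ × ℝ) × (ℝ × ℝ) => kernel pq.1 pq.2)
    {pq | 0 < pq.1.1 ∧ 0 < pq.2.1 ∧ 0 < pq.1.2 + pq.2.2} := by
  simp only [kernel_eq]
  refine ContinuousOn.mul (ContinuousOn.div (by fun_prop) (by fun_prop) fun pq h =>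
    (mul_pos h.1 h.2.1).ne') ?_
  exact continuousOn_circleKernel.comp (f := fun pq : (ℝ × ℝ) × (ℝ × ℝ) =>
    ((pq.1.2 + pq.2.2) ^ 2 + pq.1.1 ^ 2 + pq.2.1 ^ 2, 2 * pq.1.1 * pq.2.1)) (by fun_prop)
    fun pq h => abs_lt_of_height h.2.2



/-! ### The lower bound for the interaction energy -/

/-- The `i`-th component of the vorticity in the upper half space, extended by zero. -/
def upperCurl (v : R3 → R3) (i : Fin 3) (x : R3) : ℝ := if x 2 ≤ 0 then 0 else curl v x i

/-- The angular vorticity in the upper half plane, extended by zero. -/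
def upperOmega (v : R3 → R3) (r z : ℝ) : ℝ := if z ≤ 0 then 0 else omegaTheta v r z

/-- The impulse density in the upper half space, extended by zero. -/
def upperImpulse (v : R3 → R3) (x : R3) : ℝ := x 0 * upperCurl v 1 x - x 1 * upperCurl v 0 x

/-- The vertical Lamb vector in the upper half space, extended by zero. -/
def upperLamb (v : R3 → R3) (x : R3) : ℝ := v x 0 * upperCurl v 1 x - v x 1 * upperCurl v 0 x

/-- The integrand of the interaction energy of the vorticity in the upper half space with its
mirror image. -/
def mirrorEnergy (v : R3 → R3) (p : R3 × R3) : ℝ :=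
  vertKernel 0 (p.1 - refl p.2) *
    (upperCurl v 0 p.1 * upperCurl v 0 p.2 + upperCurl v 1 p.1 * upperCurl v 1 p.2)

theorem upperImpulse_eq (v : R3 → R3) (x : R3) :
    upperImpulse v x = if x 2 ≤ 0 then 0 else impulse v x := by
  unfold upperImpulse upperCurl impulse
  split_ifs <;> simp

theorem upperLamb_eq (v : R3 → R3) (x : R3) :
    upperLamb v x = if x 2 ≤ 0 then 0 else lamb v x := by
  unfold upperLamb upperCurl lamb
  split_ifs <;> simp

namespace OddVortex

variable {v : R3 → R3} {a ρ : ℝ} (h : OddVortex v a ρ)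

include h

theorem differentiable : Differentiable ℝ v := h.contDiff.differentiable (by simp)

theorem curl_two (x : R3) : curl v x 2 = 0 := (curl_formula h.axisym h.differentiable x).2.2

theorem bound_of_curl_ne_zero {x : R3} (hx : curl v x ≠ 0) :
    a ≤ radius x ∧ a ≤ |x 2| ∧ radius x ≤ ρ ∧ |x 2| ≤ ρ := by
  refine h.bound _ _ (radius_nonneg x) fun h0 => hx ?_
  rw [← norm_eq_zero, norm_curl h.axisym h.differentiable, h0, abs_zero]

theorem curl_eq_zero_of_far {x : R3} (hx : ρ + ρ < ‖x‖) : curl v x = 0 := by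
  by_contra h0
  obtain ⟨-, -, h1, h2⟩ := h.bound_of_curl_ne_zero h0
  have h3 : ‖x‖ ^ 2 ≤ (radius x + |x 2|) ^ 2 := by
    rw [norm_sq_vec3, ← radius_sq, add_sq, sq_abs]
    have := mul_nonneg (radius_nonneg x) (abs_nonneg (x 2))
    linarith
  have := abs_le_of_sq_le_sq h3 (add_nonneg (radius_nonneg x) (abs_nonneg _))
  rw [abs_of_nonneg (norm_nonneg _)] at this
  linarith

theorem hasCompactSupport_curl : HasCompactSupport (curl v) :=
  hasCompactSupport_of_far fun _ => h.curl_eq_zero_of_far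

theorem continuous_upperCurl (i : Fin 3) : Continuous (upperCurl v i) := by
  refine Continuous.if_le continuous_const (continuous_curl_comp h.contDiff i)
    (contDiff_coord 2 (n := 1)).continuous continuous_const fun x hx => ?_
  by_contra h0
  have h1 : curl v x ≠ 0 := fun h1 => h0 (by rw [h1]; rfl)
  have := (h.bound_of_curl_ne_zero h1).2.1
  rw [hx, abs_zero] at this
  linarith [h.pos]

theorem hasCompactSupport_upperCurl (i : Fin 3) : HasCompactSupport (upperCurl v i) :=
  hasCompactSupport_of_far fun x hx => by
    rw [upperCurl, h.curl_eq_zero_of_far hx]; simp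

theorem upperCurl_eq_zero (i : Fin 3) (x : R3) (hx : x 2 < a) : upperCurl v i x = 0 := by
  rw [upperCurl]
  split_ifs with h0
  · rfl
  · by_contra hc
    have h1 : curl v x ≠ 0 := fun h1 => hc (by rw [h1]; rfl)
    have := (h.bound_of_curl_ne_zero h1).2.1
    rw [abs_of_pos (not_le.1 h0)] at this
    linarith

/-- The horizontal vorticity is odd under reflection. -/
theorem curl_eq_sub (x : R3) : curl v x 0 = upperCurl v 0 x - upperCurl v 0 (refl x) ∧
    curl v x 1 = upperCurl v 1 x - upperCurl v 1 (refl x) := by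
  have h1 := curl_reflField h.differentiable x
  rw [h.refl_eq] at h1
  have c0 : curl v x 0 = - curl v (refl x) 0 := by
    have := congrArg (fun y : R3 => y 0) h1; simpa using this
  have c1 : curl v x 1 = - curl v (refl x) 1 := by
    have := congrArg (fun y : R3 => y 1) h1; simpa using this
  have hz : x 2 = 0 → curl v x = 0 := by
    intro hx
    by_contra h0
    have := (h.bound_of_curl_ne_zero h0).2.1
    rw [hx, abs_zero] at this
    linarith [h.pos]
  rcases lt_trichotomy (x 2) 0 with hx | hx | hx
  · simp [upperCurl, hx.le, hx, c0, c1]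
  · have e0 := hz hx
    simp [upperCurl, hx, e0]
  · simp [upperCurl, hx.le, hx]

theorem integrable_mirrorEnergy : Integrable (mirrorEnergy v) := by
  have h0 := integrable_vertKernel_mul (h.continuous_upperCurl 0) (h.hasCompactSupport_upperCurl 0)
    h.pos (h.upperCurl_eq_zero 0) 0
  have h1 := integrable_vertKernel_mul (h.continuous_upperCurl 1) (h.hasCompactSupport_upperCurl 1)
    h.pos (h.upperCurl_eq_zero 1) 0
  exact (h0.add h1).congr (Eventually.of_forall fun p => by
    simp only [mirrorEnergy, Pi.add_apply]; ring)

/-- Biot–Savart: the integrated vertical Lamb vector is minus the interaction energy. -/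
theorem integral_upperLamb :
    4 * Real.pi * ∫ x, upperLamb v x = -∫ p, mirrorEnergy v p := by
  obtain ⟨M, hM⟩ := h.bounded
  have hbs := fun ε (hε : 0 < ε) => biotSavart_horizontal h.contDiff h.memLp h.div_eq_zero hM
    h.hasCompactSupport_curl h.curl_two hε
  have h0 := integral_mul_of_biotSavart (h.continuous_upperCurl 1) (h.hasCompactSupport_upperCurl 1)
    h.pos (h.upperCurl_eq_zero 1) (f := fun x => v x 0) (h := fun x => curl v x 1)
    (contDiff_comp h.contDiff 0).continuous (fun x => (PiLp.norm_apply_le (v x) 0).trans (hM x))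
    (fun x => (h.curl_eq_sub x).2) fun ε hε x => (hbs ε hε x).1
  have h1 := integral_mul_of_biotSavart (h.continuous_upperCurl 0) (h.hasCompactSupport_upperCurl 0)
    h.pos (h.upperCurl_eq_zero 0) (f := fun x => -v x 1) (h := fun x => curl v x 0) (M := M)
    (contDiff_comp h.contDiff 1).continuous.neg
    (fun x => by rw [abs_neg]; exact (PiLp.norm_apply_le (v x) 1).trans (hM x))
    (fun x => (h.curl_eq_sub x).1) fun ε hε x => by
      have := (hbs ε hε x).2
      simp only [mul_neg]
      rw [integral_neg, this, neg_neg]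
  have hi : ∀ i j, Integrable fun x => upperCurl v j x * v x i := fun i j =>
    ((h.continuous_upperCurl j).mul
      (contDiff_comp h.contDiff i).continuous).integrable_of_hasCompactSupport
      (h.hasCompactSupport_upperCurl j).mul_right
  have h2 : ∫ x, upperLamb v x = (∫ x, upperCurl v 1 x * v x 0) +
      ∫ x, upperCurl v 0 x * -v x 1 := by
    have hi' : Integrable fun x => upperCurl v 0 x * -v x 1 :=
      (hi 1 0).neg.congr (Eventually.of_forall fun x => by simp)
    rw [← integral_add (hi 0 1) hi']
    congr 1; ext1 x; rw [upperLamb]; ring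
  have h3 : ∫ p, mirrorEnergy v p =
      (∫ p : R3 × R3, vertKernel 0 (p.1 - refl p.2) * (upperCurl v 0 p.1 * upperCurl v 0 p.2)) +
      ∫ p : R3 × R3, vertKernel 0 (p.1 - refl p.2) * (upperCurl v 1 p.1 * upperCurl v 1 p.2) := by
    rw [← integral_add]
    · congr 1; ext1 p; rw [mirrorEnergy]; ring
    · exact integrable_vertKernel_mul (h.continuous_upperCurl 0) (h.hasCompactSupport_upperCurl 0)
        h.pos (h.upperCurl_eq_zero 0) 0
    · exact integrable_vertKernel_mul (h.continuous_upperCurl 1) (h.hasCompactSupport_upperCurl 1)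
        h.pos (h.upperCurl_eq_zero 1) 0
  rw [h2, h3, mul_add, h0, h1]
  ring

/-! ### The vorticity support and `κ` -/

theorem bound_of_mem {q : ℝ × ℝ} (hq : q ∈ vortSupportUpper v) :
    a ≤ q.1 ∧ a ≤ q.2 ∧ q.1 ≤ ρ ∧ q.2 ≤ ρ := by
  have hcl : IsClosed {q : ℝ × ℝ | a ≤ q.1 ∧ a ≤ |q.2| ∧ q.1 ≤ ρ ∧ |q.2| ≤ ρ} := by
    have hf : Continuous fun q : ℝ × ℝ => q.1 := continuous_fst
    have hg : Continuous fun q : ℝ × ℝ => |q.2| := continuous_snd.abs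
    exact (isClosed_le continuous_const hf).inter ((isClosed_le continuous_const hg).inter
      ((isClosed_le hf continuous_const).inter (isClosed_le hg continuous_const)))
  have hsub : vortSupport v ⊆ {q : ℝ × ℝ | a ≤ q.1 ∧ a ≤ |q.2| ∧ q.1 ≤ ρ ∧ |q.2| ≤ ρ} :=
    closure_minimal (fun q hq => h.bound _ _ hq.1 hq.2) hcl
  have h1 := hsub hq.1
  have h2 : |q.2| = q.2 := abs_of_nonneg hq.2
  simp only [mem_ofPred_eq, h2] at h1
  exact h1

theorem isCompact_vortSupportUpper : IsCompact (vortSupportUpper v) := by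
  refine (isCompact_Icc (a := ((a, a) : ℝ × ℝ)) (b := (ρ, ρ))).of_isClosed_subset
    (isClosed_closure.inter (isClosed_le continuous_const continuous_snd)) fun q hq => ?_
  obtain ⟨h1, h2, h3, h4⟩ := h.bound_of_mem hq
  exact ⟨⟨h1, h2⟩, ⟨h3, h4⟩⟩

omit h in
theorem mem_vortSupportUpper {r z : ℝ} (hr : 0 ≤ r) (hz : 0 ≤ z) (hω : omegaTheta v r z ≠ 0) :
    (r, z) ∈ vortSupportUpper v := ⟨subset_closure ⟨hr, hω⟩, hz⟩

theorem nonempty_vortSupportUpper : (vortSupportUpper v).Nonempty := by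
  obtain ⟨r, z, hr, hz, hω⟩ := h.ne_zero
  exact ⟨_, mem_vortSupportUpper hr hz hω⟩

theorem kernel_pos_of_mem {pq : (ℝ × ℝ) × (ℝ × ℝ)}
    (hpq : pq ∈ vortSupportUpper v ×ˢ vortSupportUpper v) : 0 < kernel pq.1 pq.2 := by
  obtain ⟨h1, h2, -⟩ := h.bound_of_mem hpq.1
  obtain ⟨h3, h4, -⟩ := h.bound_of_mem hpq.2
  exact kernel_pos (h.pos.trans_le h1) (h.pos.trans_le h3)
    (add_pos (h.pos.trans_le h2) (h.pos.trans_le h4))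

theorem bddBelow_kernel : BddBelow ((fun pq : (ℝ × ℝ) × (ℝ × ℝ) => kernel pq.1 pq.2) ''
    (vortSupportUpper v ×ˢ vortSupportUpper v)) := by
  refine ⟨0, ?_⟩
  rintro _ ⟨pq, hpq, rfl⟩
  exact (h.kernel_pos_of_mem hpq).le

theorem kappa_le {p q : ℝ × ℝ} (hp : p ∈ vortSupportUpper v) (hq : q ∈ vortSupportUpper v) :
    2 * Real.pi * kappa v ≤ kernel p q := by
  have h1 : kernel p q ∈ (fun pq : (ℝ × ℝ) × (ℝ × ℝ) => kernel pq.1 pq.2) ''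
    (vortSupportUpper v ×ˢ vortSupportUpper v) := ⟨(p, q), ⟨hp, hq⟩, rfl⟩
  have h2 := csInf_le h.bddBelow_kernel h1
  have hpi := Real.pi_pos
  rw [kappa, ← mul_assoc, mul_one_div_cancel (by positivity), one_mul]
  exact h2

/-- The infimum in `κ` is attained. -/
theorem exists_kappa_eq : ∃ p ∈ vortSupportUpper v, ∃ q ∈ vortSupportUpper v,
    2 * Real.pi * kappa v = kernel p q := by
  have hK := h.isCompact_vortSupportUpper.prod h.isCompact_vortSupportUpper
  have hc : ContinuousOn (fun pq : (ℝ × ℝ) × (ℝ × ℝ) => kernel pq.1 pq.2)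
      (vortSupportUpper v ×ˢ vortSupportUpper v) := by
    refine continuousOn_kernel.mono fun pq hpq => ?_
    obtain ⟨h1, h2, -⟩ := h.bound_of_mem hpq.1
    obtain ⟨h3, h4, -⟩ := h.bound_of_mem hpq.2
    exact ⟨h.pos.trans_le h1, h.pos.trans_le h3,
      add_pos (h.pos.trans_le h2) (h.pos.trans_le h4)⟩
  obtain ⟨pq, hpq, hmin⟩ := (hK.image_of_continuousOn hc).sInf_mem
    ((h.nonempty_vortSupportUpper.prod h.nonempty_vortSupportUpper).image _)
  refine ⟨pq.1, hpq.1, pq.2, hpq.2, ?_⟩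
  have hpi := Real.pi_pos
  rw [kappa, ← mul_assoc, mul_one_div_cancel (by positivity), one_mul]
  exact hmin.symm

theorem kappa_pos : 0 < kappa v := by
  obtain ⟨p, hp, q, hq, heq⟩ := h.exists_kappa_eq
  have h1 := h.kernel_pos_of_mem (pq := (p, q)) ⟨hp, hq⟩
  simp only [← heq] at h1
  have hpi := Real.pi_pos
  exact pos_of_mul_pos_right h1 (by positivity)

theorem upperCurl_polar (r θ z : ℝ) :
    upperCurl v 0 !₂[r * Real.cos θ, r * Real.sin θ, z] = -(upperOmega v r z * Real.sin θ) ∧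
    upperCurl v 1 !₂[r * Real.cos θ, r * Real.sin θ, z] = upperOmega v r z * Real.cos θ := by
  have h1 := curl_polar h.axisym h.differentiable r θ z
  rw [upperCurl, upperCurl, h1, upperOmega]
  simp only [Matrix.cons_val]
  by_cases hz : z ≤ 0 <;> simp [hz]

theorem upperImpulse_polar (r θ z : ℝ) :
    upperImpulse v !₂[r * Real.cos θ, r * Real.sin θ, z] = r * upperOmega v r z := by
  obtain ⟨h0, h1⟩ := h.upperCurl_polar r θ z
  rw [upperImpulse, h0, h1]
  simp
  linear_combination (r * upperOmega v r z) * Real.sin_sq_add_cos_sq θ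

theorem continuous_upperImpulse : Continuous (upperImpulse v) :=
  ((contDiff_coord 0 (n := 1)).continuous.mul (h.continuous_upperCurl 1)).sub
    ((contDiff_coord 1 (n := 1)).continuous.mul (h.continuous_upperCurl 0))

theorem integrable_upperImpulse : Integrable (upperImpulse v) := by
  refine h.continuous_upperImpulse.integrable_of_hasCompactSupport
    (hasCompactSupport_of_far (R := ρ + ρ) fun x hx => ?_)
  rw [upperImpulse_eq, impulse, h.curl_eq_zero_of_far hx]; simp

/-- `Q` is, up to a constant, the impulse of the upper half space. -/
theorem integral_upperImpulse : ∫ x, upperImpulse v x = -(2 * Real.pi * Q v) := by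
  rw [integral_of_axisymmetric h.integrable_upperImpulse (H := fun r z => r * upperOmega v r z)
    fun r θ z _ => h.upperImpulse_polar r θ z, Q, mul_neg, neg_neg]
  congr 1
  rw [← integral_indicator measurableSet_Ioi]
  congr 1; ext1 z
  by_cases hz : z ≤ 0
  · rw [indicator_of_notMem (by simpa using hz)]
    simp [upperOmega, hz]
  · rw [indicator_of_mem (by simpa using hz)]
    refine setIntegral_congr_fun measurableSet_Ioi fun r _ => ?_
    simp only [upperOmega, hz, if_false]
    ring

theorem upperOmega_nonpos {r z : ℝ} (hr : 0 ≤ r) : upperOmega v r z ≤ 0 := by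
  rw [upperOmega]
  split_ifs with hz
  · exact le_rfl
  · exact h.nonpos r z hr (not_le.1 hz).le

theorem upperImpulse_nonpos (x : R3) : upperImpulse v x ≤ 0 := by
  obtain ⟨θ, hθ⟩ := exists_polar x
  rw [hθ, h.upperImpulse_polar]
  exact mul_nonpos_of_nonneg_of_nonpos (radius_nonneg x) (h.upperOmega_nonpos (radius_nonneg x))

theorem Q_pos : 0 < Q v := by
  obtain ⟨r, z, hr, hz, hω⟩ := h.ne_zero
  obtain ⟨b1, b2, -⟩ := h.bound r z hr hω
  have hz0 : ¬ z ≤ 0 := by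
    intro h0
    have : z = 0 := le_antisymm h0 hz
    rw [this, abs_zero] at b2
    linarith [h.pos]
  have h1 : 0 < ∫ x, -upperImpulse v x := by
    refine h.continuous_upperImpulse.neg.integral_pos_of_hasCompactSupport_nonneg_nonzero
      (hasCompactSupport_of_far (R := ρ + ρ) fun x hx => ?_)
      (fun x => neg_nonneg.2 (h.upperImpulse_nonpos x))
      (x := !₂[r * Real.cos 0, r * Real.sin 0, z]) ?_
    · rw [upperImpulse_eq, impulse, h.curl_eq_zero_of_far hx]; simp
    · rw [h.upperImpulse_polar, upperOmega, if_neg hz0]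
      exact neg_ne_zero.2 (mul_ne_zero (h.pos.trans_le b1).ne' hω)
  rw [integral_neg, h.integral_upperImpulse, neg_neg] at h1
  have hpi := Real.pi_pos
  exact pos_of_mul_pos_right h1 (by positivity)

/-- Averaging over the circles around the axis bounds the interaction of a point with the whole
upper half space from below by its interaction through `κ`. -/
theorem integral_mirrorEnergy_ge_of_integrable (x : R3)
    (hi : Integrable fun y => mirrorEnergy v (x, y)) :
    -(4 * Real.pi * kappa v * Q v) * upperImpulse v x ≤ ∫ y, mirrorEnergy v (x, y) := by
  set c : ℝ := 2 * kappa v * upperImpulse v x with hc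
  have hI : Integrable fun y => c * upperImpulse v y := h.integrable_upperImpulse.const_mul c
  have key : 0 ≤ ∫ y, (mirrorEnergy v (x, y) - c * upperImpulse v y) := by
    refine integral_nonneg_of_circles (hi.sub hI) fun s z hs => ?_
    obtain ⟨φ, hφ⟩ := exists_polar x
    set r := radius x with hr
    have hr0 : 0 ≤ r := radius_nonneg x
    obtain ⟨x0, x1⟩ := h.upperCurl_polar r φ (x 2)
    have xi := h.upperImpulse_polar r φ (x 2)
    rw [← hφ] at x0 x1 xi
    set w := upperOmega v r (x 2) with hw
    set w' := upperOmega v s z with hw'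
    by_cases hww : w * w' = 0
    · have : ∀ θ, mirrorEnergy v (x, !₂[s * Real.cos θ, s * Real.sin θ, z]) -
          c * upperImpulse v !₂[s * Real.cos θ, s * Real.sin θ, z] = 0 := by
        intro θ
        obtain ⟨y0, y1⟩ := h.upperCurl_polar s θ z
        rw [mirrorEnergy, h.upperImpulse_polar, hc, xi]
        simp only [x0, x1, y0, y1, ← hw']
        linear_combination (vertKernel 0 (x - refl !₂[s * Real.cos θ, s * Real.sin θ, z]) *
          (Real.sin φ * Real.sin θ + Real.cos φ * Real.cos θ) - 2 * kappa v * r * s) * hww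
      simp [this]
    have hw0 : w ≠ 0 := left_ne_zero_of_mul hww
    have hw0' : w' ≠ 0 := right_ne_zero_of_mul hww
    have hx2 : ¬ x 2 ≤ 0 := fun hx => hw0 (by simp [hw, upperOmega, hx])
    have hz : ¬ z ≤ 0 := fun hx => hw0' (by simp [hw', upperOmega, hx])
    have hp : (r, x 2) ∈ vortSupportUpper v := mem_vortSupportUpper hr0 (not_le.1 hx2).le
      (by rw [hw, upperOmega, if_neg hx2] at hw0; exact hw0)
    have hq : (s, z) ∈ vortSupportUpper v := mem_vortSupportUpper hs.le (not_le.1 hz).le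
      (by rw [hw', upperOmega, if_neg hz] at hw0'; exact hw0')
    have hrpos : 0 < r := h.pos.trans_le (h.bound_of_mem hp).1
    set A := (x 2 + z) ^ 2 + r ^ 2 + s ^ 2 with hA
    set B := 2 * r * s with hB
    have hAB : |B| < A := abs_lt_of_height (p := (r, x 2)) (q := (s, z))
      (add_pos (not_le.1 hx2) (not_le.1 hz))
    have hpt : ∀ θ, mirrorEnergy v (x, !₂[s * Real.cos θ, s * Real.sin θ, z]) -
          c * upperImpulse v !₂[s * Real.cos θ, s * Real.sin θ, z] =
        ((x 2 + z) * (w * w')) *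
          (Real.cos (θ - φ) * (1 / (A - B * Real.cos (θ - φ)) ^ (3 / 2 : ℝ))) -
          2 * kappa v * (r * s) * (w * w') := by
      intro θ
      obtain ⟨y0, y1⟩ := h.upperCurl_polar s θ z
      have hN : (0 : ℝ) ^ 2 + ‖x - refl !₂[s * Real.cos θ, s * Real.sin θ, z]‖ ^ 2 =
          A - B * Real.cos (θ - φ) := by
        rw [hφ, norm_sq_vec3, Real.cos_sub]
        simp
        linear_combination r ^ 2 * Real.sin_sq_add_cos_sq φ + s ^ 2 * Real.sin_sq_add_cos_sq θ
      rw [mirrorEnergy, h.upperImpulse_polar, hc, xi]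
      simp only [x0, x1, y0, y1, vertKernel, hN, ← hw']
      rw [neg_div, Real.rpow_neg (circle_denominator_pos hAB _).le, Real.cos_sub]
      simp
      ring
    simp_rw [hpt]
    have hcont : Continuous fun θ => Real.cos (θ - φ) *
        (1 / (A - B * Real.cos (θ - φ)) ^ (3 / 2 : ℝ)) :=
      (continuous_circle_integrand hAB).comp (continuous_sub_right φ)
    have hfin : volume (Ioo (-Real.pi) Real.pi) ≠ ⊤ := by simp
    have hio : IntegrableOn (fun θ => Real.cos (θ - φ) *
        (1 / (A - B * Real.cos (θ - φ)) ^ (3 / 2 : ℝ))) (Ioo (-Real.pi) Real.pi) :=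
      (hcont.continuousOn.integrableOn_compact isCompact_Icc).mono_set Ioo_subset_Icc_self
    rw [integral_sub (hio.const_mul _) (integrableOn_const hfin), integral_const_mul,
      integral_circle hAB, setIntegral_const, measureReal_def, Real.volume_Ioo,
      ENNReal.toReal_ofReal (by linarith [Real.pi_pos]), smul_eq_mul]
    have hk := h.kappa_le hp hq
    rw [kernel_eq] at hk
    simp only [← hA, ← hB] at hk
    rw [div_mul_eq_mul_div, le_div_iff₀ (by positivity)] at hk
    have hwn : 0 ≤ w * w' := mul_nonneg_of_nonpos_of_nonpos (h.upperOmega_nonpos hr0)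
      (h.upperOmega_nonpos hs.le)
    have := mul_le_mul_of_nonneg_left hk hwn
    linarith
  rw [integral_sub hi hI, integral_const_mul, h.integral_upperImpulse, hc] at key
  linarith

theorem integral_mirrorEnergy_ge :
    8 * Real.pi ^ 2 * kappa v * Q v ^ 2 ≤ ∫ p, mirrorEnergy v p := by
  have hi := h.integrable_mirrorEnergy
  rw [Measure.volume_eq_prod, integral_prod _ hi]
  calc 8 * Real.pi ^ 2 * kappa v * Q v ^ 2 =
        ∫ x, -(4 * Real.pi * kappa v * Q v) * upperImpulse v x := by
          rw [integral_const_mul, h.integral_upperImpulse]; ring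
    _ ≤ _ := by
      refine integral_mono_ae (h.integrable_upperImpulse.const_mul _) hi.integral_prod_left ?_
      filter_upwards [hi.prod_right_ae] with x hx
      exact h.integral_mirrorEnergy_ge_of_integrable x hx

/-- The growth of `Q` is at least `2 κ Q²`. -/
theorem kappa_mul_Q_sq_le : 2 * kappa v * Q v ^ 2 ≤ -(1 / Real.pi) * ∫ x, upperLamb v x := by
  have h1 := h.integral_upperLamb
  have h2 := h.integral_mirrorEnergy_ge
  have hpi := Real.pi_pos
  have h3 : 2 * Real.pi * kappa v * Q v ^ 2 ≤ -∫ x, upperLamb v x := by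
    have : 4 * Real.pi * (2 * Real.pi * kappa v * Q v ^ 2) ≤
        4 * Real.pi * (-∫ x, upperLamb v x) := by
      rw [mul_neg, h1, neg_neg]; linarith
    exact le_of_mul_le_mul_left this (by positivity)
  rw [neg_mul, ← mul_neg, one_div, ← div_eq_inv_mul, le_div_iff₀ hpi]
  linarith

end OddVortex



/-! ### The differential inequality for `Q` -/

/-- A smooth cutoff to the bounded part of the upper half space that contains the vorticity. -/
theorem exists_upperCutoff {a ρ : ℝ} (ha : 0 < a) (hρ : 0 < ρ) : ∃ ψ : R3 → ℝ,
    ContDiff ℝ ∞ ψ ∧ HasCompactSupport ψ ∧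
    (∀ x : R3, a ≤ x 2 → ‖x‖ ≤ ρ → ψ =ᶠ[𝓝 x] fun _ => 1) ∧
    (∀ x : R3, x 2 ≤ 0 → ψ =ᶠ[𝓝 x] fun _ => 0) := by
  let b : ContDiffBump (0 : R3) := ⟨ρ + 1, ρ + 2, by linarith, by linarith⟩
  -- the height factor passes from `0` to `1` between the heights `a / 2` and `3 a / 4`
  refine ⟨fun x => Real.smoothTransition (4 * x 2 / a - 2) * b x, ?_, b.hasCompactSupport.mul_left,
    fun x hx hxρ => ?_, fun x hx => ?_⟩
  · refine ContDiff.mul (Real.smoothTransition.contDiff.comp ?_) b.contDiff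
    exact ((contDiff_const.mul (contDiff_coord 2)).div_const a).sub contDiff_const
  · have h1 : ∀ᶠ y : R3 in 𝓝 x, 3 * a / 4 < y 2 :=
      (contDiff_coord 2 (n := 1)).continuous.continuousAt.eventually (lt_mem_nhds (by linarith))
    have h2 : ∀ᶠ y : R3 in 𝓝 x, ‖y‖ < ρ + 1 :=
      continuous_norm.continuousAt.eventually (gt_mem_nhds (by linarith))
    filter_upwards [h1, h2] with y hy1 hy2
    have h3 : b y = 1 := b.one_of_mem_closedBall (by simpa using hy2.le)
    have h4 : 3 < 4 * y 2 / a := by rw [lt_div_iff₀ ha]; linarith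
    rw [h3, Real.smoothTransition.one_of_one_le (by linarith), mul_one]
  · have h1 : ∀ᶠ y : R3 in 𝓝 x, y 2 < a / 2 :=
      (contDiff_coord 2 (n := 1)).continuous.continuousAt.eventually (gt_mem_nhds (by linarith))
    filter_upwards [h1] with y hy
    have h4 : 4 * y 2 / a < 2 := by rw [div_lt_iff₀ ha]; linarith
    rw [Real.smoothTransition.zero_of_nonpos (by linarith), zero_mul]

namespace OddVortex

variable {v : R3 → R3} {a ρ : ℝ} (h : OddVortex v a ρ)

include h

theorem radius_pos : 0 < ρ := by
  obtain ⟨r, z, hr, -, hω⟩ := h.ne_zero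
  obtain ⟨h1, -, h2, -⟩ := h.bound r z hr hω
  exact h.pos.trans_le (h1.trans h2)

variable {ψ : R3 → ℝ} (h1 : ∀ x : R3, a ≤ x 2 → ‖x‖ ≤ ρ + ρ → ψ =ᶠ[𝓝 x] fun _ => 1)
  (h0 : ∀ x : R3, x 2 ≤ 0 → ψ =ᶠ[𝓝 x] fun _ => 0)

include h1 h0

theorem eventuallyEq_of_curl_ne_zero {x : R3} (hx : curl v x ≠ 0) :
    ψ =ᶠ[𝓝 x] fun _ => if x 2 ≤ 0 then 0 else 1 := by
  split_ifs with hz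
  · exact h0 x hz
  · have h2 := (h.bound_of_curl_ne_zero hx).2.1
    rw [abs_of_pos (not_le.1 hz)] at h2
    refine h1 x h2 ?_
    by_contra hfar
    exact hx (h.curl_eq_zero_of_far (not_le.1 hfar))

theorem impulse_mul_cutoff (x : R3) : impulse v x * ψ x = upperImpulse v x := by
  rw [upperImpulse_eq]
  by_cases hx : curl v x = 0
  · simp [impulse, hx]
  · rw [(h.eventuallyEq_of_curl_ne_zero h1 h0 hx).eq_of_nhds]
    split_ifs <;> simp

theorem impulseFlux_cutoff (x : R3) : impulseFlux v ψ x = 2 * upperLamb v x := by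
  rw [upperLamb_eq, impulseFlux]
  by_cases hx : curl v x = 0
  · simp [impulse, lamb, hx]
  · have h2 := h.eventuallyEq_of_curl_ne_zero h1 h0 hx
    rw [h2.eq_of_nhds, h2.fderiv_eq]
    split_ifs <;> simp

theorem Q_eq_integral_cutoff : Q v = -(1 / (2 * Real.pi)) * ∫ x, impulse v x * ψ x := by
  simp_rw [h.impulse_mul_cutoff h1 h0]
  rw [h.integral_upperImpulse]
  have := Real.pi_pos
  field_simp

end OddVortex

namespace RegularSolution

variable {u : ℝ → R3 → R3} (hu : RegularSolution u)

include hu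

theorem continuousOn_integral_impulse {ψ : R3 → ℝ} (hψ : Continuous ψ)
    (hc : HasCompactSupport ψ) : ContinuousOn (fun τ => ∫ x, impulse (u τ) x * ψ x) (Ici 0) := by
  refine continuousOn_integral_of_compact_support (k := tsupport ψ) hc ?_ ?_
  · exact hu.continuousOn_impulse.mul (hψ.comp continuous_snd).continuousOn
  · intro τ x _ hx
    rw [image_eq_zero_of_notMem_tsupport hx, mul_zero]

section

variable {T a ρ : ℝ} (h : ∀ t ∈ Icc 0 T, OddVortex (u t) a ρ)

include h

theorem continuousOn_Q : ContinuousOn (fun t => Q (u t)) (Icc 0 T) := by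
  rcases lt_or_ge T 0 with hT | hT
  · rw [Icc_eq_empty (by linarith)]; exact continuousOn_empty _
  have hv := h 0 ⟨le_rfl, hT⟩
  have hρ := hv.radius_pos
  obtain ⟨ψ, hψ, hc, h1, h0⟩ := exists_upperCutoff hv.pos (by positivity : 0 < ρ + ρ)
  refine ContinuousOn.congr (continuousOn_const.mul
    ((hu.continuousOn_integral_impulse hψ.continuous hc).mono fun t ht => ht.1))
    fun t ht => (h t ht).Q_eq_integral_cutoff h1 h0

theorem hasDerivAt_Q (haxi : ∀ t, 0 ≤ t → IsAxisymmetricSwirlFree (u t)) {t : ℝ}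
    (ht : t ∈ Ioo 0 T) :
    HasDerivAt (fun t => Q (u t)) (-(1 / Real.pi) * ∫ x, upperLamb (u t) x) t := by
  have ht' : t ∈ Icc 0 T := Ioo_subset_Icc_self ht
  have hv := h t ht'
  have hρ := hv.radius_pos
  obtain ⟨ψ, hψ, hc, h1, h0⟩ := exists_upperCutoff hv.pos (by positivity : 0 < ρ + ρ)
  have hd := (hu.hasDerivAt_integral_impulse haxi hψ hc ht.1).const_mul (-(1 / (2 * Real.pi)))
  simp_rw [hv.impulseFlux_cutoff h1 h0] at hd
  rw [integral_const_mul] at hd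
  refine (hd.congr_of_eventuallyEq ?_).congr_deriv (by ring)
  filter_upwards [Icc_mem_nhds ht.1 ht.2] with τ hτ
  exact (h τ hτ).Q_eq_integral_cutoff h1 h0

end

/-- Points where the vorticity does not vanish persist for a short time, so that `κ` is upper
semicontinuous in time. -/
theorem isOpen_kappa_lt (h : ∀ T, ∃ a ρ : ℝ, ∀ t ∈ Icc 0 T, OddVortex (u t) a ρ) (c : ℝ) :
    IsOpen {t : ℝ | 0 < t ∧ kappa (u t) < c} := by
  rw [isOpen_iff_mem_nhds]
  rintro t ⟨ht, hκ⟩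
  obtain ⟨a, ρ, hv⟩ := h (t + 1)
  have hvt := hv t ⟨ht.le, by linarith⟩
  obtain ⟨p, hp, q, hq, hpq⟩ := hvt.exists_kappa_eq
  have hpi := Real.pi_pos
  have hlt : kernel p q < 2 * Real.pi * c := by
    rw [← hpq]; gcongr
  have hbp := hvt.bound_of_mem hp
  have hbq := hvt.bound_of_mem hq
  have ha := hvt.pos
  have hopen : IsOpen
      {pq : (ℝ × ℝ) × (ℝ × ℝ) | 0 < pq.1.1 ∧ 0 < pq.2.1 ∧ 0 < pq.1.2 + pq.2.2} := by
    have c1 : Continuous fun pq : (ℝ × ℝ) × (ℝ × ℝ) => pq.1.1 := by fun_prop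
    have c2 : Continuous fun pq : (ℝ × ℝ) × (ℝ × ℝ) => pq.2.1 := by fun_prop
    have c3 : Continuous fun pq : (ℝ × ℝ) × (ℝ × ℝ) => pq.1.2 + pq.2.2 := by fun_prop
    exact (isOpen_lt continuous_const c1).inter
      ((isOpen_lt continuous_const c2).inter (isOpen_lt continuous_const c3))
  have hca := continuousOn_kernel.continuousAt (x := (p, q)) (hopen.mem_nhds
    ⟨ha.trans_le hbp.1, ha.trans_le hbq.1, add_pos (ha.trans_le hbp.2.1) (ha.trans_le hbq.2.1)⟩)
  have hev := hca.eventually (gt_mem_nhds hlt)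
  rw [nhds_prod_eq, eventually_prod_iff] at hev
  obtain ⟨P, hP, R, hR, hPR⟩ := hev
  have hpick : ∀ (p : ℝ × ℝ) (P : ℝ × ℝ → Prop), p ∈ vortSupportUpper (u t) →
      (∀ᶠ x in 𝓝 p, P x) → ∃ p', P p' ∧ ∀ᶠ τ in 𝓝 t, p' ∈ vortSupportUpper (u τ) := by
    intro p P hp hP
    have hz : ∀ᶠ x : ℝ × ℝ in 𝓝 p, 0 < x.2 :=
      continuous_snd.continuousAt.eventually
        (lt_mem_nhds (ha.trans_le (hvt.bound_of_mem hp).2.1))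
    obtain ⟨p', ⟨hp1, hp2⟩, hp3, hp4⟩ := mem_closure_iff_nhds.1 hp.1 _ (hP.and hz)
    refine ⟨p', hp1, ?_⟩
    have hc : ContinuousAt (fun τ => omegaTheta (u τ) p'.1 p'.2) t := by
      have hco : ContinuousOn (fun τ => omegaTheta (u τ) p'.1 p'.2) (Ici 0) :=
        (hu.continuousOn_curl 1).comp (f := fun τ : ℝ => (τ, !₂[p'.1, 0, p'.2]))
          (by fun_prop) fun τ hτ => ⟨hτ, mem_univ _⟩
      exact hco.continuousAt (Ici_mem_nhds ht)
    filter_upwards [hc.eventually_ne hp4] with τ hτ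
    exact OddVortex.mem_vortSupportUpper hp3 hp2.le hτ
  obtain ⟨p', hp', hpτ⟩ := hpick p P hp hP
  obtain ⟨q', hq', hqτ⟩ := hpick q R hq hR
  filter_upwards [hpτ, hqτ, Ioo_mem_nhds ht (by linarith : t < t + 1)] with τ h1 h2 h3
  refine ⟨h3.1, ?_⟩
  have h4 := (hv τ ⟨h3.1.le, h3.2.le⟩).kappa_le h1 h2
  have h5 := h4.trans_lt (hPR hp' hq')
  exact lt_of_mul_lt_mul_left h5 (by positivity)

theorem aestronglyMeasurable_kappa (h : ∀ T, ∃ a ρ : ℝ, ∀ t ∈ Icc 0 T, OddVortex (u t) a ρ) :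
    AEStronglyMeasurable (fun t => kappa (u t)) (volume.restrict (Ioi 0)) := by
  have hm : Measurable ((Ioi (0 : ℝ)).indicator fun t => kappa (u t)) := by
    refine measurable_of_Iio fun c => ?_
    have : (Ioi (0 : ℝ)).indicator (fun t => kappa (u t)) ⁻¹' Iio c =
        {t : ℝ | 0 < t ∧ kappa (u t) < c} ∪ {t : ℝ | t ≤ 0 ∧ 0 < c} := by
      ext t
      by_cases ht : 0 < t
      · simp [indicator, ht, not_le.2 ht]
      · simp [indicator, ht, not_lt.1 ht]
    rw [this]
    exact (hu.isOpen_kappa_lt h c).measurableSet.union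
      (measurableSet_Iic.inter (MeasurableSet.const _))
  exact hm.aestronglyMeasurable.congr
    (indicator_ae_eq_restrict measurableSet_Ioi)

/-- Integrating `(-1 / (2Q))' ≥ κ` over a finite time interval. -/
theorem intervalIntegral_kappa_le (h : ∀ T, ∃ a ρ : ℝ, ∀ t ∈ Icc 0 T, OddVortex (u t) a ρ) {T : ℝ}
    (hT : 0 ≤ T) : IntegrableOn (fun t => kappa (u t)) (Ioc 0 T) ∧
      ∫ t in (0 : ℝ)..T, kappa (u t) ≤ 1 / (2 * Q (u 0)) := by
  have haxi : ∀ t, 0 ≤ t → IsAxisymmetricSwirlFree (u t) := fun t ht => by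
    obtain ⟨a, ρ, hv⟩ := h t
    exact (hv t ⟨ht, le_rfl⟩).axisym
  obtain ⟨a, ρ, hv⟩ := h T
  have hQ : ∀ t ∈ Icc 0 T, 0 < Q (u t) := fun t ht => (hv t ht).Q_pos
  have hcont : ContinuousOn (fun t => -(1 / (2 * Q (u t)))) (Icc 0 T) :=
    (continuousOn_const.div (continuousOn_const.mul (hu.continuousOn_Q hv))
      fun t ht => (mul_pos two_pos (hQ t ht)).ne').neg
  set f' : ℝ → ℝ := fun t => (-(1 / Real.pi) * ∫ x, upperLamb (u t) x) / (2 * Q (u t) ^ 2) with hf'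
  have hderiv : ∀ t ∈ Ioo 0 T, HasDerivAt (fun t => -(1 / (2 * Q (u t)))) (f' t) t := by
    intro t ht
    have hq := hQ t (Ioo_subset_Icc_self ht)
    have h1 := (((hu.hasDerivAt_Q hv haxi ht).const_mul 2).fun_inv
      (mul_ne_zero two_ne_zero hq.ne')).fun_neg
    simp only [one_div] at h1 ⊢
    refine h1.congr_deriv ?_
    simp only [hf']
    field_simp
  have hle : ∀ t ∈ Ioo 0 T, kappa (u t) ≤ f' t := by
    intro t ht
    have ht' := Ioo_subset_Icc_self ht
    have hq := hQ t ht'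
    simp only [hf']
    rw [le_div_iff₀ (by positivity)]
    have := (hv t ht').kappa_mul_Q_sq_le
    linarith
  have hκ : ∀ t ∈ Ioo 0 T, 0 ≤ kappa (u t) := fun t ht =>
    (hv t (Ioo_subset_Icc_self ht)).kappa_pos.le
  have hfi : IntegrableOn f' (Ioc 0 T) := intervalIntegral.integrableOn_deriv_of_nonneg hcont hderiv
    fun t ht => (hκ t ht).trans (hle t ht)
  have hfi' : IntegrableOn f' (Ioo 0 T) := hfi.mono_set Ioo_subset_Ioc_self
  have hki : IntegrableOn (fun t => kappa (u t)) (Ioo 0 T) := by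
    refine Integrable.mono' hfi' ((hu.aestronglyMeasurable_kappa h).mono_measure
      (Measure.restrict_mono (fun t ht => ht.1) le_rfl)) ?_
    filter_upwards [ae_restrict_mem measurableSet_Ioo] with t ht
    rw [Real.norm_of_nonneg (hκ t ht)]
    exact hle t ht
  refine ⟨(integrableOn_Ioc_iff_integrableOn_Ioo).2 hki, ?_⟩
  have h1 := intervalIntegral.integral_eq_sub_of_hasDerivAt_of_le hT hcont hderiv
    ((intervalIntegrable_iff_integrableOn_Ioc_of_le hT).2 hfi)
  rw [intervalIntegral.integral_of_le hT, integral_Ioc_eq_integral_Ioo] at h1 ⊢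
  have h2 := setIntegral_mono_on hki hfi' measurableSet_Ioo hle
  have h3 := hQ T ⟨hT, le_rfl⟩
  have h4 : 0 < 1 / (2 * Q (u T)) := by positivity
  linarith

end RegularSolution

end AxisymEuler

end

theorem mainTheorem3 (s : ℝ) (hs : 5 / 2 < s)
    (u : ℝ → AxisymEuler.R3 → AxisymEuler.R3)
    (hu : AxisymEuler.IsGlobalEulerSolution s u)
    (haxi : ∀ t, 0 ≤ t → AxisymEuler.IsAxisymmetricSwirlFree (u t))
    (hne : ∃ t, 0 ≤ t ∧ ∃ x, u t x ≠ 0)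
    (hodd : ∀ r z : ℝ, 0 ≤ r →
      AxisymEuler.omegaTheta (u 0) r (-z) = -AxisymEuler.omegaTheta (u 0) r z)
    (hcpt : IsCompact (AxisymEuler.vortSupport (u 0)))
    (haway : ∀ q ∈ AxisymEuler.vortSupport (u 0), q.1 ≠ 0 ∧ q.2 ≠ 0)
    (hsign : ∀ r z : ℝ, 0 ≤ r → 0 ≤ z → AxisymEuler.omegaTheta (u 0) r z ≤ 0) :
    0 < AxisymEuler.Q (u 0) ∧
    (∀ t, 0 ≤ t → 0 < AxisymEuler.kappa (u t)) ∧
    IntegrableOn (fun t => AxisymEuler.kappa (u t)) (Ioi 0) ∧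
    ∫ t in Ioi (0 : ℝ), AxisymEuler.kappa (u t) ≤ 1 / (2 * AxisymEuler.Q (u 0)) := by
  have hr := hu.regularSolution hs
  have h := hr.oddVortex haxi hne hodd hcpt haway hsign
  have hQ : 0 < AxisymEuler.Q (u 0) := by
    obtain ⟨a, ρ, hv⟩ := h 0
    exact (hv 0 ⟨le_rfl, le_rfl⟩).Q_pos
  have hκ : ∀ t, 0 ≤ t → 0 < AxisymEuler.kappa (u t) := fun t ht => by
    obtain ⟨a, ρ, hv⟩ := h t
    exact (hv t ⟨ht, le_rfl⟩).kappa_pos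
  have hb : ∀ᶠ T : ℝ in atTop, ∫ t in (0 : ℝ)..T, AxisymEuler.kappa (u t) ≤
      1 / (2 * AxisymEuler.Q (u 0)) := by
    filter_upwards [eventually_ge_atTop 0] with T hT
    exact (hr.intervalIntegral_kappa_le h hT).2
  have hi : IntegrableOn (fun t => AxisymEuler.kappa (u t)) (Ioi 0) := by
    refine integrableOn_Ioi_of_intervalIntegral_norm_bounded (l := atTop) (b := id)
      (1 / (2 * AxisymEuler.Q (u 0))) 0 (fun T => ?_) tendsto_id ?_
    · rcases le_total 0 T with hT | hT
      · exact (hr.intervalIntegral_kappa_le h hT).1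
      · simp [Ioc_eq_empty (not_lt.2 hT)]
    · filter_upwards [hb, eventually_ge_atTop 0] with T hT hT0
      refine le_of_eq_of_le ?_ hT
      refine intervalIntegral.integral_congr fun t ht => ?_
      have ht' : t ∈ Icc 0 T := by rwa [← uIcc_of_le hT0]
      exact Real.norm_of_nonneg (hκ t ht'.1).le
  exact ⟨hQ, hκ, hi, le_of_tendsto (intervalIntegral_tendsto_integral_Ioi 0 hi tendsto_id) hb⟩
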